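/- **Setting.** Let $\underline p=(p_1\ge\dots\ge p_r>0)$ be a partition with $r\ge1$ parts and let $r_1$ be the multiplicity of $p_1$. Times $t_j^{(a)}$ ($1\le a\le r$, $j\ge1$) are real or complex; functions are complex valued, defined on a set of times that is open with respect to variations of finitely many times, and smooth in the times (every restriction to finitely many variables is $C^\infty$, i.e. holomorphic for complex times). For $\underline m\in\mathbb Z^r$ put $|\underline m|=\sum_i m_i$, $|\underline m|_a=\sum_{i\le a}m_i$; $\underline e_a$ is the standard basis. Put $$e_+^{(a)}(\underline{t},z)=\exp\Big(\sum_{j\ge1}z^jt_j^{(a)}\Big),\qquad e_-^{(a)}\big(\tfrac{\partial}{\partial\underline t},z\big)=\exp\Big(-\sum_{j\ge1}\tfrac{z^{-j}}{j}\tfrac{\partial}{\partial t_j^{(a)}}\Big).$$ Let $k\in\mathbb Z$ and let $\{\tau^{\underline m}(\underline t)\}_{|\underline m|=k}$ be a tau-function of charge $k$ of the $\underline p$-KdV hierarchy, that is, $$\operatorname{Res}_z\sum_{a=1}^r(-1)^{|\underline m'+\underline m''|_{a-1}}z^{m_a'-m_a''+\ell p_a-2}\,e_+^{(a)}(\underline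 t'-\underline t'',z)\,e_-^{(a)}\big(\tfrac{\partial}{\partial\underline t'}-\tfrac{\partial}{\partial\underline t''},z\big)\tau^{\underline m'-\underline e_a}(\underline t')\tau^{\underline m''+\underline e_a}(\underline t'')=0$$ for all $\ell\ge0$, $|\underline m'|=k+1$, $|\underline m''|=k-1$, where the equation means the collection of all equations obtained by applying a finite product of derivatives $\partial/\partial t_j'^{(b)}$ inside the residue and then setting $\underline t'=\underline t''$. Fix $\underline m$ with $|\underline m|=k$. **The operators.** Where $\tau^{\underline m}\ne0$, define $P^\pm_{ab}(\underline t,z)$ ($1\le a,b\le r$) by $$P^{\pm}_{ab}(\underline t,\pm z)=(-1)^{|\underline e_a|_{b-1}}\frac{z^{\delta_{ab}-1}}{\tau^{\underline m}(\underline t)}\,e_-^{(b)}\big(\pm\tfrac{\partial}{\partial\underline t},z\big)\tau^{\underline m\pm\underline e_a\mp\underline e_b}(\underline t).$$ Let $Q^\pm_{ab}(x,\underline t,z)=\sum_{n\ge0}Q^\pm_{ab;n}(x,\underline t)z^{-n}$ be obtained from $P^\pm_{ab}$ by setting $t_j^{(a)}=0$ for $a>r_1$ and replacing $t_1^{(a)}$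 by $t_1^{(a)}+x$ for $a\le r_1$. Let $\partial=\partial/\partial x$, let $Q_{11}=\big(Q^+_{ab}(x,\underline t,\partial)\big)_{a,b\le r_1}$ be the matrix pseudodifferential operator with these symbols ($z^{-n}\mapsto\partial^{-n}$), and put $$\mathcal L_a=Q_{11}\circ E_{aa}\partial\circ Q_{11}^{-1}\ (a\le r_1),\qquad \widetilde{\mathcal L}(x,t,\partial)=\sum_{a=1}^{r_1}\mathcal L_a^{p_1}\Big|_{t_j^{(a)}=t_j\ \forall a\le r_1},$$ an $r_1\times r_1$ matrix pseudodifferential operator whose coefficients are smooth functions of $x$ and $t=(t_j)_{j\ge1}$ on the set where the correspondingly restricted $\tau^{\underline m}$ does not vanish. The subscript $+$ denotes the differential part. Let $\varepsilon$ be any $p_1$-th root of $-1$ in the field of times, $\tilde t=(\varepsilon^jt_j)_j$, and let all $Q^\pm$ below be taken at identified times. Define differential operators $W_{ab}=\sum_{j=0}^{\min(p_a,p_b)-1}w_{ba;j}(x,t)(-\partial)^j$ as follows. For $a\le r_1<b$: $$w_{ba;j}=-\sum_{i=0}^{j}\frac{x^i}{i!}Q^+_{ab;j-i+1}(-x,\tilde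 t).$$ For $b\le r_1<a$ the $w_{ba;j}$ are the coefficients in $$\sum_jw_{ba;j}(-\partial)^j=\sum_{j=0}^{p_a-1}\sum_{i=0}^j\partial^j\circ Q^-_{ba;j-i+1}(-x,\tilde t)\frac{x^i}{i!}.$$ For $a,b\le r_1$ they are the coefficients of $(-\partial)^j$, $0\le j<p_1$, in the entries of $$-\widetilde{\mathcal L}(-x,\tilde t,-\partial)_++\mathbb 1(-\partial)^{p_1}-\big(W_{12}\circ(-\partial)^{-\underline q}\circ W_{21}\big)_+,$$ where $W_{11},W_{12},W_{21}$ are the blocks of $(W_{ab})$ for the splitting $\{1,\dots,r_1\}\sqcup\{r_1+1,\dots,r\}$ and $(-\partial)^{-\underline q}=\sum_{a>r_1}E_{aa}(-\partial)^{-p_a}$. Put $$\mathcal L(x,t,\partial)=-\mathbb 1(-\partial)^{p_1}+W_{11}+W_{12}\circ(-\partial)^{-\underline q}\circ W_{21}.$$ **Theorem.** The operator $Q_{11}$ is invertible, and: 1. $\widetilde{\mathcal L}$ has a unique $p_1$-th root $\widetilde{\mathcal L}^{1/p_1}$ of the form $\mathbb 1\partial+(\text{order}\le0)$, and $$\frac{\partial\widetilde{\mathcal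 L}}{\partial t_j}=\big[(\widetilde{\mathcal L}^{j/p_1})_+,\widetilde{\mathcal L}\big]\qquad\text{for all }j\ge1.$$ 2. For every $\varepsilon$ as above, $\mathcal L(x,t,\partial)=-\widetilde{\mathcal L}(-x,\tilde t,-\partial)$; moreover $\mathcal L$ has a unique $p_1$-th root $\mathcal L^{1/p_1}$ of the form $-\varepsilon\mathbb 1\partial+(\text{order}\le0)$, and $$\frac{\partial\mathcal L}{\partial t_j}=\big[(\mathcal L^{j/p_1})_+,\mathcal L\big]\qquad\text{for all }j\ge1.$$ -/

import Mathlib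

open scoped BigOperators Topology ContDiff

noncomputable section


/-! ### Pseudodifferential operators over a differential ring -/

/-- Formal series `∑ a_i ∂^i` (`i ∈ ℤ`) whose coefficients vanish for all large `i`. -/
def psiSubgroup (R : Type*) [CommRing R] : AddSubgroup (ℤ → R) where
  carrier := {f | ∃ N : ℤ, ∀ i, N < i → f i = 0}
  zero_mem' := ⟨0, fun _ _ => rfl⟩
  add_mem' := by
    rintro f g ⟨N, hN⟩ ⟨M, hM⟩
    refine ⟨max N M, fun i hi => ?_⟩
    simp [hN i (lt_of_le_of_lt (le_max_left _ _) hi), hM i (lt_of_le_of_lt (le_max_right _ _) hi)]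
  neg_mem' := by
    rintro f ⟨N, hN⟩
    exact ⟨N, fun i hi => by simp [hN i hi]⟩

/-- The ring `R((∂⁻¹))` of scalar pseudodifferential operators over the differential ring `R`. -/
def PsiDO (R : Type*) [CommRing R] : Type _ := psiSubgroup R

namespace PsiDO

variable {R : Type*} [CommRing R]

instance : AddCommGroup (PsiDO R) := inferInstanceAs (AddCommGroup (psiSubgroup R))

/-- The coefficient of `∂^i` (coefficients are written to the left of the powers of `∂`). -/
def coeff (A : PsiDO R) (i : ℤ) : R := A.1 i

/-- Build an operator from its coefficients. -/
def mk (f : ℤ → R) (h : ∃ N : ℤ, ∀ i, N < i → f i = 0) : PsiDO R := ⟨f, h⟩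

theorem bdd (A : PsiDO R) : ∃ N : ℤ, ∀ i, N < i → A.coeff i = 0 := A.2

@[simp] theorem coeff_mk (f : ℤ → R) (h : ∃ N : ℤ, ∀ i, N < i → f i = 0) (i : ℤ) :
    (mk f h).coeff i = f i := rfl

@[ext] theorem ext {A B : PsiDO R} (h : ∀ i, A.coeff i = B.coeff i) : A = B :=
  Subtype.ext (funext h)

@[simp] theorem coeff_zero (i : ℤ) : (0 : PsiDO R).coeff i = 0 := rfl

@[simp] theorem coeff_add (A B : PsiDO R) (i : ℤ) :
    (A + B).coeff i = A.coeff i + B.coeff i := rfl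

/-- The monomial `a ∂^n`. -/
def mono (a : R) (n : ℤ) : PsiDO R :=
  mk (fun i => if i = n then a else 0) ⟨n, fun _ hi => if_neg hi.ne'⟩

/-- The operator `∑_{n ≥ 0} c_n ∂^{-n}`. -/
def ofSymbol (c : ℕ → R) : PsiDO R :=
  mk (fun i => if i ≤ 0 then c (-i).toNat else 0) ⟨0, fun _ hi => if_neg hi.not_ge⟩

/-- The differential part `A_+`. -/
def pos (A : PsiDO R) : PsiDO R :=
  mk (fun i => if 0 ≤ i then A.coeff i else 0)
    (A.bdd.imp fun N hN i hi => by simp [hN i hi])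

/-- Apply an additive map to all coefficients. -/
def mapCoeff {S : Type*} [CommRing S] (φ : R →+ S) (A : PsiDO R) : PsiDO S :=
  mk (fun i => φ (A.coeff i)) (A.bdd.imp fun N hN i hi => by simp [hN i hi])

/-- Apply a ring homomorphism to all coefficients and replace `∂` by `-∂`. -/
def reflect {S : Type*} [CommRing S] (φ : R →+* S) (A : PsiDO R) : PsiDO S :=
  mk (fun i => (Int.negOnePow i : ℤ) • φ (A.coeff i))
    (A.bdd.imp fun N hN i hi => by simp [hN i hi])

instance : One (PsiDO R) := ⟨mono 1 0⟩

theorem coeff_one (k : ℤ) : (1 : PsiDO R).coeff k = if k = 0 then 1 else 0 := rfl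

/-- A common bound for three operators. -/
theorem exists_bound (A B C : PsiDO R) : ∃ N : ℤ, 0 ≤ N ∧ (∀ i, N < i → A.coeff i = 0) ∧
    (∀ i, N < i → B.coeff i = 0) ∧ (∀ i, N < i → C.coeff i = 0) := by
  obtain ⟨a, ha⟩ := A.bdd
  obtain ⟨b, hb⟩ := B.bdd
  obtain ⟨c, hc⟩ := C.bdd
  exact ⟨max 0 (max a (max b c)), by omega, fun i hi => ha i (by omega),
    fun i hi => hb i (by omega), fun i hi => hc i (by omega)⟩

variable [Differential R]

/-- The coefficient of `∂^k` in `A ∘ B`, from the rule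
`a ∂^i ∘ b ∂^j = ∑_{n ≥ 0} (i choose n) a b^{(n)} ∂^{i+j-n}` (with `j = k - i + n`);
only finitely many terms are nonzero. -/
def mulCoeff (A B : PsiDO R) (k : ℤ) : R :=
  ∑ᶠ (i : ℤ) (n : ℕ), Ring.choose i n •
    (A.coeff i * (Differential.deriv (R := R))^[n] (B.coeff (k - i + n)))

theorem iter_zero (n : ℕ) : (Differential.deriv (R := R))^[n] (0 : R) = 0 :=
  Function.iterate_fixed (map_zero _) n

theorem iter_add (n : ℕ) (a b : R) : (Differential.deriv (R := R))^[n] (a + b) =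
    (Differential.deriv (R := R))^[n] a + (Differential.deriv (R := R))^[n] b := by
  induction n generalizing a b with
  | zero => rfl
  | succ n ih => simp [Function.iterate_succ_apply, ih]

theorem iter_sum {ι : Type*} (s : Finset ι) (n : ℕ) (f : ι → R) :
    (Differential.deriv (R := R))^[n] (∑ i ∈ s, f i) =
      ∑ i ∈ s, (Differential.deriv (R := R))^[n] (f i) := by
  classical
  induction s using Finset.induction_on with
  | empty => simp
  | insert a s ha ih => simp [Finset.sum_insert ha, ih]

theorem iter_zsmul (n : ℕ) (c : ℤ) (a : R) : (Differential.deriv (R := R))^[n] (c • a) =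
    c • (Differential.deriv (R := R))^[n] a := by
  induction n generalizing a with
  | zero => rfl
  | succ n ih => simp only [Function.iterate_succ_apply, Derivation.map_smul, ih]

theorem iter_mul (n : ℕ) (a b : R) : (Differential.deriv (R := R))^[n] (a * b) =
    ∑ x ∈ Finset.HasAntidiagonal.antidiagonal n, (n.choose x.1 : ℤ) •
      ((Differential.deriv (R := R))^[x.1] a * (Differential.deriv (R := R))^[x.2] b) := by
  induction n with
  | zero => simp
  | succ n ih =>
    rw [Function.iterate_succ_apply', ih, map_sum]
    have h1 := Finset.sum_antidiagonal_choose_succ_nsmul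
      (fun i j => (Differential.deriv (R := R))^[i] a * (Differential.deriv (R := R))^[j] b) n
    simp only [natCast_zsmul]
    rw [h1, ← Finset.sum_add_distrib]
    refine Finset.sum_congr rfl fun x hx => ?_
    have hx' : x.1 + x.2 = n := Finset.HasAntidiagonal.mem_antidiagonal.mp hx
    have h2 : n.choose x.2 = n.choose x.1 := by
      rw [← hx', Nat.choose_symm_add]
    simp only [map_nsmul, Derivation.leibniz, Function.iterate_succ_apply', smul_eq_mul, h2]
    rw [← smul_add]
    congr 1
    ring

/-- The contribution of the coefficients of `∂^i` and `∂^j` to that of `∂^k`. -/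
def mulTerm (a b : R) (i j k : ℤ) : R :=
  if k ≤ i + j then
    Ring.choose i (i + j - k).toNat •
      (a * (Differential.deriv (R := R))^[(i + j - k).toNat] b) else 0

theorem mulTerm_zero_left (b : R) (i j k : ℤ) : mulTerm 0 b i j k = 0 := by
  unfold mulTerm; simp

theorem mulTerm_zero_right (a : R) (i j k : ℤ) : mulTerm a 0 i j k = 0 := by
  unfold mulTerm; simp

theorem mulTerm_of_lt (a b : R) {i j k : ℤ} (h : i + j < k) : mulTerm a b i j k = 0 :=
  if_neg h.not_ge

theorem mulCoeff_eq (A B : PsiDO R) (k N : ℤ) (S T : Finset ℤ)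
    (hA : ∀ i, N < i → A.coeff i = 0) (hB : ∀ i, N < i → B.coeff i = 0)
    (hS : ∀ i, k - N ≤ i → i ≤ N → i ∈ S) (hT : ∀ i, k - N ≤ i → i ≤ N → i ∈ T) :
    mulCoeff A B k = ∑ i ∈ S, ∑ j ∈ T, mulTerm (A.coeff i) (B.coeff j) i j k := by
  unfold mulCoeff
  rw [finsum_eq_sum_of_support_subset (s := S)]
  · refine Finset.sum_congr rfl fun i _ => ?_
    rw [← finsum_eq_sum_of_support_subset
      (f := fun j => mulTerm (A.coeff i) (B.coeff j) i j k) (s := T)]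
    · have hinj : Function.Injective (fun n : ℕ => k - i + (n : ℤ)) := by
        intro a b h
        simpa using h
      have h3 := finsum_mem_range (f := fun j => mulTerm (A.coeff i) (B.coeff j) i j k) hinj
      have h4 : (∑ᶠ j ∈ Set.range (fun n : ℕ => k - i + (n : ℤ)),
          mulTerm (A.coeff i) (B.coeff j) i j k) =
          ∑ᶠ j, mulTerm (A.coeff i) (B.coeff j) i j k := by
        refine finsum_congr fun j => ?_
        by_cases hj : j ∈ Set.range (fun n : ℕ => k - i + (n : ℤ))
        · simp only [hj, finsum_true]
        · simp only [hj, finsum_false]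
          rw [mulTerm, if_neg]
          intro hk
          exact hj ⟨(i + j - k).toNat, by simp only; omega⟩
      rw [← h4, h3]
      refine finsum_congr fun n => ?_
      have : (i + (k - i + (n : ℤ)) - k).toNat = n := by omega
      rw [mulTerm, if_pos (by omega), this]
    · intro j hj
      by_contra hc
      apply hj
      change mulTerm (A.coeff i) (B.coeff j) i j k = 0
      by_cases h1 : N < i
      · rw [hA i h1, mulTerm_zero_left]
      by_cases h2 : N < j
      · rw [hB j h2, mulTerm_zero_right]
      · refine mulTerm_of_lt _ _ ?_
        by_contra h3
        exact hc (hT j (by omega) (by omega))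
  · intro i hi
    by_contra hc
    apply hi
    rw [← finsum_zero (α := ℕ)]
    refine finsum_congr fun n => ?_
    by_cases h1 : N < i
    · rw [hA i h1]; simp
    · have h2 : i < k - N := by
        by_contra h3
        exact hc (hS i (by omega) (by omega))
      rw [hB _ (by omega), iter_zero]; simp

instance : Mul (PsiDO R) where
  mul A B := mk (mulCoeff A B) (by
    obtain ⟨N, hN⟩ := A.bdd
    obtain ⟨M, hM⟩ := B.bdd
    refine ⟨N + M, fun k hk => ?_⟩
    unfold mulCoeff
    rw [← finsum_zero (α := ℤ)]
    refine finsum_congr fun i => ?_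
    rw [← finsum_zero (α := ℕ)]
    refine finsum_congr fun n => ?_
    by_cases hi : N < i
    · rw [hN i hi]; simp
    · rw [hM _ (by omega), iter_zero]; simp)

theorem coeff_mul (A B : PsiDO R) (k : ℤ) : (A * B).coeff k = mulCoeff A B k := rfl

theorem mulTerm_add_left (a a' b : R) (i j k : ℤ) :
    mulTerm (a + a') b i j k = mulTerm a b i j k + mulTerm a' b i j k := by
  unfold mulTerm
  split_ifs
  · rw [add_mul, smul_add]
  · simp

theorem mulTerm_add_right (a b b' : R) (i j k : ℤ) :
    mulTerm a (b + b') i j k = mulTerm a b i j k + mulTerm a b' i j k := by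
  unfold mulTerm
  split_ifs
  · rw [iter_add, mul_add, smul_add]
  · simp

theorem mul_bound (A B : PsiDO R) (N : ℤ) (hA : ∀ i, N < i → A.coeff i = 0)
    (hB : ∀ i, N < i → B.coeff i = 0) (k : ℤ) (hk : 2 * N < k) : (A * B).coeff k = 0 := by
  rw [coeff_mul, mulCoeff_eq A B k N ∅ ∅ hA hB (by omega) (by omega)]
  simp

theorem assoc_aux (i j : ℤ) (s : ℕ) (b c : R) :
    (∑ x ∈ Finset.HasAntidiagonal.antidiagonal s, (Ring.choose i x.1 * Ring.choose (i + j - x.1) x.2) •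
      ((Differential.deriv (R := R))^[x.1] b * (Differential.deriv (R := R))^[x.2] c)) =
    ∑ x ∈ Finset.HasAntidiagonal.antidiagonal s, (Ring.choose i x.1 * Ring.choose j x.2) •
      (Differential.deriv (R := R))^[x.1] (b * (Differential.deriv (R := R))^[x.2] c) := by
  simp only [iter_mul, Finset.smul_sum, ← Function.iterate_add_apply]
  have hV : ∀ x : ℕ × ℕ, Ring.choose (i + j - x.1) x.2 =
      ∑ y ∈ Finset.HasAntidiagonal.antidiagonal x.2, Ring.choose (i - x.1) y.1 * Ring.choose j y.2 := by
    intro x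
    rw [← Ring.add_choose_eq x.2 (Commute.all (i - (x.1 : ℤ)) j)]
    congr 1; ring
  simp only [hV, Finset.mul_sum, Finset.sum_smul]
  rw [Finset.sum_sigma', Finset.sum_sigma']
  refine Finset.sum_bij' (fun x _ => ⟨(x.1.1 + x.2.1, x.2.2), (x.1.1, x.2.1)⟩)
    (fun x _ => ⟨(x.2.1, x.2.2 + x.1.2), (x.2.2, x.1.2)⟩) ?_ ?_ ?_ ?_ ?_
  · rintro ⟨⟨n, u⟩, ⟨w, v⟩⟩ h
    simp only [Finset.mem_sigma, Finset.HasAntidiagonal.mem_antidiagonal] at h ⊢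
    obtain ⟨h1, h2⟩ := h
    change n + u = s at h1
    exact ⟨by omega, by simp⟩
  · rintro ⟨⟨n, u⟩, ⟨w, v⟩⟩ h
    simp only [Finset.mem_sigma, Finset.HasAntidiagonal.mem_antidiagonal] at h ⊢
    obtain ⟨h1, h2⟩ := h
    change n + u = s at h1
    exact ⟨by omega, by simp⟩
  · rintro ⟨⟨n, u⟩, ⟨w, v⟩⟩ h
    simp only [Finset.mem_sigma, Finset.HasAntidiagonal.mem_antidiagonal] at h
    obtain ⟨h1, h2⟩ := h
    subst h2; rfl
  · rintro ⟨⟨n, u⟩, ⟨w, v⟩⟩ h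
    simp only [Finset.mem_sigma, Finset.HasAntidiagonal.mem_antidiagonal] at h
    obtain ⟨h1, h2⟩ := h
    subst h2; rfl
  · rintro ⟨⟨n, u⟩, ⟨w, v⟩⟩ h
    simp only [Finset.mem_sigma, Finset.HasAntidiagonal.mem_antidiagonal] at h
    obtain ⟨h1, h2⟩ := h
    subst h2
    simp only [smul_smul]
    congr 1
    have h3 := Ring.choose_smul_choose i (Nat.le_add_right n w)
    rw [nsmul_eq_mul, Nat.add_sub_cancel_left] at h3
    linear_combination (- Ring.choose j v) * h3

theorem mulTerm_sum_left {ι : Type*} (s : Finset ι) (f : ι → R) (b : R) (i j k : ℤ) :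
    mulTerm (∑ x ∈ s, f x) b i j k = ∑ x ∈ s, mulTerm (f x) b i j k :=
  map_sum (⟨⟨fun a => mulTerm a b i j k, mulTerm_zero_left b i j k⟩,
    fun a a' => mulTerm_add_left a a' b i j k⟩ : R →+ R) f s

theorem mulTerm_sum_right {ι : Type*} (s : Finset ι) (a : R) (f : ι → R) (i j k : ℤ) :
    mulTerm a (∑ x ∈ s, f x) i j k = ∑ x ∈ s, mulTerm a (f x) i j k :=
  map_sum (⟨⟨fun b => mulTerm a b i j k, mulTerm_zero_right a i j k⟩,
    fun b b' => mulTerm_add_right a b b' i j k⟩ : R →+ R) f s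

theorem mulTerm_assoc (a b c : R) (i j q k : ℤ) (S : Finset ℤ)
    (hS : ∀ l, min (k - q) (k - i) ≤ l → l ≤ max (i + j) (j + q) → l ∈ S) :
    ∑ l ∈ S, mulTerm (mulTerm a b i j l) c l q k =
      ∑ l ∈ S, mulTerm a (mulTerm b c j q l) i l k := by
  by_cases hs : i + j + q < k
  · rw [Finset.sum_eq_zero, Finset.sum_eq_zero]
    · intro l _
      by_cases h : i + l < k
      · exact mulTerm_of_lt _ _ h
      · rw [mulTerm_of_lt b c (by omega), mulTerm_zero_right]
    · intro l _
      by_cases h : l + q < k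
      · exact mulTerm_of_lt _ _ h
      · rw [mulTerm_of_lt a b (by omega), mulTerm_zero_left]
  · obtain ⟨s, hs'⟩ : ∃ s : ℕ, i + j + q - k = s := ⟨_, (Int.toNat_of_nonneg (by omega)).symm⟩
    have key := congrArg (fun y => a * y) (assoc_aux i j s b c)
    simp only [Finset.mul_sum] at key
    refine Eq.trans (Eq.symm ?_) (key.trans ?_)
    · refine Finset.sum_of_injOn (fun x : ℕ × ℕ => i + j - (x.1 : ℤ)) ?_ ?_ ?_ ?_
      · rintro ⟨n, u⟩ h ⟨n', u'⟩ h' he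
        simp only [Finset.mem_coe, Finset.HasAntidiagonal.mem_antidiagonal] at h h' he
        ext <;> simp only <;> omega
      · rintro ⟨n, u⟩ h
        simp only [Finset.mem_coe, Finset.HasAntidiagonal.mem_antidiagonal] at h ⊢
        exact hS _ (by omega) (by omega)
      · intro l _ hl
        by_cases h : l + q < k
        · exact mulTerm_of_lt _ _ h
        by_cases h' : i + j < l
        · rw [mulTerm_of_lt a b h', mulTerm_zero_left]
        · exact absurd ⟨((i + j - l).toNat, (l + q - k).toNat), by
            simp only [Finset.mem_coe, Finset.HasAntidiagonal.mem_antidiagonal]; omega,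
            by simp only; omega⟩ hl
      · rintro ⟨n, u⟩ h
        simp only [Finset.HasAntidiagonal.mem_antidiagonal] at h ⊢
        have e1 : (i + j - (i + j - (n : ℤ))).toNat = n := by omega
        have e2 : (i + j - (n : ℤ) + q - k).toNat = u := by omega
        rw [mulTerm, if_pos (by omega), mulTerm, if_pos (by omega), e1, e2]
        simp only [zsmul_eq_mul]
        push_cast
        ring
    · refine Finset.sum_of_injOn (fun x : ℕ × ℕ => j + q - (x.2 : ℤ)) ?_ ?_ ?_ ?_
      · rintro ⟨n, u⟩ h ⟨n', u'⟩ h' he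
        simp only [Finset.mem_coe, Finset.HasAntidiagonal.mem_antidiagonal] at h h' he
        ext <;> simp only <;> omega
      · rintro ⟨n, u⟩ h
        simp only [Finset.mem_coe, Finset.HasAntidiagonal.mem_antidiagonal] at h ⊢
        exact hS _ (by omega) (by omega)
      · intro l _ hl
        by_cases h : i + l < k
        · exact mulTerm_of_lt _ _ h
        by_cases h' : j + q < l
        · rw [mulTerm_of_lt b c h', mulTerm_zero_right]
        · exact absurd ⟨((i + l - k).toNat, (j + q - l).toNat), by
            simp only [Finset.mem_coe, Finset.HasAntidiagonal.mem_antidiagonal]; omega,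
            by simp only; omega⟩ hl
      · rintro ⟨n, u⟩ h
        simp only [Finset.HasAntidiagonal.mem_antidiagonal] at h ⊢
        have e1 : (j + q - (j + q - (u : ℤ))).toNat = u := by omega
        have e2 : (i + (j + q - (u : ℤ)) - k).toNat = n := by omega
        rw [mulTerm, if_pos (by omega), mulTerm, if_pos (by omega), e1, e2, iter_zsmul]
        simp only [zsmul_eq_mul]
        push_cast
        ring

theorem mul_assoc' (A B C : PsiDO R) : A * B * C = A * (B * C) := by
  obtain ⟨N, hN, hA, hB, hC⟩ := exists_bound A B C
  ext k
  set K : ℤ := 2 * N + |k| with hK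
  have hk1 := neg_abs_le k
  have hk2 := le_abs_self k
  set S : Finset ℤ := Finset.Icc (-K) K with hSdef
  set T : Finset ℤ := Finset.Icc (-(K + N)) (K + N) with hTdef
  have hAB := mul_bound A B N hA hB
  have hBC := mul_bound B C N hB hC
  have hmS : ∀ i, k - 2 * N ≤ i → i ≤ 2 * N → i ∈ S := fun i h1 h2 => by
    rw [hSdef, Finset.mem_Icc]; omega
  have hmT : ∀ i, k - 2 * N ≤ i → i ≤ 2 * N → i ∈ T := fun i h1 h2 => by
    rw [hTdef, Finset.mem_Icc]; omega
  have hin : ∀ (X Y : PsiDO R), (∀ i, N < i → X.coeff i = 0) → (∀ i, N < i → Y.coeff i = 0) →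
      ∀ l ∈ S, (X * Y).coeff l =
        ∑ i ∈ T, ∑ j ∈ T, mulTerm (X.coeff i) (Y.coeff j) i j l := by
    intro X Y hX hY l hl
    rw [hSdef, Finset.mem_Icc] at hl
    refine mulCoeff_eq X Y l N T T hX hY ?_ ?_ <;>
      (intro i h1 h2; rw [hTdef, Finset.mem_Icc]; omega)
  rw [coeff_mul, coeff_mul,
    mulCoeff_eq (A * B) C k (2 * N) S T hAB (fun i hi => hC i (by omega)) hmS hmT,
    mulCoeff_eq A (B * C) k (2 * N) T S (fun i hi => hA i (by omega)) hBC hmT hmS]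
  have e1 : ∀ l ∈ S, ∑ q ∈ T, mulTerm ((A * B).coeff l) (C.coeff q) l q k =
      ∑ i ∈ T, ∑ j ∈ T, ∑ q ∈ T,
        mulTerm (mulTerm (A.coeff i) (B.coeff j) i j l) (C.coeff q) l q k := by
    intro l hl
    rw [hin A B hA hB l hl]
    simp only [mulTerm_sum_left]
    rw [Finset.sum_comm]
    refine Finset.sum_congr rfl fun i _ => ?_
    rw [Finset.sum_comm]
  have e2 : ∀ i ∈ T, ∑ l ∈ S, mulTerm (A.coeff i) ((B * C).coeff l) i l k =
      ∑ j ∈ T, ∑ q ∈ T, ∑ l ∈ S,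
        mulTerm (A.coeff i) (mulTerm (B.coeff j) (C.coeff q) j q l) i l k := by
    intro i _
    rw [Finset.sum_congr rfl fun l hl => by rw [hin B C hB hC l hl]]
    simp only [mulTerm_sum_right]
    rw [Finset.sum_comm]
    refine Finset.sum_congr rfl fun j _ => ?_
    rw [Finset.sum_comm]
  rw [Finset.sum_congr rfl e1, Finset.sum_congr rfl e2, Finset.sum_comm]
  refine Finset.sum_congr rfl fun i _ => ?_
  rw [Finset.sum_comm]
  refine Finset.sum_congr rfl fun j _ => ?_
  rw [Finset.sum_comm]
  refine Finset.sum_congr rfl fun q _ => ?_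
  by_cases hi : N < i
  · simp [hA i hi, mulTerm_zero_left]
  by_cases hj : N < j
  · simp [hB j hj, mulTerm_zero_left, mulTerm_zero_right]
  by_cases hq : N < q
  · simp [hC q hq, mulTerm_zero_right]
  · refine mulTerm_assoc _ _ _ _ _ _ _ _ fun l h1 h2 => hmS l (by omega) (by omega)

theorem left_distrib' (A B C : PsiDO R) : A * (B + C) = A * B + A * C := by
  obtain ⟨N, -, hA, hB, hC⟩ := exists_bound A B C
  ext k
  have hT : ∀ i, k - N ≤ i → i ≤ N → i ∈ Finset.Icc (k - N) N := fun i h1 h2 =>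
    Finset.mem_Icc.mpr ⟨h1, h2⟩
  rw [coeff_add, coeff_mul, coeff_mul, coeff_mul,
    mulCoeff_eq A (B + C) k N _ _ hA (fun i hi => by rw [coeff_add, hB i hi, hC i hi, add_zero])
      hT hT, mulCoeff_eq A B k N _ _ hA hB hT hT, mulCoeff_eq A C k N _ _ hA hC hT hT]
  simp only [coeff_add, mulTerm_add_right, Finset.sum_add_distrib]

theorem right_distrib' (A B C : PsiDO R) : (A + B) * C = A * C + B * C := by
  obtain ⟨N, -, hA, hB, hC⟩ := exists_bound A B C
  ext k
  have hT : ∀ i, k - N ≤ i → i ≤ N → i ∈ Finset.Icc (k - N) N := fun i h1 h2 =>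
    Finset.mem_Icc.mpr ⟨h1, h2⟩
  rw [coeff_add, coeff_mul, coeff_mul, coeff_mul,
    mulCoeff_eq (A + B) C k N _ _ (fun i hi => by rw [coeff_add, hA i hi, hB i hi, add_zero]) hC
      hT hT, mulCoeff_eq A C k N _ _ hA hC hT hT, mulCoeff_eq B C k N _ _ hB hC hT hT]
  simp only [coeff_add, mulTerm_add_left, Finset.sum_add_distrib]

theorem one_mul' (A : PsiDO R) : 1 * A = A := by
  ext k
  rw [coeff_mul, mulCoeff, finsum_eq_single _ (0 : ℤ), finsum_eq_single _ (0 : ℕ)]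
  · simp [coeff_one]
  · intro n hn
    rw [Ring.choose_zero_pos ℤ (Nat.pos_of_ne_zero hn)]
    simp
  · intro i hi
    rw [coeff_one, if_neg hi]
    simp

theorem mul_one' (A : PsiDO R) : A * 1 = A := by
  ext k
  rw [coeff_mul, mulCoeff, finsum_eq_single _ k, finsum_eq_single _ (0 : ℕ)]
  · simp [coeff_one]
  · intro n hn
    rw [coeff_one, if_neg (by omega), iter_zero]
    simp
  · intro i hi
    rw [← finsum_zero (α := ℕ)]
    refine finsum_congr fun n => ?_
    rw [coeff_one]
    split_ifs with h
    · obtain ⟨n, rfl⟩ : ∃ n' : ℕ, n = n' + 1 := ⟨n - 1, by omega⟩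
      rw [Function.iterate_succ_apply, Derivation.map_one_eq_zero, iter_zero]
      simp
    · rw [iter_zero]; simp

instance : Ring (PsiDO R) :=
  { (inferInstance : AddCommGroup (PsiDO R)) with
    mul := (· * ·)
    one := 1
    mul_assoc := mul_assoc'
    one_mul := one_mul'
    mul_one := mul_one'
    left_distrib := left_distrib'
    right_distrib := right_distrib'
    zero_mul := fun A => by
      have h := right_distrib' 0 0 A
      rw [add_zero] at h
      exact left_eq_add.mp h
    mul_zero := fun A => by
      have h := left_distrib' A 0 0
      rw [add_zero] at h
      exact left_eq_add.mp h }

end PsiDO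


/-! ### Smooth functions of infinitely many variables -/

/-- The point `t + ∑ y_i v_i`, for finitely many directions `v_i`, each of which moves only
finitely many of the variables. -/
def timeShift {𝕜 ι : Type*} [RCLike 𝕜] {n : ℕ} (t : ι → 𝕜) (v : Fin n → ι →₀ 𝕜)
    (y : Fin n → 𝕜) : ι → 𝕜 :=
  t + ⇑(∑ i, y i • v i)

/-- A set of values of the variables `(t_i)_{i ∈ ι}` that is open with respect to
variations of finitely many variables. -/
structure TimeDomain (𝕜 ι : Type*) [RCLike 𝕜] where
  /-- the underlying set -/
  carrier : Set (ι → 𝕜)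
  isOpen' : ∀ t ∈ carrier, ∀ (n : ℕ) (v : Fin n → ι →₀ 𝕜),
    ∀ᶠ y : Fin n → 𝕜 in 𝓝 0, timeShift t v y ∈ carrier

section Smooth

variable {𝕜 ι : Type*} [RCLike 𝕜]

open Classical in
/-- Extension by zero; only used near points of the domain. -/
def TimeDomain.zeroExt (Ω : TimeDomain 𝕜 ι) (f : Ω.carrier → ℂ) (t : ι → 𝕜) : ℂ :=
  if h : t ∈ Ω.carrier then f ⟨t, h⟩ else 0

theorem timeShift_zero {n : ℕ} (t : ι → 𝕜) (v : Fin n → ι →₀ 𝕜) : timeShift t v 0 = t := by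
  simp [timeShift]

theorem timeShift_timeShift {n k : ℕ} (t : ι → 𝕜) (v : Fin n → ι →₀ 𝕜) (w : Fin k → ι →₀ 𝕜)
    (y : Fin n → 𝕜) (z : Fin k → 𝕜) :
    timeShift (timeShift t v y) w z = timeShift t (Fin.append v w) (Fin.append y z) := by
  simp [timeShift, Fin.sum_univ_add, add_assoc]

theorem TimeDomain.zeroExt_of_mem (Ω : TimeDomain 𝕜 ι) (f : Ω.carrier → ℂ) {t : ι → 𝕜}
    (h : t ∈ Ω.carrier) : Ω.zeroExt f t = f ⟨t, h⟩ := dif_pos h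

theorem TimeDomain.zeroExt_add (Ω : TimeDomain 𝕜 ι) (f g : Ω.carrier → ℂ) (t : ι → 𝕜) :
    Ω.zeroExt (f + g) t = Ω.zeroExt f t + Ω.zeroExt g t := by
  unfold zeroExt; split_ifs <;> simp

theorem TimeDomain.zeroExt_mul (Ω : TimeDomain 𝕜 ι) (f g : Ω.carrier → ℂ) (t : ι → 𝕜) :
    Ω.zeroExt (f * g) t = Ω.zeroExt f t * Ω.zeroExt g t := by
  unfold zeroExt; split_ifs <;> simp

theorem line_eq (Ω : TimeDomain 𝕜 ι) (v : ι →₀ 𝕜) (f : Ω.carrier → ℂ) (t : ι → 𝕜) :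
    (fun s : 𝕜 => Ω.zeroExt f (t + ⇑(s • v))) =
      (fun y : Fin 1 → 𝕜 => Ω.zeroExt f (timeShift t (fun _ => v) y)) ∘ fun s _ => s := by
  funext s
  simp [timeShift]

variable [NormedAlgebra 𝕜 ℂ]

/-- `f` is smooth in the variables: its restriction to every finite-dimensional slice is `C^∞`. -/
def TimeDomain.IsSmooth (Ω : TimeDomain 𝕜 ι) (f : Ω.carrier → ℂ) : Prop :=
  ∀ t ∈ Ω.carrier, ∀ (n : ℕ) (v : Fin n → ι →₀ 𝕜),
    ContDiffAt 𝕜 ∞ (fun y : Fin n → 𝕜 => Ω.zeroExt f (timeShift t v y)) 0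

/-- To check smoothness it is enough to compare with a smooth function near each point. -/
theorem TimeDomain.isSmooth_of (Ω : TimeDomain 𝕜 ι) (f : Ω.carrier → ℂ)
    (h : ∀ t ∈ Ω.carrier, ∀ (n : ℕ) (v : Fin n → ι →₀ 𝕜), ∃ F : (Fin n → 𝕜) → ℂ,
      ContDiffAt 𝕜 ∞ F 0 ∧ ∀ (y : Fin n → 𝕜) (hy : timeShift t v y ∈ Ω.carrier),
        F y = f ⟨_, hy⟩) : Ω.IsSmooth f := by
  intro t ht n v
  obtain ⟨F, hF, hFf⟩ := h t ht n v
  refine hF.congr_of_eventuallyEq ?_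
  filter_upwards [Ω.isOpen' t ht n v] with y hy
  rw [Ω.zeroExt_of_mem f hy, hFf y hy]

/-- The algebra of smooth functions on a domain. -/
def smoothSubalgebra (Ω : TimeDomain 𝕜 ι) : Subalgebra ℂ (Ω.carrier → ℂ) where
  carrier := {f | Ω.IsSmooth f}
  add_mem' := by
    intro f g hf hg t ht n v
    simp only [Ω.zeroExt_add]
    exact (hf t ht n v).add (hg t ht n v)
  mul_mem' := by
    intro f g hf hg t ht n v
    simp only [Ω.zeroExt_mul]
    exact (hf t ht n v).mul (hg t ht n v)
  algebraMap_mem' := by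
    intro c
    refine Ω.isSmooth_of _ fun t _ n v => ⟨fun _ => c, contDiffAt_const, fun y hy => rfl⟩

/-- The algebra of smooth functions on a domain. -/
abbrev SmoothFn (Ω : TimeDomain 𝕜 ι) : Type _ := smoothSubalgebra Ω

/-- The derivative along the direction `v` at a point. -/
def dirDeriv (Ω : TimeDomain 𝕜 ι) (v : ι →₀ 𝕜) (f : Ω.carrier → ℂ) (t : Ω.carrier) : ℂ :=
  deriv (fun s : 𝕜 => Ω.zeroExt f (t.1 + ⇑(s • v))) 0

theorem line_differentiable (Ω : TimeDomain 𝕜 ι) (v : ι →₀ 𝕜) {f : Ω.carrier → ℂ}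
    (hf : Ω.IsSmooth f) {t : ι → 𝕜} (ht : t ∈ Ω.carrier) :
    DifferentiableAt 𝕜 (fun s : 𝕜 => Ω.zeroExt f (t + ⇑(s • v))) 0 := by
  rw [line_eq]
  refine DifferentiableAt.comp (0 : 𝕜) ?_ (by fun_prop)
  exact (hf t ht 1 fun _ => v).differentiableAt (by simp)

theorem dirDeriv_smooth (Ω : TimeDomain 𝕜 ι) (v : ι →₀ 𝕜) {f : Ω.carrier → ℂ}
    (hf : Ω.IsSmooth f) : Ω.IsSmooth (dirDeriv Ω v f) := by
  intro t ht n w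
  set G : (Fin (n + 1) → 𝕜) → ℂ :=
    fun y => Ω.zeroExt f (timeShift t (Fin.append w fun _ : Fin 1 => v) y) with hG
  have hG0 : ContDiffAt 𝕜 ∞ G 0 := hf t ht _ _
  set e : (Fin n → 𝕜) → (Fin (n + 1) → 𝕜) := fun y => Fin.append y (fun _ : Fin 1 => (0 : 𝕜))
    with he
  have hesm : ContDiff 𝕜 ∞ e := by
    rw [contDiff_pi]
    intro i
    refine Fin.addCases (fun i => ?_) (fun i => ?_) i
    · simp only [he, Fin.append_left]; fun_prop
    · simp only [he, Fin.append_right]; fun_prop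
  have he0 : e 0 = 0 := by
    funext i
    refine Fin.addCases (fun i => ?_) (fun i => ?_) i
    · simp only [he, Fin.append_left]; rfl
    · simp only [he, Fin.append_right]; rfl
  have hfd : ContDiffAt 𝕜 ∞ (fun y => fderiv 𝕜 G (e y) (Fin.append 0 fun _ : Fin 1 => 1)) 0 := by
    have h1 : ContDiffAt 𝕜 ∞ (fderiv 𝕜 G) (e 0) := by
      rw [he0]; exact hG0.fderiv_right (by simp)
    exact (h1.comp (0 : Fin n → 𝕜) hesm.contDiffAt).clm_apply contDiffAt_const
  refine hfd.congr_of_eventuallyEq ?_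
  have hev : ∀ᶠ y in 𝓝 (0 : Fin n → 𝕜), DifferentiableAt 𝕜 G (e y) := by
    have h2 : ∀ᶠ z in 𝓝 (0 : Fin (n + 1) → 𝕜), DifferentiableAt 𝕜 G z := by
      have h3 : ContDiffAt 𝕜 1 G 0 := hG0.of_le (by exact_mod_cast le_top)
      filter_upwards [h3.eventually (by simp)] with z hz
      exact hz.differentiableAt (by simp)
    have h4 : Filter.Tendsto e (𝓝 0) (𝓝 0) := by
      have := hesm.continuous.tendsto 0
      rwa [he0] at this
    exact h4.eventually h2
  filter_upwards [Ω.isOpen' t ht n w, hev] with y hy hdy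
  rw [Ω.zeroExt_of_mem _ hy]
  have hline : HasDerivAt (fun s : 𝕜 => (Fin.append y fun _ : Fin 1 => s : Fin (n + 1) → 𝕜))
      (Fin.append 0 fun _ : Fin 1 => 1) 0 := by
    rw [hasDerivAt_pi]
    intro i
    refine Fin.addCases (fun i => ?_) (fun i => ?_) i
    · simp only [Fin.append_left]; exact hasDerivAt_const _ _
    · simp only [Fin.append_right]; exact hasDerivAt_id _
  have hcomp := (hdy.hasFDerivAt.comp_hasDerivAt (0 : 𝕜) hline)
  have heq : (fun s : 𝕜 => Ω.zeroExt f (timeShift t w y + ⇑(s • v))) =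
      G ∘ fun s : 𝕜 => (Fin.append y fun _ : Fin 1 => s : Fin (n + 1) → 𝕜) := by
    funext s
    have h5 := timeShift_timeShift t w (fun _ : Fin 1 => v) y (fun _ => s)
    simp only [Function.comp, hG, ← h5]
    simp [timeShift]
  rw [dirDeriv, heq]
  exact hcomp.deriv

/-- The derivation `f ↦ ∂_v f` of the algebra of smooth functions. -/
def dirDerivation (Ω : TimeDomain 𝕜 ι) (v : ι →₀ 𝕜) :
    Derivation ℂ (SmoothFn Ω) (SmoothFn Ω) :=
  Derivation.mk'
    { toFun := fun f => ⟨dirDeriv Ω v f.1, dirDeriv_smooth Ω v f.2⟩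
      map_add' := by
        intro f g
        ext t
        have h := deriv_add (line_differentiable Ω v f.2 t.2) (line_differentiable Ω v g.2 t.2)
        have h' : dirDeriv Ω v (f.1 + g.1) t = dirDeriv Ω v f.1 t + dirDeriv Ω v g.1 t := by
          simp only [dirDeriv, Ω.zeroExt_add]
          exact h
        exact h'
      map_smul' := by
        intro c f
        ext t
        have h0 : ∀ s, Ω.zeroExt (c • f.1) s = c * Ω.zeroExt f.1 s := by
          intro s; unfold TimeDomain.zeroExt; split_ifs <;> simp
        have h' : dirDeriv Ω v (c • f.1) t = c * dirDeriv Ω v f.1 t := by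
          simp only [dirDeriv, h0]
          exact deriv_const_mul c (line_differentiable Ω v f.2 t.2)
        exact h' }
    (by
      intro f g
      ext t
      have h := deriv_mul (line_differentiable Ω v f.2 t.2) (line_differentiable Ω v g.2 t.2)
      have h0 : ∀ f : Ω.carrier → ℂ, Ω.zeroExt f (t.1 + ⇑((0 : 𝕜) • v)) = f t := by
        intro f
        have : t.1 + ⇑((0 : 𝕜) • v) = t.1 := by simp
        rw [this]
        exact Ω.zeroExt_of_mem f t.2
      have h' : dirDeriv Ω v (f.1 * g.1) t =
          dirDeriv Ω v f.1 t * g.1 t + f.1 t * dirDeriv Ω v g.1 t := by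
        have h1 := h0 f.1
        have h2 := h0 g.1
        simp only [dirDeriv, Ω.zeroExt_mul]
        simp only [Pi.mul_def] at h
        rw [h, h1, h2]
      simp only [LinearMap.coe_mk, AddHom.coe_mk, smul_eq_mul]
      change dirDeriv Ω v (f.1 * g.1) t =
        f.1 t * dirDeriv Ω v g.1 t + g.1 t * dirDeriv Ω v f.1 t
      rw [h']; ring)

/-- The partial derivative `∂/∂t_i`. -/
def pderivT {Ω : TimeDomain 𝕜 ι} (i : ι) : Derivation ℂ (SmoothFn Ω) (SmoothFn Ω) :=
  dirDerivation Ω (Finsupp.single i 1)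

/-- The coordinate function `t_i`. -/
def coordFn (Ω : TimeDomain 𝕜 ι) (i : ι) : SmoothFn Ω :=
  ⟨fun t => algebraMap 𝕜 ℂ (t.1 i), Ω.isSmooth_of _ fun t _ n v =>
    ⟨fun y => algebraMap 𝕜 ℂ (t i + ∑ k, y k * v k i), by
      have h : ContDiff 𝕜 ∞ (fun z : 𝕜 => algebraMap 𝕜 ℂ z) := (Algebra.linearMap 𝕜 ℂ).toContinuousLinearMap.contDiff
      exact (h.comp (by fun_prop)).contDiffAt, fun y hy => by
        simp [timeShift]⟩⟩

/-- The open set where `g` does not vanish. -/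
def nonvanishing {Ω : TimeDomain 𝕜 ι} (g : SmoothFn Ω) : TimeDomain 𝕜 ι where
  carrier := {t | ∃ h : t ∈ Ω.carrier, g.1 ⟨t, h⟩ ≠ 0}
  isOpen' := by
    rintro t ⟨ht, hgt⟩ n v
    have hc := (g.2 t ht n v).continuousAt
    have hne := hc.eventually_ne (y := 0) (by
      rw [timeShift_zero, Ω.zeroExt_of_mem _ ht]; exact hgt)
    filter_upwards [Ω.isOpen' t ht n v, hne] with y hy hy'
    exact ⟨hy, by rwa [Ω.zeroExt_of_mem _ hy] at hy'⟩

/-- The quotient `f / g` on the open set where `g` does not vanish. -/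
def quotFn {Ω : TimeDomain 𝕜 ι} (f g : SmoothFn Ω) : SmoothFn (nonvanishing g) :=
  ⟨fun t => f.1 ⟨t.1, t.2.1⟩ / g.1 ⟨t.1, t.2.1⟩,
    (nonvanishing g).isSmooth_of _ fun t ht n v =>
      ⟨fun y => Ω.zeroExt f.1 (timeShift t v y) * (Ω.zeroExt g.1 (timeShift t v y))⁻¹,
        (f.2 t ht.1 n v).mul ((g.2 t ht.1 n v).inv (by
          rw [timeShift_zero, Ω.zeroExt_of_mem _ ht.1]; exact ht.2)),
        fun y hy => by
          simp only [Ω.zeroExt_of_mem _ hy.1, div_eq_mul_inv]⟩⟩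

end Smooth

/-- A linear substitution of the variables: `toFun` expresses the variables `t_i`, `i ∈ ι`, in
terms of new variables `s_j`, `j ∈ κ`; changing `s_j` by `c` changes `t` by `c • col j`, so that
each new variable enters only finitely many old ones. -/
structure TimeMap (𝕜 κ ι : Type*) [RCLike 𝕜] where
  /-- the substitution -/
  toFun : (κ → 𝕜) → (ι → 𝕜)
  /-- the direction in which the new variable `s_j` moves the old variables -/
  col : κ → ι →₀ 𝕜
  map_single : ∀ (s : κ → 𝕜) (j : κ) (c : 𝕜),
    toFun (s + ⇑(Finsupp.single j c)) = toFun s + ⇑(c • col j)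

section Substitution

variable {𝕜 κ ι : Type*} [RCLike 𝕜]

theorem TimeMap.map_add (φ : TimeMap 𝕜 κ ι) (s : κ → 𝕜) (v : κ →₀ 𝕜) :
    φ.toFun (s + ⇑v) = φ.toFun s + ⇑(Finsupp.linearCombination 𝕜 φ.col v) := by
  induction v using Finsupp.induction_linear generalizing s with
  | zero => simp
  | add v w hv hw => rw [Finsupp.coe_add, ← add_assoc, hw, hv, _root_.map_add, Finsupp.coe_add, add_assoc]
  | single j c => rw [φ.map_single, Finsupp.linearCombination_single]

theorem TimeMap.map_shift (φ : TimeMap 𝕜 κ ι) {n : ℕ} (s : κ → 𝕜) (v : Fin n → κ →₀ 𝕜)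
    (y : Fin n → 𝕜) : φ.toFun (timeShift s v y) =
      timeShift (φ.toFun s) (fun i => Finsupp.linearCombination 𝕜 φ.col (v i)) y := by
  rw [timeShift, φ.map_add, timeShift, map_sum]
  simp only [map_smul]

/-- The preimage of a domain under a substitution. -/
def TimeDomain.comap (Ω : TimeDomain 𝕜 ι) (φ : TimeMap 𝕜 κ ι) : TimeDomain 𝕜 κ where
  carrier := φ.toFun ⁻¹' Ω.carrier
  isOpen' := by
    intro s hs n v
    filter_upwards [Ω.isOpen' _ hs n fun i => Finsupp.linearCombination 𝕜 φ.col (v i)] with y hy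
    rw [Set.mem_preimage, φ.map_shift]
    exact hy

variable [NormedAlgebra 𝕜 ℂ]

/-- Substitution `f ↦ f ∘ φ`, as a homomorphism of algebras of smooth functions. -/
def pullback {Ω : TimeDomain 𝕜 ι} (φ : TimeMap 𝕜 κ ι) :
    SmoothFn Ω →+* SmoothFn (Ω.comap φ) where
  toFun f := ⟨fun s => f.1 ⟨φ.toFun s.1, s.2⟩, (Ω.comap φ).isSmooth_of _ fun s hs n v =>
    ⟨_, f.2 _ hs n fun i => Finsupp.linearCombination 𝕜 φ.col (v i), fun y hy => by
      have hy' : φ.toFun (timeShift s v y) ∈ Ω.carrier := hy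
      rw [← φ.map_shift, Ω.zeroExt_of_mem _ hy']⟩⟩
  map_one' := rfl
  map_mul' _ _ := rfl
  map_zero' := rfl
  map_add' _ _ := rfl

end Substitution

/-! ### Tau-functions and wave operators -/

section Tau

variable {𝕜 : Type*} [RCLike 𝕜] [NormedAlgebra 𝕜 ℂ]

section Hirota

variable {r : ℕ} {Ω : TimeDomain 𝕜 (Fin r × ℕ+)}

/-- The coefficient of `z^{-k}` in
`e_-^{(a)}(σ ∂/∂t, z) f = exp(-σ ∑_{j ≥ 1} (z^{-j} / j) ∂/∂t_j^{(a)}) f`, for a sign `σ`.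
The `n`-th power in the exponential series contributes the terms
`((-σ)^n / n!) ∏_{i ≤ n} (1 / j_i) ∂/∂t_{j_i}^{(a)}` with `j_1 + ... + j_n = k`. -/
def eMinus (a : Fin r) (σ : ℤˣ) (k : ℕ) (f : SmoothFn Ω) : SmoothFn Ω :=
  ∑ c : Composition k,
    ((-((σ : ℤ) : ℂ)) ^ c.length / (c.length.factorial : ℂ) *
        ∏ i, (1 / (c.blocksFun i : ℂ))) •
      (List.ofFn fun i => (⟨c.blocksFun i, c.one_le_blocksFun i⟩ : ℕ+)).foldr
        (fun j g => pderivT (a, j) g) f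

/-- `e_-^{(a)}(σ ∂/∂t, z) f` as a series in `z`: the coefficient of `z^i`, `i ∈ ℤ`. -/
def eMinusSeries (a : Fin r) (σ : ℤˣ) (f : SmoothFn Ω) (i : ℤ) : SmoothFn Ω :=
  if i ≤ 0 then eMinus a σ (-i).toNat f else 0

/-- If `G(t', z)` is a Laurent series in `z⁻¹` with coefficients depending on `t'`, then
`∂/∂t'_j^{(b)} (e_+^{(a)}(t' - t'', z) G) = e_+^{(a)}(t' - t'', z) (∂/∂t'_j^{(b)} + δ_{ab} z^j) G`.
This is the series obtained from `G` by applying such operators for all `(b, j)` in the list;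
as `e_+^{(a)}(0, z) = 1`, it is the value at `t' = t''` of the corresponding derivative of
`e_+^{(a)}(t' - t'', z) G(t', z)`. -/
def waveDeriv (a : Fin r) (l : List (Fin r × ℕ+)) (G : ℤ → SmoothFn Ω) : ℤ → SmoothFn Ω :=
  l.foldr (fun bj H i => pderivT bj (H i) + if bj.1 = a then H (i - (bj.2 : ℕ)) else 0) G

/-- The bilinear equations, for a tau-function of charge `k` (only the `τ^m` with `|m| = k` enter):
`Res_z ∑_a (-1)^{|m' + m''|_{a-1}} z^{m'_a - m''_a + ℓ p_a - 2} e_+^{(a)}(t' - t'', z)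
  e_-^{(a)}(∂/∂t' - ∂/∂t'', z) τ^{m' - e_a}(t') τ^{m'' + e_a}(t'') = 0`,
understood as the collection of equations obtained by applying an arbitrary product of
derivatives with respect to `t'` (the list `l`) and then setting `t' = t''`.
The residue pairs the coefficient of `z^{q - 1 - (m'_a - m''_a + ℓ p_a - 2)}` of the first factor
with that of `z^{-q}` of the second one; the sum over `q` is finite. -/
def IsTauFunction (p : Fin r → ℕ) (k : ℤ) (τ : (Fin r → ℤ) → SmoothFn Ω) : Prop :=
  ∀ (ℓ : ℕ) (m' m'' : Fin r → ℤ), ∑ i, m' i = k + 1 → ∑ i, m'' i = k - 1 →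
    ∀ l : List (Fin r × ℕ+),
      ∑ a : Fin r, (Int.negOnePow (∑ i ∈ Finset.Iio a, (m' i + m'' i)) : ℤ) •
        ∑ᶠ q : ℕ,
          waveDeriv a l (eMinusSeries a 1 (τ (m' - Pi.single a 1)))
            ((q : ℤ) - 1 - (m' a - m'' a + ℓ * p a - 2)) *
          eMinus a (-1) q (τ (m'' + Pi.single a 1)) = 0

/-- `τ^m` times the coefficient of `z^{-n}` in `P^±_{ab}(m, t, z)` (sign `σ`), where
`P^±_{ab}(m, t, ±z) = (-1)^{[a < b]} (z^{δ_ab - 1} / τ^m) e_-^{(b)}(±∂/∂t, z) τ^{m ± e_a ∓ e_b}`. -/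
def waveNum (τ : (Fin r → ℤ) → SmoothFn Ω) (σ : ℤˣ) (m : Fin r → ℤ) (a b : Fin r) (n : ℕ) :
    SmoothFn Ω :=
  (((if a < b then -1 else 1) * σ ^ n : ℤˣ) : ℤ) •
    eMinusSeries b σ (τ (m + (σ : ℤ) • (Pi.single a 1 - Pi.single b 1)))
      (-(n : ℤ) + (if a = b then 0 else 1))

end Hirota

/-- Functions of a space variable `x` (index `none`) and times (indices `some _`) form a
differential ring with derivation `∂ = ∂/∂x`. -/
instance {κ : Type*} (Ω : TimeDomain 𝕜 (Option κ)) : Differential (SmoothFn Ω) :=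
  ⟨(pderivT none).restrictScalars ℤ⟩

section Reduction

variable {r : ℕ} [NeZero r] (p : Fin r → ℕ)

/-- The indices `a` with `p_a = p_1` (for a partition these are `1, ..., r_1`). -/
abbrev Blk1 : Type := {a : Fin r // p a = p 0}

/-- The indices `a` with `p_a ≠ p_1` (for a partition these are `r_1 + 1, ..., r`). -/
abbrev Blk2 : Type := {a : Fin r // p a ≠ p 0}

/-- The substitution `t_j^{(a)} ↦ t_j^{(a)} + δ_{j1} x` for `a ≤ r_1`, `t_j^{(a)} ↦ 0` for
`a > r_1`. -/
def redMap : TimeMap 𝕜 (Option (Blk1 p × ℕ+)) (Fin r × ℕ+) where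
  toFun s aj := if h : p aj.1 = p 0 then
    s (some (⟨aj.1, h⟩, aj.2)) + (if aj.2 = 1 then s none else 0) else 0
  col
    | none => ∑ a : Blk1 p, Finsupp.single (a.1, 1) 1
    | some (a, j) => Finsupp.single (a.1, j) 1
  map_single := by
    rintro s (_ | ⟨a, j⟩) c
    · funext ⟨b, i⟩
      have hsum : (∑ a : Blk1 p, Finsupp.single ((a.1, 1) : Fin r × ℕ+) (1 : 𝕜) (b, i)) =
          if p b = p 0 ∧ i = 1 then 1 else 0 := by
        split_ifs with h
        · obtain ⟨h1, rfl⟩ := h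
          rw [Finset.sum_eq_single (⟨b, h1⟩ : Blk1 p)]
          · simp
          · intro a _ ha
            exact Finsupp.single_eq_of_ne fun he => ha (Subtype.ext (Prod.ext_iff.mp he).1.symm)
          · simp
        · refine Finset.sum_eq_zero fun a _ => Finsupp.single_eq_of_ne fun he => h ?_
          have := Prod.ext_iff.mp he
          simp only at this
          exact ⟨this.1 ▸ a.2, this.2⟩
      by_cases h : p b = p 0
      · by_cases hi : i = 1
        · subst hi
          simp [hsum, h, add_assoc]
        · simp [h, hi]
      · simp [hsum, h]
    · funext ⟨b, i⟩
      by_cases h : p b = p 0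
      · by_cases hb : b = a.1 ∧ i = j
        · obtain ⟨rfl, rfl⟩ := hb
          simp [h]
          ring
        · have h1 : ((b, i) : Fin r × ℕ+) ≠ (a.1, j) := fun he => hb (Prod.ext_iff.mp he)
          have h2 : (some ((⟨b, h⟩ : Blk1 p), i)) ≠ some (a, j) := by
            intro he
            have he' := Prod.ext_iff.mp (Option.some.inj he)
            exact hb ⟨congrArg Subtype.val he'.1, he'.2⟩
          simp [h, Finsupp.single_eq_of_ne h1, Finsupp.single_eq_of_ne h2]
      · have h1 : ((b, i) : Fin r × ℕ+) ≠ (a.1, j) := fun he =>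
          h (by rw [show b = a.1 from (Prod.ext_iff.mp he).1]; exact a.2)
        simp [h, Finsupp.single_eq_of_ne h1]

/-- The identification `t_j^{(a)} = t_j` of the times. -/
def diagMap : TimeMap 𝕜 (Option ℕ+) (Option (Blk1 p × ℕ+)) where
  toFun s i := s (i.map Prod.snd)
  col
    | none => Finsupp.single none 1
    | some j => ∑ a : Blk1 p, Finsupp.single (some (a, j)) 1
  map_single := by
    rintro s (_ | j) c
    · funext i
      rcases i with _ | ⟨b, i⟩ <;> simp
    · funext i
      rcases i with _ | ⟨b, i⟩
      · simp
      · by_cases h : i = j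
        · subst h
          simp [Finsupp.single_apply]
        · simp [h]

/-- The substitution `x ↦ -x`, `t_j ↦ ε^j t_j`. -/
def flipMap (ε : 𝕜) : TimeMap 𝕜 (Option ℕ+) (Option ℕ+) where
  toFun s
    | none => - s none
    | some j => ε ^ (j : ℕ) * s (some j)
  col
    | none => Finsupp.single none (-1)
    | some j => Finsupp.single (some j) (ε ^ (j : ℕ))
  map_single := by
    rintro s (_ | j) c
    · funext i
      rcases i with _ | i
      · simp; ring
      · simp
    · funext i
      rcases i with _ | i
      · simp
      · by_cases h : i = j
        · subst h
          simp; ring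
        · have h' : (some i : Option ℕ+) ≠ some j := fun he => h (Option.some.inj he)
          simp [Finsupp.single_eq_of_ne h']

variable {Ω : TimeDomain 𝕜 (Fin r × ℕ+)} (τ : (Fin r → ℤ) → SmoothFn Ω) (m : Fin r → ℤ)

/-- The values of `x` and of the times `t_j^{(a)}`, `a ≤ r_1`, at which the reduced
`τ^m` does not vanish. -/
abbrev waveDomain : TimeDomain 𝕜 (Option (Blk1 p × ℕ+)) :=
  nonvanishing (pullback (redMap p) (τ m))

/-- The coefficient `Q^±_{ab;n}(m, x, t)` of `z^{-n}` in `Q^±_{ab}(m, x, t, z)`. -/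
def waveQ (σ : ℤˣ) (a b : Fin r) (n : ℕ) : SmoothFn (waveDomain p τ m) :=
  quotFn (pullback (redMap p) (waveNum τ σ m a b n)) (pullback (redMap p) (τ m))

/-- The operator `Q^+_{11}(m, x, t, ∂)`. -/
def waveQ11 : Matrix (Blk1 p) (Blk1 p) (PsiDO (SmoothFn (waveDomain p τ m))) :=
  Matrix.of fun a b => PsiDO.ofSymbol (waveQ p τ m 1 a.1 b.1)

/-- The reduced Lax operators `𝓛_a = Q^+_{11} ∘ E_{aa} ∂ ∘ (Q^+_{11})⁻¹`. -/
def laxA (a : Blk1 p) : Matrix (Blk1 p) (Blk1 p) (PsiDO (SmoothFn (waveDomain p τ m))) :=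
  waveQ11 p τ m * Matrix.single a a (PsiDO.mono 1 1) * Ring.inverse (waveQ11 p τ m)

/-- The values of `x` and `t = (t_j)` at which the reduced `τ^m`, with the times identified,
does not vanish. -/
abbrev laxDomain : TimeDomain 𝕜 (Option ℕ+) := (waveDomain p τ m).comap (diagMap p)

/-- The constrained Lax operator `∑_{a ≤ r_1} 𝓛_a^{p_1}` after the identification of the times. -/
def laxTilde : Matrix (Blk1 p) (Blk1 p) (PsiDO (SmoothFn (laxDomain p τ m))) :=
  (∑ a, laxA p τ m a ^ p 0).map (PsiDO.mapCoeff (pullback (diagMap p)).toAddMonoidHom)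

/-! The operator built from the coefficients `w_{ba;j}`; `ε` is a `p_1`-th root of `-1`. -/

variable (ε : 𝕜)

/-- The values of `x` and `t` for which `(-x, (ε^j t_j)_j)` lies in the previous domain. -/
abbrev solDomain : TimeDomain 𝕜 (Option ℕ+) := (laxDomain p τ m).comap (flipMap ε)

/-- `Q^±_{ab;n}(m, -x, t̃)` with identified times and `t̃_j = ε^j t_j`. -/
def solQ (σ : ℤˣ) (a b : Fin r) (n : ℕ) : SmoothFn (solDomain p τ m ε) :=
  pullback (flipMap ε) (pullback (diagMap p) (waveQ p τ m σ a b n))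

/-- The function `x^i / i!`. -/
def divPowX {κ : Type*} (V : TimeDomain 𝕜 (Option κ)) (i : ℕ) : SmoothFn V :=
  ((1 : ℂ) / (i.factorial : ℂ)) • coordFn V none ^ i

/-- `w (-∂)^j` for `j ∈ ℤ`. -/
def monoNeg {R : Type*} [CommRing R] (w : R) (j : ℤ) : PsiDO R :=
  PsiDO.mono ((Int.negOnePow j : ℤ) • w) j

/-- The differential operator `∑_{j < n} w_j (-∂)^j`. -/
def diffOp {R : Type*} [CommRing R] (n : ℕ) (w : ℕ → R) : PsiDO R :=
  ∑ j ∈ Finset.range n, monoNeg (w j) j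

/-- The functions `w_j` in the expansion `∑_j w_j (-∂)^j` of an operator. -/
def negCoeff {R : Type*} [CommRing R] (A : PsiDO R) (j : ℕ) : R :=
  (-1) ^ j * A.coeff j

/-- `w_{ba;j} = -∑_{i ≤ j} (x^i / i!) Q^+_{ab;j-i+1}(-x, t̃)` for `a ≤ r_1 < b`. -/
def w12 (a : Blk1 p) (b : Blk2 p) (j : ℕ) : SmoothFn (solDomain p τ m ε) :=
  -∑ i ∈ Finset.range (j + 1),
    divPowX (solDomain p τ m ε) i * solQ p τ m ε 1 a.1 b.1 (j - i + 1)

/-- The block `W_{12}`. -/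
def solW12 : Matrix (Blk1 p) (Blk2 p) (PsiDO (SmoothFn (solDomain p τ m ε))) :=
  Matrix.of fun a b => diffOp (p b.1) (w12 p τ m ε a b)

/-- `w_{ba;j}` for `b ≤ r_1 < a`, from the expansion of
`∑_{j < p_a} ∑_{i ≤ j} ∂^j ∘ Q^-_{ba;j-i+1}(-x, t̃) x^i / i!`. -/
def w21 (a : Blk2 p) (b : Blk1 p) (j : ℕ) : SmoothFn (solDomain p τ m ε) :=
  negCoeff (∑ j ∈ Finset.range (p a.1), ∑ i ∈ Finset.range (j + 1),
    PsiDO.mono 1 j * PsiDO.mono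
      (solQ p τ m ε (-1) b.1 a.1 (j - i + 1) * divPowX (solDomain p τ m ε) i) 0) j

/-- The block `W_{21}`. -/
def solW21 : Matrix (Blk2 p) (Blk1 p) (PsiDO (SmoothFn (solDomain p τ m ε))) :=
  Matrix.of fun a b => diffOp (p a.1) (w21 p τ m ε a b)

/-- `(-∂)^{-q} = ∑_{a > r_1} E_{aa} (-∂)^{-p_a}`. -/
def negDq : Matrix (Blk2 p) (Blk2 p) (PsiDO (SmoothFn (solDomain p τ m ε))) :=
  Matrix.diagonal fun a => monoNeg 1 (-(p a.1 : ℤ))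

/-- `1 (-∂)^{p_1}`. -/
def negDp : Matrix (Blk1 p) (Blk1 p) (PsiDO (SmoothFn (solDomain p τ m ε))) :=
  Matrix.diagonal fun _ => monoNeg 1 (p 0)

/-- The operator `L̃(m, -x, t̃, -∂)`. -/
def laxFlip : Matrix (Blk1 p) (Blk1 p) (PsiDO (SmoothFn (solDomain p τ m ε))) :=
  (laxTilde p τ m).map (PsiDO.reflect (pullback (flipMap ε)))

/-- `w_{ba;j}` for `a, b ≤ r_1`, from the expansion of
`-L̃(m, -x, t̃, -∂)_+ + 1 (-∂)^{p_1} - (W_{12} ∘ (-∂)^{-q} ∘ W_{21})_+`. -/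
def w11 (a b : Blk1 p) (j : ℕ) : SmoothFn (solDomain p τ m ε) :=
  negCoeff ((-(laxFlip p τ m ε).map PsiDO.pos + negDp p τ m ε -
    (solW12 p τ m ε * negDq p τ m ε * solW21 p τ m ε).map PsiDO.pos) a b) j

/-- The block `W_{11}`. -/
def solW11 : Matrix (Blk1 p) (Blk1 p) (PsiDO (SmoothFn (solDomain p τ m ε))) :=
  Matrix.of fun a b => diffOp (p 0) (w11 p τ m ε a b)

/-- The operator
`-1 (-∂)^{p_1} + W_{11} + W_{12} ∘ (-∂)^{-q} ∘ W_{21}`, which is the quasideterminant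
`-1 (-∂)^{p_1} + W_{11} - W_{12} ∘ (-(-∂)^q + W_{22})⁻¹ ∘ W_{21}` for `W_{22} = 0`. -/
def laxSol : Matrix (Blk1 p) (Blk1 p) (PsiDO (SmoothFn (solDomain p τ m ε))) :=
  -negDp p τ m ε + solW11 p τ m ε + solW12 p τ m ε * negDq p τ m ε * solW21 p τ m ε

end Reduction

/-! ### Lax equations -/

section LaxEquations

variable {I : Type*} [Fintype I] [DecidableEq I] {V : TimeDomain 𝕜 (Option ℕ+)}

/-- `B` is an `n`-th root of `A` of the form `c 1 ∂ + (terms of order ≤ 0)`. -/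
def IsRootWithLeading (c : ℂ) (n : ℕ) (A B : Matrix I I (PsiDO (SmoothFn V))) : Prop :=
  B ^ n = A ∧ ∀ (a b : I) (i : ℤ), 1 ≤ i →
    (B a b).coeff i = if a = b ∧ i = 1 then algebraMap ℂ (SmoothFn V) c else 0

/-- `A` has exactly one `n`-th root `A^{1/n}` of the form `c 1 ∂ + (terms of order ≤ 0)`, and
`∂A/∂t_j = [(A^{j/n})_+, A]` for all `j ≥ 1`, where `A^{j/n} = (A^{1/n})^j`. -/
def SolvesLax (c : ℂ) (n : ℕ) (A : Matrix I I (PsiDO (SmoothFn V))) : Prop :=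
  (∃! B, IsRootWithLeading c n A B) ∧
    ∀ B, IsRootWithLeading c n A B → ∀ j : ℕ+,
      A.map (PsiDO.mapCoeff (pderivT (some j)).toLinearMap.toAddMonoidHom) =
        ⁅(B ^ (j : ℕ)).map PsiDO.pos, A⁆

end LaxEquations

end Tau

end

/-!
The proof is a dressing argument. Let `T` be the matrix operator whose entries are
`∑_n (-1)^n ∂^{-n} ∘ Q⁻_{ba;n}`. A differential operator is recognised by the vanishing of the
residues of `∂^k ∘ A`, `k ≥ 0`, and the bilinear identities, differentiated in `x` and in the times,
are statements about such residues. Those with `ℓ = 0` say that `Q₁₁ T` is a differential operator,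
so that `T = Q₁₁⁻¹` because both have leading coefficient `1`, and that
`∂Q₁₁/∂t_j^{(d)} Q₁₁⁻¹ + Q₁₁ E_dd ∂^j Q₁₁⁻¹` is one, so that `Q₁₁` satisfies the Sato equations.
Hence `Q₁₁ ∂ Q₁₁⁻¹` is a `p₁`-th root of `L̃ = Q₁₁ ∂^{p₁} Q₁₁⁻¹`, and `L̃` satisfies the Lax
equations. Two roots `B`, `B'` with leading term `c ∂` agree, because the leading coefficient of
`B^n - B'^n` is `n c^{n-1}` times that of `B - B'`.

The identities with `ℓ = 1` compute the integral part of `L̃`: its `(a, b)` entry is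
`-∑_{c > r₁} ∑_n Q⁺_{ac;n+1} ∂⁻¹ Q⁻_{bc;p_c-n}` up to a sign in each term. For divided powers
`f_i = x^i / i!` the product `(∑_{i,j} f_i u_{j-i} (-∂)^j) (-∂)^{-q} (∑_{i,j} ∂^j v_{j-i} f_i)` has
an integral part of the same shape: moving the powers of `∂` to the left past the divided powers,
the latter cancel by the binomial identity `∑_i (-1)^i f_i f_{n-i} = 0` for `n > 0`. This identifies
`L` with `-L̃(-x, t̃, -∂)`. Finally `x ↦ -x`, `t_j ↦ ε^j t_j`, `∂ ↦ -∂` is a ring homomorphism that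
multiplies the `j`-th flow by `ε^j`, so that it carries the Lax equations and the root `B` of `L̃`
to those of `L`, with root `ε B(-x, t̃, -∂)`.
-/

noncomputable section

/-! ### Algebra of pseudodifferential operators -/

namespace PsiDO

section Additive

variable {R S : Type*} [CommRing R] [CommRing S]

/-- The coefficient of `∂^i` as an additive map. -/
def coeffHom (i : ℤ) : PsiDO R →+ R where
  toFun A := A.coeff i
  map_zero' := rfl
  map_add' _ _ := rfl

@[simp] theorem coeff_neg (A : PsiDO R) (i : ℤ) : (-A).coeff i = -A.coeff i := rfl

@[simp] theorem coeff_sub (A B : PsiDO R) (i : ℤ) :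
    (A - B).coeff i = A.coeff i - B.coeff i := map_sub (coeffHom i) A B

@[simp] theorem coeff_sum {ι : Type*} (s : Finset ι) (A : ι → PsiDO R) (i : ℤ) :
    (∑ x ∈ s, A x).coeff i = ∑ x ∈ s, (A x).coeff i := map_sum (coeffHom i) A s

theorem coeff_zsmul (c : ℤ) (A : PsiDO R) (i : ℤ) : (c • A).coeff i = c • A.coeff i :=
  map_zsmul (coeffHom i) c A

theorem coeff_mono (a : R) (n i : ℤ) : (mono a n).coeff i = if i = n then a else 0 := rfl

theorem coeff_ofSymbol (c : ℕ → R) (i : ℤ) :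
    (ofSymbol c).coeff i = if i ≤ 0 then c (-i).toNat else 0 := rfl

@[simp] theorem coeff_pos (A : PsiDO R) (i : ℤ) :
    A.pos.coeff i = if 0 ≤ i then A.coeff i else 0 := rfl

@[simp] theorem coeff_mapCoeff (φ : R →+ S) (A : PsiDO R) (i : ℤ) :
    (mapCoeff φ A).coeff i = φ (A.coeff i) := rfl

@[simp] theorem coeff_reflect (φ : R →+* S) (A : PsiDO R) (i : ℤ) :
    (reflect φ A).coeff i = (Int.negOnePow i : ℤ) • φ (A.coeff i) := rfl

/-- Monomials of a fixed degree as an additive map. -/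
def monoHom (n : ℤ) : R →+ PsiDO R where
  toFun a := mono a n
  map_zero' := by ext i; simp [coeff_mono]
  map_add' a b := by
    ext i
    simp only [coeff_mono, coeff_add]
    split_ifs <;> simp

@[simp] theorem mono_zero (n : ℤ) : mono (0 : R) n = 0 := map_zero (monoHom n)

theorem mono_neg (a : R) (n : ℤ) : mono (-a) n = -mono a n := map_neg (monoHom n) a

theorem mono_sum {ι : Type*} (s : Finset ι) (f : ι → R) (n : ℤ) :
    mono (∑ x ∈ s, f x) n = ∑ x ∈ s, mono (f x) n := map_sum (monoHom n) f s

theorem mono_zsmul (c : ℤ) (a : R) (n : ℤ) : mono (c • a) n = c • mono a n :=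
  map_zsmul (monoHom n) c a

/-- `mapCoeff` as an additive map. -/
def mapCoeffHom (φ : R →+ S) : PsiDO R →+ PsiDO S where
  toFun := mapCoeff φ
  map_zero' := by ext i; simp
  map_add' A B := by ext i; simp

@[simp] theorem mapCoeffHom_apply (φ : R →+ S) (A : PsiDO R) :
    mapCoeffHom φ A = mapCoeff φ A := rfl

/-- The differential part as an additive map. -/
def posHom : PsiDO R →+ PsiDO R where
  toFun := pos
  map_zero' := by ext i; simp
  map_add' A B := by ext i; simp only [coeff_pos, coeff_add]; split_ifs <;> simp

theorem pos_mapCoeff (φ : R →+ S) (A : PsiDO R) : (mapCoeff φ A).pos = mapCoeff φ A.pos := by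
  ext i
  simp only [coeff_pos, coeff_mapCoeff]
  split_ifs <;> simp

theorem pos_reflect (φ : R →+* S) (A : PsiDO R) : (reflect φ A).pos = reflect φ A.pos := by
  ext i
  simp only [coeff_pos, coeff_reflect]
  split_ifs <;> simp

variable (R) in
/-- The order filtration: operators of order at most `N`. -/
def ordLE (N : ℤ) : AddSubgroup (PsiDO R) where
  carrier := {A | ∀ i, N < i → A.coeff i = 0}
  zero_mem' _ _ := rfl
  add_mem' hA hB i hi := by rw [coeff_add, hA i hi, hB i hi, add_zero]
  neg_mem' hA i hi := by rw [coeff_neg, hA i hi, neg_zero]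

theorem ordLE_mono : Monotone (ordLE R) := fun _ _ hNM _ hA i hi => hA i (hNM.trans_lt hi)

theorem mono_mem_ordLE (a : R) (n : ℤ) : mono a n ∈ ordLE R n := fun _ hi => if_neg hi.ne'

theorem ofSymbol_mem_ordLE (c : ℕ → R) : ofSymbol c ∈ ordLE R 0 := fun _ hi => if_neg hi.not_ge

theorem mapCoeff_mem_ordLE (φ : R →+ S) {A : PsiDO R} {N : ℤ} (hA : A ∈ ordLE R N) :
    mapCoeff φ A ∈ ordLE S N := fun i hi => by rw [coeff_mapCoeff, hA i hi, map_zero]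

theorem reflect_mem_ordLE (φ : R →+* S) {A : PsiDO R} {N : ℤ} (hA : A ∈ ordLE R N) :
    reflect φ A ∈ ordLE S N := fun i hi => by rw [coeff_reflect, hA i hi, map_zero, smul_zero]

theorem exists_mem_ordLE_pair (A B : PsiDO R) : ∃ N, A ∈ ordLE R N ∧ B ∈ ordLE R N := by
  obtain ⟨N, -, hA, hB, -⟩ := exists_bound A B 0
  exact ⟨N, hA, hB⟩

end Additive

section Products

variable {R : Type*} [CommRing R] [Differential R]

theorem coeff_mul_eq_sum {A B : PsiDO R} {N : ℤ} (hA : A ∈ ordLE R N) (hB : B ∈ ordLE R N)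
    (k : ℤ) :
    (A * B).coeff k = ∑ i ∈ Finset.Icc (k - N) N, ∑ j ∈ Finset.Icc (k - N) N,
      mulTerm (A.coeff i) (B.coeff j) i j k :=
  mulCoeff_eq A B k N _ _ hA hB (fun _ h1 h2 => Finset.mem_Icc.mpr ⟨h1, h2⟩)
    (fun _ h1 h2 => Finset.mem_Icc.mpr ⟨h1, h2⟩)

theorem mul_mem_ordLE {A B : PsiDO R} {N M : ℤ} (hA : A ∈ ordLE R N) (hB : B ∈ ordLE R M) :
    A * B ∈ ordLE R (N + M) := by
  intro k hk
  rw [coeff_mul, mulCoeff]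
  refine finsum_eq_zero_of_forall_eq_zero fun i => finsum_eq_zero_of_forall_eq_zero fun n => ?_
  by_cases hi : N < i
  · rw [hA i hi, zero_mul, smul_zero]
  · rw [hB _ (by omega), iter_zero, mul_zero, smul_zero]

theorem coeff_mul_top {A B : PsiDO R} {N M : ℤ} (hA : A ∈ ordLE R N) (hB : B ∈ ordLE R M) :
    (A * B).coeff (N + M) = A.coeff N * B.coeff M := by
  rw [coeff_mul, mulCoeff, finsum_eq_single _ N, finsum_eq_single _ 0]
  · simp
  · intro n hn
    rw [hB _ (by omega), iter_zero, mul_zero, smul_zero]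
  · intro i hi
    refine finsum_eq_zero_of_forall_eq_zero fun n => ?_
    by_cases hi' : N < i
    · rw [hA i hi', zero_mul, smul_zero]
    · rw [hB _ (by omega), iter_zero, mul_zero, smul_zero]

theorem coeff_mono_mul (a : R) (i : ℤ) (B : PsiDO R) (k : ℤ) :
    (mono a i * B).coeff k = ∑ᶠ n : ℕ, Ring.choose i n •
      (a * (Differential.deriv (R := R))^[n] (B.coeff (k - i + n))) := by
  rw [coeff_mul, mulCoeff, finsum_eq_single _ i]
  · simp [coeff_mono]
  · intro j hj
    simp [coeff_mono, hj]

@[simp] theorem coeff_mono_zero_mul (a : R) (B : PsiDO R) (k : ℤ) :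
    (mono a 0 * B).coeff k = a * B.coeff k := by
  rw [coeff_mono_mul, finsum_eq_single _ 0]
  · simp
  · intro n hn
    rw [Ring.choose_zero_pos ℤ (Nat.pos_of_ne_zero hn), zero_smul]

theorem coeff_d_mul (B : PsiDO R) (k : ℤ) :
    (mono 1 1 * B).coeff k = B.coeff (k - 1) + Differential.deriv (B.coeff k) := by
  rw [coeff_mono_mul, finsum_eq_sum_of_support_subset (s := Finset.range 2)]
  · simp [Finset.sum_range_succ]
  · intro n hn
    by_contra hc
    have hchoose : Ring.choose (1 : ℤ) n = 0 := by
      have := Ring.choose_natCast (R := ℤ) 1 n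
      rwa [Nat.choose_eq_zero_of_lt (by simpa using hc), Nat.cast_one, Nat.cast_zero] at this
    exact hn (by simp only [hchoose, zero_smul])

@[simp] theorem coeff_mul_mono_one (A : PsiDO R) (j k : ℤ) :
    (A * mono 1 j).coeff k = A.coeff (k - j) := by
  have iter_one {n : ℕ} (hn : n ≠ 0) : (Differential.deriv (R := R))^[n] (1 : R) = 0 := by
    obtain ⟨n, rfl⟩ := Nat.exists_eq_succ_of_ne_zero hn
    rw [Function.iterate_succ_apply, Derivation.map_one_eq_zero, iter_zero]
  rw [coeff_mul, mulCoeff, finsum_eq_single _ (k - j), finsum_eq_single _ (0 : ℕ)]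
  · simp [coeff_mono]
  · intro n hn
    rw [coeff_mono, if_neg (by omega), iter_zero, mul_zero, smul_zero]
  · intro i hi
    refine finsum_eq_zero_of_forall_eq_zero fun n => ?_
    rw [coeff_mono]
    split_ifs with h
    · rw [iter_one (by omega), mul_zero, smul_zero]
    · rw [iter_zero, mul_zero, smul_zero]

theorem mono_mul_mono_one (a : R) (i j : ℤ) : mono a i * mono 1 j = mono a (i + j) := by
  ext k
  simp only [coeff_mul_mono_one, coeff_mono, sub_eq_iff_eq_add]

theorem mono_zero_mul_mono (a b : R) (j : ℤ) : mono a 0 * mono b j = mono (a * b) j := by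
  ext k
  rw [coeff_mono_zero_mul, coeff_mono, coeff_mono]
  split_ifs <;> simp

theorem d_mul_mono (a : R) (n : ℤ) :
    mono 1 1 * mono a n = mono a (n + 1) + mono (Differential.deriv a) n := by
  ext k
  rw [coeff_d_mul, coeff_add]
  simp only [coeff_mono, sub_eq_iff_eq_add]
  split_ifs <;> simp

theorem mono_one_pow (n : ℕ) : (mono (1 : R) 1) ^ n = mono 1 n := by
  induction n with
  | zero => rfl
  | succ n ih => rw [pow_succ, ih, mono_mul_mono_one, Nat.cast_succ]

theorem coeff_mul_mono_zero (A : PsiDO R) (b : R) (k : ℤ) :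
    (A * mono b 0).coeff k = ∑ᶠ n : ℕ, Ring.choose (k + n) n •
      (A.coeff (k + n) * (Differential.deriv (R := R))^[n] b) := by
  have hinj : Function.Injective (fun n : ℕ => k + (n : ℤ)) := fun a b h => by simpa using h
  have hreindex := finsum_mem_range (f := fun i : ℤ => Ring.choose i (i - k).toNat •
      (A.coeff i * (Differential.deriv (R := R))^[(i - k).toNat] b)) hinj
  simp only [add_sub_cancel_left, Int.toNat_natCast] at hreindex
  rw [coeff_mul, mulCoeff, ← hreindex]
  refine finsum_congr fun i => ?_
  by_cases hi : k ≤ i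
  · have hrange : i ∈ Set.range fun n : ℕ => k + (n : ℤ) := ⟨(i - k).toNat, by simp only; omega⟩
    rw [finsum_eq_single _ (i - k).toNat]
    · rw [coeff_mono, if_pos (by omega)]
      simp only [hrange, finsum_true]
    · intro n hn
      rw [coeff_mono, if_neg (by omega), iter_zero, mul_zero, smul_zero]
  · have hrange : i ∉ Set.range fun n : ℕ => k + (n : ℤ) := by
      rintro ⟨n, rfl⟩
      simp at hi
    simp only [hrange, finsum_false]
    refine finsum_eq_zero_of_forall_eq_zero fun n => ?_
    rw [coeff_mono, if_neg (by omega), iter_zero, mul_zero, smul_zero]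

theorem coeff_neg_one_mul_mono_zero (A : PsiDO R) (b : R) :
    (A * mono b 0).coeff (-1) = A.coeff (-1) * b := by
  rw [coeff_mul_mono_zero, finsum_eq_single _ 0]
  · simp
  · intro n hn
    obtain ⟨n, rfl⟩ := Nat.exists_eq_succ_of_ne_zero hn
    have hchoose := Ring.choose_natCast (R := ℤ) n (n + 1)
    rw [Nat.choose_eq_zero_of_lt (by omega), Nat.cast_zero] at hchoose
    rw [Nat.succ_eq_add_one, show (-1 + ((n + 1 : ℕ) : ℤ)) = (n : ℤ) by push_cast; ring]
    exact (congrArg (· • _) hchoose).trans (zero_smul ℤ _)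

theorem coeff_eq_zero_of_residues {A : PsiDO R}
    (h : ∀ k : ℕ, (mono 1 (k : ℤ) * A).coeff (-1) = 0) {i : ℤ} (hi : i < 0) : A.coeff i = 0 := by
  obtain ⟨k, rfl⟩ : ∃ k : ℕ, i = -1 - (k : ℤ) := ⟨(-1 - i).toNat, by omega⟩
  induction k using Nat.strong_induction_on with
  | _ k ih =>
    have hk := h k
    rw [coeff_mono_mul, finsum_eq_single _ 0] at hk
    · simpa using hk
    · intro n hn
      by_cases hnk : n ≤ k
      · rw [show (-1 - (k : ℤ) + n) = -1 - ((k - n : ℕ) : ℤ) by omega,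
          ih (k - n) (by omega) (by omega), iter_zero, mul_zero, smul_zero]
      · rw [Ring.choose_natCast, Nat.choose_eq_zero_of_lt (by omega), Nat.cast_zero, zero_smul]

/-- The operator `∑_{n ≥ 0} ∂^{-n} ∘ h_n`, whose coefficients stand to the right of `∂`. -/
def coSymbol (h : ℕ → R) : PsiDO R :=
  ofSymbol fun k => (∑ n ∈ Finset.range (k + 1), mono 1 (-(n : ℤ)) * mono (h n) 0).coeff (-k)

theorem coSymbol_mem_ordLE (h : ℕ → R) : coSymbol h ∈ ordLE R 0 := ofSymbol_mem_ordLE _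

theorem coeff_coSymbol_zero (h : ℕ → R) : (coSymbol h).coeff 0 = h 0 := by
  simp [coSymbol, coeff_ofSymbol, coeff_mono]

theorem coSymbol_sub_mem_ordLE (h : ℕ → R) (N : ℕ) :
    coSymbol h - ∑ n ∈ Finset.range N, mono 1 (-(n : ℤ)) * mono (h n) 0 ∈ ordLE R (-N) := by
  have hterm (n : ℕ) : mono 1 (-(n : ℤ)) * mono (h n) 0 ∈ ordLE R (-(n : ℤ)) := by
    simpa using mul_mem_ordLE (mono_mem_ordLE (1 : R) (-(n : ℤ))) (mono_mem_ordLE (h n) 0)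
  intro i hi
  rw [coeff_sub, sub_eq_zero]
  by_cases hi0 : 0 < i
  · rw [coSymbol_mem_ordLE h i hi0]
    exact (sum_mem (fun n _ => ordLE_mono (by omega) (hterm n)) i hi0).symm
  · obtain ⟨k, rfl⟩ : ∃ k : ℕ, i = -(k : ℤ) := ⟨(-i).toNat, by omega⟩
    rw [coSymbol, coeff_ofSymbol, if_pos (by omega), neg_neg, Int.toNat_natCast,
      coeff_sum, coeff_sum]
    refine Finset.sum_subset (Finset.range_subset_range.mpr (by omega)) fun n _ hn => ?_
    have : k + 1 ≤ n := by simpa using hn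
    exact hterm n _ (by omega)

theorem coeff_neg_one_mul_coSymbol (G : PsiDO R) (h : ℕ → R) :
    (G * coSymbol h).coeff (-1) = ∑ᶠ n : ℕ, G.coeff (n - 1) * h n := by
  obtain ⟨N, hN⟩ := G.bdd
  obtain ⟨K, hK⟩ : ∃ K : ℕ, N + 2 ≤ K := ⟨(N + 2).toNat, by omega⟩
  have htrunc := mul_mem_ordLE (show G ∈ ordLE R N from hN) (coSymbol_sub_mem_ordLE h K)
    (-1) (by omega)
  rw [mul_sub, coeff_sub, sub_eq_zero] at htrunc
  rw [htrunc, Finset.mul_sum, coeff_sum, finsum_eq_sum_of_support_subset (s := Finset.range K)]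
  · refine Finset.sum_congr rfl fun n _ => ?_
    rw [← mul_assoc, coeff_neg_one_mul_mono_zero, coeff_mul_mono_one, sub_neg_eq_add,
      neg_add_eq_sub]
  · intro n hn
    by_contra hc
    have : K ≤ n := by simpa using hc
    exact hn (by simp only; rw [hN _ (by omega), zero_mul])

variable (R) in
/-- The subring of differential operators. -/
def diffOps : Subring (PsiDO R) where
  carrier := {A | ∀ i < 0, A.coeff i = 0}
  zero_mem' _ _ := rfl
  one_mem' _ hi := if_neg hi.ne
  add_mem' hA hB i hi := by rw [coeff_add, hA i hi, hB i hi, add_zero]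
  neg_mem' hA i hi := by rw [coeff_neg, hA i hi, neg_zero]
  mul_mem' {A B} hA hB k hk := by
    obtain ⟨N, hA', hB'⟩ := exists_mem_ordLE_pair A B
    rw [coeff_mul_eq_sum hA' hB']
    refine Finset.sum_eq_zero fun i _ => Finset.sum_eq_zero fun j _ => ?_
    by_cases hi : i < 0
    · rw [hA i hi, mulTerm_zero_left]
    by_cases hj : j < 0
    · rw [hB j hj, mulTerm_zero_right]
    lift i to ℕ using not_lt.mp hi
    rw [mulTerm, if_pos (by omega), Ring.choose_natCast, Nat.choose_eq_zero_of_lt (by omega),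
      Nat.cast_zero, zero_smul]

theorem mono_mem_diffOps (a : R) {n : ℤ} (hn : 0 ≤ n) : mono a n ∈ diffOps R :=
  fun i hi => by rw [coeff_mono, if_neg (by omega)]

end Products

section Homs

variable {R S : Type*} [CommRing R] [Differential R] [CommRing S] [Differential S]

theorem map_mulTerm (φ : R →+* S) (hφ : ∀ a, φ (Differential.deriv a) = Differential.deriv (φ a))
    (a b : R) (i j k : ℤ) : φ (mulTerm a b i j k) = mulTerm (φ a) (φ b) i j k := by
  unfold mulTerm
  split_ifs
  · rw [map_zsmul, map_mul, (Function.Semiconj.iterate_right hφ _).eq]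
  · exact map_zero φ

/-- A homomorphism of differential rings acts on pseudodifferential operators. -/
def mapRingHom (φ : R →+* S) (hφ : ∀ a, φ (Differential.deriv a) = Differential.deriv (φ a)) :
    PsiDO R →+* PsiDO S where
  toFun := mapCoeff φ.toAddMonoidHom
  map_zero' := map_zero (mapCoeffHom φ.toAddMonoidHom)
  map_add' := map_add (mapCoeffHom φ.toAddMonoidHom)
  map_one' := by
    ext i
    simp only [coeff_mapCoeff, coeff_one]
    split_ifs <;> simp
  map_mul' A B := by
    obtain ⟨N, hA, hB⟩ := exists_mem_ordLE_pair A B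
    ext k
    rw [coeff_mapCoeff, coeff_mul_eq_sum hA hB,
      coeff_mul_eq_sum (mapCoeff_mem_ordLE _ hA) (mapCoeff_mem_ordLE _ hB)]
    simp only [map_sum, coeff_mapCoeff]
    exact Finset.sum_congr rfl fun i _ => Finset.sum_congr rfl fun j _ =>
      map_mulTerm φ hφ _ _ i j k

theorem negOnePow_smul_smul {M : Type*} [AddCommGroup M] (i j : ℤ) (a : M) :
    (Int.negOnePow i : ℤ) • (Int.negOnePow j : ℤ) • a = (Int.negOnePow (i + j) : ℤ) • a := by
  rw [smul_smul, Int.negOnePow_add, Units.val_mul]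

theorem map_iterate_deriv_of_neg (φ : R →+* S)
    (hφ : ∀ a, φ (Differential.deriv a) = -Differential.deriv (φ a)) (n : ℕ) (a : R) :
    φ ((Differential.deriv (R := R))^[n] a) =
      (Int.negOnePow n : ℤ) • (Differential.deriv (R := S))^[n] (φ a) := by
  induction n generalizing a with
  | zero => simp
  | succ n ih =>
    rw [Function.iterate_succ_apply, ih, hφ, Function.iterate_succ_apply, ← neg_one_zsmul,
      iter_zsmul, smul_smul, Nat.cast_succ, Int.negOnePow_succ, mul_neg_one, Units.val_neg]

theorem negOnePow_smul_map_mulTerm (φ : R →+* S)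
    (hφ : ∀ a, φ (Differential.deriv a) = -Differential.deriv (φ a)) (a b : R) (i j k : ℤ) :
    (Int.negOnePow k : ℤ) • φ (mulTerm a b i j k) =
      mulTerm ((Int.negOnePow i : ℤ) • φ a) ((Int.negOnePow j : ℤ) • φ b) i j k := by
  unfold mulTerm
  split_ifs with h
  · rw [map_zsmul, map_mul, map_iterate_deriv_of_neg φ hφ, iter_zsmul]
    simp only [mul_smul_comm, smul_mul_assoc, negOnePow_smul_smul]
    rw [smul_comm (Int.negOnePow k : ℤ), negOnePow_smul_smul]
    congr 3
    rw [Int.negOnePow_eq_iff, Int.toNat_of_nonneg (by omega)]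
    exact ⟨0, by ring⟩
  · rw [map_zero, smul_zero]

/-- The substitution `∂ ↦ -∂`, combined with a homomorphism that anticommutes with the
derivations. -/
def reflectHom (φ : R →+* S) (hφ : ∀ a, φ (Differential.deriv a) = -Differential.deriv (φ a)) :
    PsiDO R →+* PsiDO S where
  toFun := reflect φ
  map_zero' := by ext i; simp
  map_add' A B := by ext i; simp
  map_one' := by
    ext i
    simp only [coeff_reflect, coeff_one]
    split_ifs with h <;> simp [h]
  map_mul' A B := by
    obtain ⟨N, hA, hB⟩ := exists_mem_ordLE_pair A B
    ext k
    rw [coeff_reflect, coeff_mul_eq_sum hA hB,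
      coeff_mul_eq_sum (reflect_mem_ordLE φ hA) (reflect_mem_ordLE φ hB)]
    simp only [map_sum, coeff_reflect, Finset.smul_sum]
    exact Finset.sum_congr rfl fun i _ => Finset.sum_congr rfl fun j _ =>
      negOnePow_smul_map_mulTerm φ hφ _ _ i j k

variable {𝕜 : Type*} [CommSemiring 𝕜] [Algebra 𝕜 R] (δ : Derivation 𝕜 R R)

theorem derivation_mulTerm (hδ : ∀ a, δ (Differential.deriv a) = Differential.deriv (δ a))
    (a b : R) (i j k : ℤ) :
    δ (mulTerm a b i j k) = mulTerm (δ a) b i j k + mulTerm a (δ b) i j k := by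
  unfold mulTerm
  split_ifs
  · rw [map_zsmul, Derivation.leibniz, (Function.Semiconj.iterate_right hδ _).eq, ← smul_add,
      smul_eq_mul, smul_eq_mul, mul_comm (δ a), add_comm (a * _)]
  · rw [map_zero, add_zero]

theorem mapCoeff_derivation_mul
    (hδ : ∀ a, δ (Differential.deriv a) = Differential.deriv (δ a)) (A B : PsiDO R) :
    mapCoeff δ.toLinearMap.toAddMonoidHom (A * B) =
      mapCoeff δ.toLinearMap.toAddMonoidHom A * B +
        A * mapCoeff δ.toLinearMap.toAddMonoidHom B := by
  obtain ⟨N, hA, hB⟩ := exists_mem_ordLE_pair A B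
  ext k
  rw [coeff_mapCoeff, coeff_add, coeff_mul_eq_sum hA hB,
    coeff_mul_eq_sum (mapCoeff_mem_ordLE _ hA) hB, coeff_mul_eq_sum hA (mapCoeff_mem_ordLE _ hB)]
  simp only [map_sum, ← Finset.sum_add_distrib, coeff_mapCoeff]
  exact Finset.sum_congr rfl fun i _ => Finset.sum_congr rfl fun j _ =>
    derivation_mulTerm δ hδ _ _ i j k

end Homs

end PsiDO

/-! ### Divided powers -/

/-- A sequence with `f_0 = 1`, `f_{i+1}' = f_i` and `f_i f_j = (i + j choose i) f_{i+j}`, such as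
`x^i / i!` for `∂ = ∂/∂x`. -/
structure IsDividedPowerSeq {R : Type*} [CommRing R] [Differential R] (f : ℕ → R) : Prop where
  zero : f 0 = 1
  deriv_succ : ∀ i, Differential.deriv (f (i + 1)) = f i
  mul : ∀ i j, f i * f j = ((i + j).choose i : ℤ) • f (i + j)

theorem negOnePow_natCast (n : ℕ) : (Int.negOnePow n : ℤ) = (-1) ^ n := by
  rw [Int.negOnePow_def, zpow_natCast, Units.val_pow_eq_pow_val, Units.val_neg, Units.val_one]

namespace PsiDO

variable {R : Type*} [CommRing R]

theorem monoNeg_sum {ι : Type*} (s : Finset ι) (a : ι → R) (n : ℤ) :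
    monoNeg (∑ x ∈ s, a x) n = ∑ x ∈ s, monoNeg (a x) n := by
  simp only [monoNeg, Finset.smul_sum, mono_sum]

variable [Differential R]

theorem monoNeg_mul_monoNeg_one (a : R) (m n : ℤ) :
    monoNeg a m * monoNeg 1 n = monoNeg a (m + n) := by
  simp only [monoNeg, mono_zsmul, smul_mul_smul_comm, mono_mul_mono_one, Int.negOnePow_add,
    Units.val_mul]

theorem mono_zero_mul_monoNeg (a b : R) (n : ℤ) :
    mono a 0 * monoNeg b n = monoNeg (a * b) n := by
  rw [monoNeg, mono_zero_mul_mono, mul_smul_comm, monoNeg]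

theorem diffOp_conv (f q : ℕ → R) (p : ℕ) :
    diffOp p (fun j => ∑ i ∈ Finset.range (j + 1), f i * q (j - i)) =
      ∑ n ∈ Finset.range p, mono (q n) 0 * (diffOp (p - n) f * monoNeg 1 n) := by
  simp only [diffOp, Finset.sum_mul, Finset.mul_sum, monoNeg_sum, monoNeg_mul_monoNeg_one,
    mono_zero_mul_monoNeg]
  rw [← Finset.sum_range_diag_flip p fun n i => monoNeg (q n * f i) ((i : ℤ) + n)]
  refine Finset.sum_congr rfl fun j _ => ?_
  rw [← Finset.sum_flip]
  refine Finset.sum_congr rfl fun n hn => ?_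
  have hnj : n ≤ j := by simpa [Nat.lt_succ_iff] using hn
  rw [Nat.sub_sub_self hnj, mul_comm, ← Nat.cast_add, Nat.sub_add_cancel hnj]

theorem sum_mono_mul_conv (f q : ℕ → R) (p : ℕ) :
    ∑ j ∈ Finset.range p, ∑ i ∈ Finset.range (j + 1),
        mono 1 (j : ℤ) * mono (q (j - i) * f i) 0 =
      ∑ n ∈ Finset.range p, ∑ i ∈ Finset.range (p - n),
        mono 1 ((n + i : ℕ) : ℤ) * mono (f i) 0 * mono (q n) 0 := by
  rw [← Finset.sum_range_diag_flip p fun n i =>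
    mono 1 ((n + i : ℕ) : ℤ) * mono (f i) 0 * mono (q n) 0]
  refine Finset.sum_congr rfl fun j _ => ?_
  rw [← Finset.sum_flip]
  refine Finset.sum_congr rfl fun n hn => ?_
  have hnj : n ≤ j := by simpa [Nat.lt_succ_iff] using hn
  rw [Nat.sub_sub_self hnj, mul_assoc, mono_zero_mul_mono, mul_comm (f (j - n)),
    Nat.add_sub_cancel' hnj]

theorem d_inv_mul_mul_d (a : R) :
    mono 1 (-1) * mono a 1 = mono a 0 - mono 1 (-1) * mono (Differential.deriv a) 0 := by
  have hd := congrArg (mono 1 (-1) * ·) (d_mul_mono a 0)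
  simp only [← mul_assoc, mono_mul_mono_one, mul_add] at hd
  rw [zero_add] at hd
  rw [eq_sub_iff_add_eq, ← hd]
  exact one_mul _

theorem d_inv_mul_mono_sub_mem_diffOps (a : R) (n : ℕ) :
    mono 1 (-1) * mono a n -
      ((-1) ^ n : ℤ) • (mono 1 (-1) * mono ((Differential.deriv (R := R))^[n] a) 0) ∈
        diffOps R := by
  induction n generalizing a with
  | zero => simp
  | succ n ih =>
    have hstep : mono 1 (-1) * mono a ((n + 1 : ℕ) : ℤ) =
        mono a n - mono 1 (-1) * mono (Differential.deriv a) n := by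
      have h := congrArg (· * mono 1 (n : ℤ)) (d_inv_mul_mul_d a)
      simp only [sub_mul, mul_assoc, mono_mul_mono_one, zero_add] at h
      rw [Nat.cast_succ, add_comm (n : ℤ), h]
    rw [hstep, Function.iterate_succ_apply, pow_succ, mul_neg_one, neg_smul, sub_neg_eq_add,
      sub_add]
    exact sub_mem (mono_mem_diffOps _ n.cast_nonneg) (ih _)

end PsiDO

namespace IsDividedPowerSeq

open PsiDO

variable {R : Type*} [CommRing R] [Differential R] {f : ℕ → R}

theorem iterate_deriv (hf : IsDividedPowerSeq f) (n k : ℕ) :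
    (Differential.deriv (R := R))^[n] (f k) = if n ≤ k then f (k - n) else 0 := by
  induction n generalizing k with
  | zero => simp
  | succ n ih =>
    rw [Function.iterate_succ_apply]
    cases k with
    | zero => simp [hf.zero]
    | succ k => rw [hf.deriv_succ, ih]; simp

theorem sum_neg_one_pow_smul_mul (hf : IsDividedPowerSeq f) (N : ℕ) :
    ∑ i ∈ Finset.range (N + 1), ((-1) ^ i : ℤ) • (f (N - i) * f i) = if N = 0 then 1 else 0 := by
  have hbinom : ∀ i ∈ Finset.range (N + 1), ((-1) ^ i : ℤ) • (f (N - i) * f i) =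
      ((-1) ^ i * (N.choose i : ℤ)) • f N := by
    intro i hi
    have hiN : i ≤ N := by simpa [Nat.lt_succ_iff] using hi
    rw [mul_comm (f (N - i)), hf.mul, Nat.add_sub_cancel' hiN, smul_smul]
  rw [Finset.sum_congr rfl hbinom, ← Finset.sum_smul, Int.alternating_sum_range_choose]
  split_ifs with hN
  · rw [hN, hf.zero, one_smul]
  · rw [zero_smul]

/-- Since `∂⁻¹ ∘ a ∘ ∂ = a - ∂⁻¹ ∘ a'`, the sum telescopes. -/
theorem diffOp_succ (hf : IsDividedPowerSeq f) (k : ℕ) :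
    diffOp (k + 1) f = ((-1) ^ k : ℤ) • (mono 1 (-1) * mono (f k) (k + 1)) := by
  induction k with
  | zero =>
    rw [diffOp, Finset.sum_range_one, hf.zero, Nat.cast_zero, zero_add, mono_mul_mono_one]
    simp [monoNeg]
  | succ k ih =>
    have h := congrArg (· * mono 1 ((k : ℤ) + 1)) (d_inv_mul_mul_d (f (k + 1)))
    simp only [sub_mul, mul_assoc, mono_mul_mono_one, hf.deriv_succ, zero_add] at h
    rw [diffOp, Finset.sum_range_succ, ← diffOp, ih, Nat.cast_succ, add_comm ((k : ℤ) + 1) 1, h,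
      monoNeg, ← Nat.cast_succ, negOnePow_natCast, mono_zsmul, smul_sub, pow_succ]
    simp only [mul_neg_one, neg_smul]
    abel

theorem diffOp_mul_monoNeg_neg (hf : IsDividedPowerSeq f) (k : ℕ) :
    diffOp (k + 1) f * monoNeg 1 (-((k + 1 : ℕ) : ℤ)) = -(mono 1 (-1) * mono (f k) 0) := by
  rw [hf.diffOp_succ, monoNeg, mono_zsmul, Int.negOnePow_neg, negOnePow_natCast,
    smul_mul_smul_comm, mul_assoc, mono_mul_mono_one, ← pow_add, ← Nat.cast_succ, add_neg_cancel,
    Odd.neg_one_pow ⟨k, by ring⟩, neg_one_smul]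

theorem sum_iterate_deriv_mul (hf : IsDividedPowerSeq f) {k n M : ℕ} (hk : k < n + M) :
    ∑ i ∈ Finset.range M,
        ((-1) ^ (n + i) : ℤ) • ((Differential.deriv (R := R))^[n + i] (f k) * f i) =
      if n = k then ((-1) ^ k : ℤ) • 1 else 0 := by
  simp only [hf.iterate_deriv]
  by_cases hnk : n ≤ k
  · obtain ⟨N, rfl⟩ := Nat.exists_eq_add_of_le hnk
    rw [← Finset.sum_subset (s₁ := Finset.range (N + 1))
      (Finset.range_subset_range.mpr (by omega))]
    · have hN := congrArg (((-1) ^ n : ℤ) • ·) (hf.sum_neg_one_pow_smul_mul N)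
      simp only [Finset.smul_sum, smul_smul, ← pow_add] at hN
      convert hN using 1
      · refine Finset.sum_congr rfl fun i hi => ?_
        rw [if_pos (by simp at hi; omega), Nat.add_sub_add_left]
      · by_cases hN0 : N = 0 <;> simp [hN0]
    · intro i _ hi
      rw [if_neg (by simp at hi; omega), zero_mul, smul_zero]
  · rw [if_neg (by omega)]
    exact Finset.sum_eq_zero fun i _ => by rw [if_neg (by omega), zero_mul, smul_zero]

theorem sum_d_inv_mul_sub_mem_diffOps (hf : IsDividedPowerSeq f) {k n M : ℕ} (hk : k < n + M) :
    ∑ i ∈ Finset.range M, mono 1 (-1) * mono (f k) ((n + i : ℕ) : ℤ) * mono (f i) 0 -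
      (if n = k then ((-1) ^ k : ℤ) • mono 1 (-1) else 0) ∈ diffOps R := by
  have hterms := sum_mem (t := Finset.range M) fun i _ =>
    mul_mem (d_inv_mul_mono_sub_mem_diffOps (f k) (n + i)) (mono_mem_diffOps (f i) le_rfl)
  simp only [sub_mul, Finset.sum_sub_distrib] at hterms
  convert hterms using 2
  have hsum := congrArg (fun a => mono 1 (-1) * mono a 0) (hf.sum_iterate_deriv_mul hk)
  simp only [mono_sum, mono_zsmul, Finset.mul_sum, mul_smul_comm] at hsum
  simp only [smul_mul_assoc, mul_assoc, mono_zero_mul_mono, hsum]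
  split_ifs
  · rw [mono_zsmul, mul_smul_comm, mono_mul_mono_one, add_zero]
  · rw [mono_zero, mul_zero]

theorem diffOp_conv_mul_monoNeg_neg (hf : IsDividedPowerSeq f) (p : ℕ) (q : ℕ → R) :
    diffOp p (fun j => ∑ i ∈ Finset.range (j + 1), f i * q (j - i)) * monoNeg 1 (-(p : ℤ)) =
      -∑ n ∈ Finset.range p, mono (q n) (-1) * mono (f (p - 1 - n)) 0 := by
  rw [diffOp_conv, Finset.sum_mul, ← Finset.sum_neg_distrib]
  refine Finset.sum_congr rfl fun n hn => ?_
  obtain ⟨k, rfl⟩ : ∃ k, p = n + k + 1 := ⟨p - n - 1, by simp at hn; omega⟩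
  rw [mul_assoc, mul_assoc, monoNeg_mul_monoNeg_one, show n + k + 1 - n = k + 1 by omega,
    show (n : ℤ) + -((n + k + 1 : ℕ) : ℤ) = -((k + 1 : ℕ) : ℤ) by push_cast; ring,
    hf.diffOp_mul_monoNeg_neg, mul_neg, ← mul_assoc, mono_mul_mono_one, zero_add,
    show n + k + 1 - 1 - n = k by omega]

/-- The two factors contribute `∑_n q_n ∂⁻¹ ∘ f_{p-1-n}` and `∑_{n',i} ∂^{n'+i} ∘ f_i q'_{n'}`;
moving `∂^{n'+i}` to the left through `∂⁻¹ ∘ f_{p-1-n}` leaves an alternating sum of binomial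
coefficients, which vanishes unless `n + n' = p - 1`. -/
theorem diffOp_mul_monoNeg_mul_sum_mem_diffOps (hf : IsDividedPowerSeq f) (p : ℕ)
    (q q' : ℕ → R) :
    diffOp p (fun j => ∑ i ∈ Finset.range (j + 1), f i * q (j - i)) * monoNeg 1 (-(p : ℤ)) *
        (∑ j ∈ Finset.range p, ∑ i ∈ Finset.range (j + 1),
          mono 1 j * mono (q' (j - i) * f i) 0) +
      ∑ n ∈ Finset.range p, ((-1) ^ (p - 1 - n) : ℤ) •
        (mono (q n) (-1) * mono (q' (p - 1 - n)) 0) ∈ diffOps R := by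
  have hterms := sum_mem (t := Finset.range p) fun n hn => sum_mem (t := Finset.range p)
    fun n' _ => mul_mem (mul_mem (mono_mem_diffOps (q n) le_rfl)
      (hf.sum_d_inv_mul_sub_mem_diffOps (k := p - 1 - n) (n := n') (M := p - n')
        (by simp at hn; omega))) (mono_mem_diffOps (q' n') le_rfl)
  rw [hf.diffOp_conv_mul_monoNeg_neg, sum_mono_mul_conv, ← neg_mem_iff, neg_mul, neg_add, neg_neg,
    ← sub_eq_add_neg]
  convert hterms using 1
  simp only [mul_sub, sub_mul, Finset.sum_sub_distrib]
  congr 1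
  · rw [Finset.sum_mul]
    simp only [Finset.mul_sum, Finset.sum_mul, ← mul_assoc, mono_mul_mono_one, zero_add]
    refine Finset.sum_congr rfl fun n _ => Finset.sum_congr rfl fun n' _ =>
      Finset.sum_congr rfl fun i _ => ?_
    rw [mul_assoc (mono (q n) (-1)), mono_mul_mono_one, zero_add]
  · refine Finset.sum_congr rfl fun n hn => ?_
    rw [Finset.sum_eq_single_of_mem (p - 1 - n) (by simp at hn ⊢; omega)]
    · rw [if_pos rfl, mul_smul_comm, smul_mul_assoc, mono_mul_mono_one, zero_add]
    · intro n' _ hn'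
      rw [if_neg hn', mul_zero, zero_mul]

end IsDividedPowerSeq

/-! ### Matrix pseudodifferential operators -/

theorem leibniz_conj {A : Type*} [Ring A] (d : A →+ A)
    (hd : ∀ x y, d (x * y) = d x * y + x * d y) {Q T C : A} (hQT : Q * T = 1) (hTQ : T * Q = 1)
    (hC : d C = 0) : d (Q * C * T) = ⁅d Q * T, Q * C * T⁆ := by
  have hone : d 1 = 0 := by simpa using hd 1 1
  have hT : d T = -(T * (d Q * T)) := by
    have h := congrArg (T * ·) (hd Q T)
    simp only [hQT, hone, mul_zero, mul_add, ← mul_assoc T Q, hTQ, one_mul] at h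
    exact eq_neg_of_add_eq_zero_right h.symm
  have hQ : d Q = d Q * T * Q := by rw [mul_assoc, hTQ, mul_one]
  rw [hd, hd, hC, hT, Ring.lie_def]
  nth_rewrite 1 [hQ]
  noncomm_ring

namespace PsiDO

variable {R : Type*} [CommRing R] {I J K : Type*}

/-- The matrix of the coefficients of `∂^i`. -/
def matCoeff (i : ℤ) : Matrix I J (PsiDO R) →+ Matrix I J R := (coeffHom i).mapMatrix

@[simp] theorem matCoeff_apply (i : ℤ) (A : Matrix I J (PsiDO R)) (a : I) (b : J) :
    matCoeff i A a b = (A a b).coeff i := rfl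

theorem matrix_ordLE_mono : Monotone fun N => ((ordLE R N).matrix : AddSubgroup (Matrix I J _)) :=
  fun _ _ hNM _ hA a b => ordLE_mono hNM (hA a b)

theorem mem_matrix_ordLE_pred {A : Matrix I J (PsiDO R)} {N : ℤ} (hA : A ∈ (ordLE R N).matrix)
    (hN : matCoeff N A = 0) : A ∈ (ordLE R (N - 1)).matrix := by
  intro a b i hi
  rcases (Int.sub_one_lt_iff.mp hi).eq_or_lt with rfl | hi
  · exact congrFun (congrFun hN a) b
  · exact hA a b i hi

theorem eq_zero_of_forall_mem_matrix_ordLE {A : Matrix I J (PsiDO R)}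
    (h : ∀ n : ℕ, A ∈ (ordLE R (-(n : ℤ))).matrix) : A = 0 := by
  ext a b i
  exact h (-i + 1).toNat a b i (by omega)

theorem eq_map_pos_sub {A B : Matrix I J (PsiDO R)} (hA : A ∈ (ordLE R (-1)).matrix)
    (h : ∀ a b, ∀ i < 0, (A a b + B a b).coeff i = 0) : A = B.map pos - B := by
  ext a b i
  rw [Matrix.sub_apply, Matrix.map_apply, coeff_sub, coeff_pos]
  split_ifs with hi
  · rw [hA a b i (by omega), sub_self]
  · rw [zero_sub, eq_neg_iff_add_eq_zero, ← coeff_add]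
    exact h a b i (by omega)

variable [Differential R]

section Mul

variable [Fintype J]

theorem mul_mem_matrix_ordLE {A : Matrix I J (PsiDO R)} {B : Matrix J K (PsiDO R)} {N M : ℤ}
    (hA : A ∈ (ordLE R N).matrix) (hB : B ∈ (ordLE R M).matrix) :
    A * B ∈ (ordLE R (N + M)).matrix := fun a b => by
  rw [Matrix.mul_apply]
  exact sum_mem fun c _ => mul_mem_ordLE (hA a c) (hB c b)

theorem matCoeff_mul_top {A : Matrix I J (PsiDO R)} {B : Matrix J K (PsiDO R)} {N M : ℤ}
    (hA : A ∈ (ordLE R N).matrix) (hB : B ∈ (ordLE R M).matrix) :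
    matCoeff (N + M) (A * B) = matCoeff N A * matCoeff M B := by
  ext a b
  simp only [matCoeff_apply, Matrix.mul_apply, coeff_sum]
  exact Finset.sum_congr rfl fun c _ => coeff_mul_top (hA a c) (hB c b)

end Mul

section One

variable [DecidableEq I]

theorem one_mem_matrix_ordLE : (1 : Matrix I I (PsiDO R)) ∈ (ordLE R 0).matrix := by
  intro a b
  rw [Matrix.one_apply]
  split_ifs
  · exact mono_mem_ordLE 1 0
  · exact zero_mem _

theorem matCoeff_one : matCoeff 0 (1 : Matrix I I (PsiDO R)) = 1 := by
  ext a b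
  simp only [matCoeff_apply, Matrix.one_apply]
  split_ifs <;> simp [coeff_one]

end One

variable [Fintype I]

theorem map_mapCoeff_derivation_mul {𝕜 : Type*} [CommSemiring 𝕜] [Algebra 𝕜 R]
    (δ : Derivation 𝕜 R R) (hδ : ∀ a, δ (Differential.deriv a) = Differential.deriv (δ a))
    (A B : Matrix I I (PsiDO R)) :
    (mapCoeffHom δ.toLinearMap.toAddMonoidHom).mapMatrix (A * B) =
      (mapCoeffHom δ.toLinearMap.toAddMonoidHom).mapMatrix A * B +
        A * (mapCoeffHom δ.toLinearMap.toAddMonoidHom).mapMatrix B := by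
  ext1 a b
  simp only [AddMonoidHom.mapMatrix_apply, Matrix.map_apply, Matrix.mul_apply, Matrix.add_apply,
    map_sum, mapCoeffHom_apply, mapCoeff_derivation_mul δ hδ, Finset.sum_add_distrib]

variable [DecidableEq I]

theorem lax_of_dressing {𝕜 : Type*} [CommSemiring 𝕜] [Algebra 𝕜 R] (δ : Derivation 𝕜 R R)
    (hδ : ∀ a, δ (Differential.deriv a) = Differential.deriv (δ a))
    {Q T C D : Matrix I I (PsiDO R)} (hQT : Q * T = 1) (hTQ : T * Q = 1)
    (hC : C.map (mapCoeff δ.toLinearMap.toAddMonoidHom) = 0) (hCD : Commute C D)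
    (hQ : Q.map (mapCoeff δ.toLinearMap.toAddMonoidHom) * T =
      (Q * D * T).map pos - Q * D * T) :
    (Q * C * T).map (mapCoeff δ.toLinearMap.toAddMonoidHom) =
      ⁅(Q * D * T).map pos, Q * C * T⁆ := by
  have hcomm : Q * D * T * (Q * C * T) = Q * C * T * (Q * D * T) := by
    calc Q * D * T * (Q * C * T) = Q * (D * ((T * Q) * C)) * T := by noncomm_ring
      _ = Q * (C * ((T * Q) * D)) * T := by rw [hTQ, one_mul, one_mul, hCD.eq]
      _ = Q * C * T * (Q * D * T) := by noncomm_ring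
  refine (leibniz_conj _ (map_mapCoeff_derivation_mul δ hδ) hQT hTQ hC).trans ?_
  change ⁅Q.map (mapCoeff δ.toLinearMap.toAddMonoidHom) * T, _⁆ = _
  rw [hQ, Ring.lie_def, Ring.lie_def, sub_mul, mul_sub, hcomm, sub_sub_sub_cancel_right]

theorem pow_mem_matrix_ordLE {B : Matrix I I (PsiDO R)} (hB : B ∈ (ordLE R 1).matrix) (k : ℕ) :
    B ^ k ∈ (ordLE R k).matrix := by
  induction k with
  | zero => exact one_mem_matrix_ordLE
  | succ k ih =>
    rw [pow_succ, Nat.cast_succ]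
    exact mul_mem_matrix_ordLE ih hB

theorem matCoeff_pow {B : Matrix I I (PsiDO R)} {c : R} (hB : B ∈ (ordLE R 1).matrix)
    (hc : matCoeff 1 B = c • 1) (k : ℕ) : matCoeff k (B ^ k) = c ^ k • 1 := by
  induction k with
  | zero => rw [pow_zero, pow_zero, one_smul]; exact matCoeff_one
  | succ k ih =>
    rw [pow_succ, Nat.cast_succ, matCoeff_mul_top (pow_mem_matrix_ordLE hB k) hB, ih, hc,
      smul_mul_smul_comm, mul_one, pow_succ]

theorem pow_succ_sub_mem_matrix_ordLE {B C : Matrix I I (PsiDO R)} {e : ℤ}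
    (hB : B ∈ (ordLE R 1).matrix) (hC : C ∈ (ordLE R 1).matrix)
    (hBC : B - C ∈ (ordLE R e).matrix) (k : ℕ) :
    B ^ (k + 1) - C ^ (k + 1) ∈ (ordLE R (e + k)).matrix := by
  induction k with
  | zero => simpa using hBC
  | succ k ih =>
    have hsplit : B ^ (k + 1 + 1) - C ^ (k + 1 + 1) =
        (B ^ (k + 1) - C ^ (k + 1)) * B + C ^ (k + 1) * (B - C) := by
      rw [pow_succ B, pow_succ C]; noncomm_ring
    rw [hsplit, Nat.cast_succ, ← add_assoc]
    refine add_mem (mul_mem_matrix_ordLE ih hB) ?_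
    convert mul_mem_matrix_ordLE (pow_mem_matrix_ordLE hC (k + 1)) hBC using 3
    push_cast; ring

theorem matCoeff_pow_succ_sub {B C : Matrix I I (PsiDO R)} {c : R} {e : ℤ}
    (hB : B ∈ (ordLE R 1).matrix) (hC : C ∈ (ordLE R 1).matrix)
    (hBc : matCoeff 1 B = c • 1) (hCc : matCoeff 1 C = c • 1)
    (hBC : B - C ∈ (ordLE R e).matrix) (k : ℕ) :
    matCoeff (e + k) (B ^ (k + 1) - C ^ (k + 1)) =
      (((k + 1 : ℕ) : R) * c ^ k) • matCoeff e (B - C) := by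
  induction k with
  | zero => simp
  | succ k ih =>
    have hsplit : B ^ (k + 1 + 1) - C ^ (k + 1 + 1) =
        (B ^ (k + 1) - C ^ (k + 1)) * B + C ^ (k + 1) * (B - C) := by
      rw [pow_succ B, pow_succ C]; noncomm_ring
    have hleft := matCoeff_mul_top (pow_succ_sub_mem_matrix_ordLE hB hC hBC k) hB
    have hright := matCoeff_mul_top (pow_mem_matrix_ordLE hC (k + 1)) hBC
    rw [show ((k + 1 : ℕ) : ℤ) + e = e + k + 1 by push_cast; ring] at hright
    rw [hsplit, Nat.cast_succ (R := ℤ), ← add_assoc, map_add, hleft, hright, ih, hBc,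
      matCoeff_pow hC hCc, smul_mul_smul_comm, mul_one, smul_mul_assoc, one_mul, ← add_smul]
    congr 1
    push_cast
    ring

theorem pow_succ_injective_of_leading {k : ℕ} {c : R}
    (hc : IsLeftRegular (((k + 1 : ℕ) : R) * c ^ k)) {B C : Matrix I I (PsiDO R)}
    (hB : B ∈ (ordLE R 1).matrix) (hC : C ∈ (ordLE R 1).matrix)
    (hBc : matCoeff 1 B = c • 1) (hCc : matCoeff 1 C = c • 1)
    (h : B ^ (k + 1) = C ^ (k + 1)) : B = C := by
  have hdescend {e : ℤ} (he : B - C ∈ (ordLE R e).matrix) :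
      B - C ∈ (ordLE R (e - 1)).matrix := by
    refine mem_matrix_ordLE_pred he ?_
    have hcoeff := matCoeff_pow_succ_sub hB hC hBc hCc he k
    rw [h, sub_self, map_zero] at hcoeff
    ext a b
    exact hc ((congrFun (congrFun hcoeff a) b).symm.trans (mul_zero _).symm)
  refine sub_eq_zero.mp (eq_zero_of_forall_mem_matrix_ordLE fun e => ?_)
  induction e with
  | zero =>
    refine mem_matrix_ordLE_pred (N := 1) (sub_mem hB hC) ?_
    rw [map_sub, hBc, hCc, sub_self]
  | succ e ih =>
    rw [Nat.cast_succ, neg_add]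
    exact hdescend ih

/-- The error `B * A - 1` is minus its own square, so its order is not bounded below. -/
theorem mul_eq_one_symm_of_sub_one_mem_ordLE {A B : Matrix I I (PsiDO R)} (h : A * B = 1)
    (hBA : B * A - 1 ∈ (ordLE R (-1)).matrix) : B * A = 1 := by
  set K := B * A - 1 with hK
  have hsquare : K = -(K * K) := by
    have hidem : B * A * (B * A) = B * A := by rw [mul_assoc, ← mul_assoc A B A, h, one_mul]
    rw [hK, sub_mul, mul_sub, hidem]
    noncomm_ring
  have horder (n : ℕ) : K ∈ (ordLE R (-(n : ℤ) - 1)).matrix := by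
    induction n with
    | zero => simpa using hBA
    | succ n ih =>
      rw [hsquare]
      exact neg_mem (matrix_ordLE_mono (by push_cast; omega) (mul_mem_matrix_ordLE ih ih))
  exact sub_eq_zero.mp
    (eq_zero_of_forall_mem_matrix_ordLE fun n => matrix_ordLE_mono (by omega) (horder n))

end PsiDO

/-! ### Partial derivatives of functions of infinitely many variables -/

section Directional

variable {𝕜 ι κ : Type*} [RCLike 𝕜]

theorem TimeDomain.eventually_add_smul_mem (Ω : TimeDomain 𝕜 ι) (v : ι →₀ 𝕜) {t : ι → 𝕜}
    (ht : t ∈ Ω.carrier) : ∀ᶠ s : 𝕜 in 𝓝 0, t + ⇑(s • v) ∈ Ω.carrier := by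
  have hconst : Filter.Tendsto (fun (s : 𝕜) (_ : Fin 1) => s) (𝓝 0) (𝓝 0) :=
    (continuous_pi fun _ => continuous_id).tendsto' _ _ rfl
  simpa [timeShift] using hconst.eventually (Ω.isOpen' t ht 1 fun _ => v)

variable [NormedAlgebra 𝕜 ℂ]

theorem dirDeriv_eq_fderiv (Ω : TimeDomain 𝕜 ι) {f : Ω.carrier → ℂ} {n : ℕ}
    {t : ι → 𝕜} {w : Fin n → ι →₀ 𝕜} {z : Fin n → 𝕜} (hz : timeShift t w z ∈ Ω.carrier)
    (hd : DifferentiableAt 𝕜 (fun y : Fin n → 𝕜 => Ω.zeroExt f (timeShift t w y)) z)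
    (y : Fin n → 𝕜) :
    dirDeriv Ω (∑ i, y i • w i) f ⟨_, hz⟩ =
      fderiv 𝕜 (fun y : Fin n → 𝕜 => Ω.zeroExt f (timeShift t w y)) z y := by
  rw [← hd.lineDeriv_eq_fderiv, lineDeriv, dirDeriv]
  congr 1
  funext s
  simp only [timeShift, add_assoc]
  congr 2
  rw [← Finsupp.coe_add]
  congr 1
  simp [add_smul, Finset.sum_add_distrib, Finset.smul_sum, smul_smul]

theorem differentiableAt_zeroExt_timeShift (Ω : TimeDomain 𝕜 ι) {f : Ω.carrier → ℂ}
    (hf : Ω.IsSmooth f) {n : ℕ} {t : ι → 𝕜} (ht : t ∈ Ω.carrier) (w : Fin n → ι →₀ 𝕜) :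
    DifferentiableAt 𝕜 (fun y : Fin n → 𝕜 => Ω.zeroExt f (timeShift t w y)) 0 :=
  (hf t ht n w).differentiableAt (by simp)

theorem dirDeriv_sum_smul (Ω : TimeDomain 𝕜 ι) {f : Ω.carrier → ℂ} (hf : Ω.IsSmooth f)
    {n : ℕ} (w : Fin n → ι →₀ 𝕜) (y : Fin n → 𝕜) (t : Ω.carrier) :
    dirDeriv Ω (∑ i, y i • w i) f t = ∑ i, y i • dirDeriv Ω (w i) f t := by
  obtain ⟨t, ht⟩ := t
  have hz : timeShift t w 0 ∈ Ω.carrier := by rwa [timeShift_zero]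
  have hbase : (⟨t, ht⟩ : Ω.carrier) = ⟨timeShift t w 0, hz⟩ :=
    Subtype.ext (timeShift_zero t w).symm
  have hd := differentiableAt_zeroExt_timeShift Ω hf ht w
  have hbasis (i) : dirDeriv Ω (w i) f ⟨timeShift t w 0, hz⟩ = fderiv 𝕜
      (fun y : Fin n → 𝕜 => Ω.zeroExt f (timeShift t w y)) 0 (Pi.single i 1) := by
    rw [← dirDeriv_eq_fderiv Ω hz hd]
    simp [Pi.single_apply]
  rw [hbase, dirDeriv_eq_fderiv Ω hz hd]
  simp only [hbasis, ← map_smul, ← map_sum]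
  congr 1
  funext j
  simp [Finset.sum_apply, Pi.single_apply]

/-- The derivative of `f` as a linear function of the direction. -/
def dirDerivationHom (Ω : TimeDomain 𝕜 ι) (f : SmoothFn Ω) : (ι →₀ 𝕜) →ₗ[𝕜] SmoothFn Ω where
  toFun v := dirDerivation Ω v f
  map_add' v w := by
    ext t
    have h := dirDeriv_sum_smul Ω f.2 ![v, w] 1 t
    simp only [Fin.sum_univ_two, Pi.one_apply, one_smul] at h
    exact h
  map_smul' c v := by
    ext t
    have h := dirDeriv_sum_smul Ω f.2 ![v] ![c] t
    simp only [Fin.sum_univ_one] at h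
    exact h

theorem dirDeriv_dirDeriv_eq_fderiv_fderiv (Ω : TimeDomain 𝕜 ι) {f : Ω.carrier → ℂ}
    (hf : Ω.IsSmooth f) {n : ℕ} (u : Fin n → ι →₀ 𝕜) (i j : Fin n) {t : ι → 𝕜}
    (ht : t ∈ Ω.carrier) :
    dirDeriv Ω (u i) (dirDeriv Ω (u j) f) ⟨t, ht⟩ =
      fderiv 𝕜 (fderiv 𝕜 fun y : Fin n → 𝕜 => Ω.zeroExt f (timeShift t u y)) 0
        (Pi.single i 1) (Pi.single j 1) := by
  set F := fun y : Fin n → 𝕜 => Ω.zeroExt f (timeShift t u y)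
  have hF : ContDiffAt 𝕜 ∞ F 0 := hf t ht n u
  have hsingle (k) : ∑ x, (Pi.single k 1 : Fin n → 𝕜) x • u x = u k := by
    simp [Pi.single_apply]
  have hfirst : ∀ᶠ y in 𝓝 (0 : Fin n → 𝕜),
      Ω.zeroExt (dirDeriv Ω (u j) f) (timeShift t u y) = fderiv 𝕜 F y (Pi.single j 1) := by
    have hC1 : ContDiffAt 𝕜 1 F 0 := hF.of_le (by exact_mod_cast le_top)
    filter_upwards [Ω.isOpen' t ht n u, hC1.eventually (by simp)] with y hy hC1y
    rw [Ω.zeroExt_of_mem _ hy, ← dirDeriv_eq_fderiv Ω hy (hC1y.differentiableAt (by simp)),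
      hsingle]
  have hz : timeShift t u 0 ∈ Ω.carrier := by rwa [timeShift_zero]
  have hbase : (⟨t, ht⟩ : Ω.carrier) = ⟨timeShift t u 0, hz⟩ :=
    Subtype.ext (timeShift_zero t u).symm
  have hsecond := dirDeriv_eq_fderiv Ω hz
    (differentiableAt_zeroExt_timeShift Ω (dirDeriv_smooth Ω (u j) hf) ht u) (Pi.single i 1)
  rw [hsingle] at hsecond
  have hdF : DifferentiableAt 𝕜 (fderiv 𝕜 F) 0 :=
    (hF.fderiv_right (m := ∞) (by simp)).differentiableAt (by simp)
  rw [hbase, hsecond, Filter.EventuallyEq.fderiv_eq hfirst,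
    fderiv_clm_apply hdF (differentiableAt_const _)]
  simp

theorem dirDerivation_comm (Ω : TimeDomain 𝕜 ι) (v w : ι →₀ 𝕜) (f : SmoothFn Ω) :
    dirDerivation Ω v (dirDerivation Ω w f) = dirDerivation Ω w (dirDerivation Ω v f) := by
  ext ⟨t, ht⟩
  have hvw := dirDeriv_dirDeriv_eq_fderiv_fderiv Ω f.2 ![v, w] 0 1 ht
  have hwv := dirDeriv_dirDeriv_eq_fderiv_fderiv Ω f.2 ![v, w] 1 0 ht
  have hsymm :
      IsSymmSndFDerivAt 𝕜 (fun y : Fin 2 → 𝕜 => Ω.zeroExt f.1 (timeShift t ![v, w] y)) 0 :=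
    (f.2 t ht 2 ![v, w]).isSymmSndFDerivAt (by
      rw [minSmoothness_of_isRCLikeNormedField]; exact WithTop.coe_le_coe.mpr le_top)
  rw [hsymm.eq] at hvw
  exact hvw.trans hwv.symm

theorem pderivT_comm {Ω : TimeDomain 𝕜 ι} (i j : ι) (f : SmoothFn Ω) :
    pderivT i (pderivT j f) = pderivT j (pderivT i f) := dirDerivation_comm _ _ _ _

theorem dirDerivation_pullback {Ω : TimeDomain 𝕜 ι} (φ : TimeMap 𝕜 κ ι) (v : κ →₀ 𝕜)
    (f : SmoothFn Ω) : dirDerivation (Ω.comap φ) v (pullback φ f) =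
      pullback φ (dirDerivation Ω (Finsupp.linearCombination 𝕜 φ.col v) f) := by
  ext t
  change deriv _ _ = deriv _ _
  congr 1
  funext s
  rw [← map_smul, show φ.toFun t.1 + ⇑(Finsupp.linearCombination 𝕜 φ.col (s • v)) =
    φ.toFun (t.1 + ⇑(s • v)) from (φ.map_add _ _).symm]
  rfl

theorem pderivT_pullback {Ω : TimeDomain 𝕜 ι} (φ : TimeMap 𝕜 κ ι) (j : κ)
    (f : SmoothFn Ω) : pderivT j (pullback φ f) = pullback φ (dirDerivation Ω (φ.col j) f) := by
  rw [pderivT, dirDerivation_pullback, Finsupp.linearCombination_single, one_smul]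

/-- Restriction of functions to the set where `g` does not vanish. -/
def restrictNonvanishing {Ω : TimeDomain 𝕜 ι} (g : SmoothFn Ω) :
    SmoothFn Ω →+* SmoothFn (nonvanishing g) where
  toFun f := ⟨fun t => f.1 ⟨t.1, t.2.1⟩, (nonvanishing g).isSmooth_of _ fun t ht n v =>
    ⟨_, f.2 t ht.1 n v, fun _ hy => Ω.zeroExt_of_mem _ hy.1⟩⟩
  map_one' := rfl
  map_mul' _ _ := rfl
  map_zero' := rfl
  map_add' _ _ := rfl

theorem dirDerivation_restrictNonvanishing {Ω : TimeDomain 𝕜 ι} (g : SmoothFn Ω) (v : ι →₀ 𝕜)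
    (f : SmoothFn Ω) : dirDerivation _ v (restrictNonvanishing g f) =
      restrictNonvanishing g (dirDerivation Ω v f) := by
  ext t
  refine Filter.EventuallyEq.deriv_eq ?_
  filter_upwards [(nonvanishing g).eventually_add_smul_mem v t.2] with s hs
  rw [TimeDomain.zeroExt_of_mem _ _ hs, TimeDomain.zeroExt_of_mem _ _ hs.1]
  rfl

theorem quotFn_eq_quotFn_one_mul {Ω : TimeDomain 𝕜 ι} (f g : SmoothFn Ω) :
    quotFn f g = quotFn 1 g * restrictNonvanishing g f := by
  ext t
  change _ / _ = (1 : ℂ) / _ * _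
  rw [one_div, div_eq_inv_mul]
  rfl

theorem quotFn_self {Ω : TimeDomain 𝕜 ι} (g : SmoothFn Ω) : quotFn g g = 1 := by
  ext t
  exact div_self t.2.2

theorem pderivT_coordFn (Ω : TimeDomain 𝕜 ι) (i : ι) : pderivT i (coordFn Ω i) = 1 := by
  ext t
  have hline : HasDerivAt (fun s : 𝕜 => algebraMap 𝕜 ℂ (t.1 i + s)) 1 0 := by
    have h := ((Algebra.linearMap 𝕜 ℂ).toContinuousLinearMap.hasFDerivAt
      (x := t.1 i + 0)).comp_hasDerivAt (0 : 𝕜) ((hasDerivAt_id _).const_add _)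
    rwa [show (Algebra.linearMap 𝕜 ℂ).toContinuousLinearMap 1 = 1 from
      map_one (algebraMap 𝕜 ℂ)] at h
  refine Eq.trans (Filter.EventuallyEq.deriv_eq ?_) hline.deriv
  filter_upwards [Ω.eventually_add_smul_mem (Finsupp.single i 1) t.2] with s hs
  rw [TimeDomain.zeroExt_of_mem _ _ hs]
  simp [coordFn]

end Directional

/-! ### Bilinear equations -/

section StableKernel

variable {M N M' N' ι κ : Type*} [AddCommGroup M] [AddCommGroup N] [AddCommGroup M']
  [AddCommGroup N'] {T : ι → AddMonoid.End M} {π : M →+ N}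

/-- The elements on which `π` vanishes after any product of the operators `T i`: the largest
`T`-stable subgroup of the kernel of `π`. -/
def stableKer (T : ι → AddMonoid.End M) (π : M →+ N) : AddSubgroup M :=
  ⨅ l : List ι, (π.comp (l.map T).prod).ker

theorem mem_stableKer {G : M} : G ∈ stableKer T π ↔ ∀ l : List ι, π ((l.map T).prod G) = 0 :=
  AddSubgroup.mem_iInf

theorem map_eq_zero_of_mem_stableKer {G : M} (hG : G ∈ stableKer T π) : π G = 0 :=
  mem_stableKer.mp hG []

theorem apply_mem_stableKer {G : M} (hG : G ∈ stableKer T π) (i : ι) :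
    T i G ∈ stableKer T π :=
  mem_stableKer.mpr fun l => by simpa using mem_stableKer.mp hG (l ++ [i])

theorem pow_apply_mem_stableKer {G : M} (hG : G ∈ stableKer T π) (i : ι) (k : ℕ) :
    (T i ^ k) G ∈ stableKer T π :=
  mem_stableKer.mpr fun l => by simpa using mem_stableKer.mp hG (l ++ List.replicate k i)

theorem le_stableKer {H : AddSubgroup M} (hT : ∀ i, H ≤ H.comap (T i)) (hπ : H ≤ π.ker) :
    H ≤ stableKer T π := by
  intro G hG
  rw [mem_stableKer]
  intro l
  refine hπ ?_
  induction l with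
  | nil => exact hG
  | cons i l ih =>
    rw [List.map_cons, List.prod_cons]
    exact hT i ih

theorem map_mem_stableKer_of_leibniz {R : Type*} {T' : κ → AddMonoid.End M'} {π' : M' →+ N'}
    {μ : R → M → M'} {δ : κ → R → R} {L : κ → M → M}
    (hL : ∀ i, ∀ G ∈ stableKer T π, L i G ∈ stableKer T π)
    (hT : ∀ i f G, T' i (μ f G) = μ (δ i f) G + μ f (L i G))
    (hπ : ∀ f G, π G = 0 → π' (μ f G) = 0) {G : M} (hG : G ∈ stableKer T π) (f : R) :
    μ f G ∈ stableKer T' π' := by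
  let H := AddSubgroup.closure {X | ∃ f, ∃ G ∈ stableKer T π, μ f G = X}
  have hmem {G : M} (hG : G ∈ stableKer T π) (f : R) : μ f G ∈ H :=
    AddSubgroup.subset_closure ⟨f, G, hG, rfl⟩
  refine le_stableKer (H := H) (fun i => ?_) ?_ (hmem hG f)
  · rw [AddSubgroup.closure_le]
    rintro _ ⟨f, G, hG, rfl⟩
    change T' i (μ f G) ∈ H
    rw [hT]
    exact add_mem (hmem hG _) (hmem (hL i G hG) f)
  · rw [AddSubgroup.closure_le]
    rintro _ ⟨f, G, hG, rfl⟩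
    exact hπ f G (map_eq_zero_of_mem_stableKer hG)

end StableKernel

namespace PsiDO

section Residue

variable {R S C 𝕜 : Type*} [CommRing R] [CommRing S]

/-- Multiplication of the symbol by `z^j`. Unlike the composition with `∂^j` on the right, to which
it amounts over a differential ring, it needs no derivation of the coefficients. -/
def symbolShift (j : ℤ) : PsiDO R →+ PsiDO R where
  toFun A := mk (fun i => A.coeff (i - j)) (by
    obtain ⟨N, hN⟩ := A.bdd
    exact ⟨N + j, fun i hi => hN _ (by lia)⟩)
  map_zero' := rfl
  map_add' _ _ := rfl

theorem hasFiniteSupport_coeff_mul (A : PsiDO R) (s : ℤ) (h : ℕ → R) :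
    Function.HasFiniteSupport fun n : ℕ => A.coeff (n - 1 - s) * h n := by
  obtain ⟨N, hN⟩ := A.bdd
  refine (Set.finite_Iic (N + 1 + s).toNat).subset fun n hn => ?_
  by_contra hlarge
  rw [Set.mem_Iic, not_le] at hlarge
  exact hn (by simp only [hN _ (by lia : N < (n : ℤ) - 1 - s), zero_mul])

/-- The residue in `z` of `z^s A(z) ∑_n h_n z^{-n}`, where `A(z)` is the symbol of `A`. -/
def symbolResidue (s : ℤ) (h : ℕ → R) : PsiDO R →+ R where
  toFun A := ∑ᶠ n : ℕ, A.coeff (n - 1 - s) * h n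
  map_zero' := by simp
  map_add' A B := by
    rw [← finsum_add_distrib (hasFiniteSupport_coeff_mul A s h)
      (hasFiniteSupport_coeff_mul B s h)]
    simp only [coeff_add, add_mul]

theorem symbolResidue_apply (s : ℤ) (h : ℕ → R) (A : PsiDO R) :
    symbolResidue s h A = ∑ᶠ n : ℕ, A.coeff (n - 1 - s) * h n := rfl

theorem symbolResidue_mapCoeff (φ : R →+* S) (f g : S) (s : ℤ) (h : ℕ → R) (A : PsiDO R) :
    symbolResidue s (fun n => g * φ (h n))
        (mapCoeff (AddMonoidHom.mulLeft f) (mapCoeff φ.toAddMonoidHom A)) =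
      g * f * φ (symbolResidue s h A) := by
  refine Eq.trans (finsum_congr fun n => ?_)
    (((AddMonoidHom.mulLeft (g * f)).comp φ.toAddMonoidHom).map_finsum
      (hasFiniteSupport_coeff_mul A s h)).symm
  change f * φ _ * (g * φ _) = g * f * φ _
  rw [map_mul]
  ring

/-- The residue of a sum over `c` of terms as in `symbolResidue`. -/
def residuePairing [Fintype C] (s : C → ℤ) (h : C → ℕ → R) : (C → PsiDO R) →+ R :=
  ∑ c, (symbolResidue (s c) (h c)).comp (Pi.evalAddMonoidHom _ c)

theorem residuePairing_apply [Fintype C] (s : C → ℤ) (h : C → ℕ → R) (G : C → PsiDO R) :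
    residuePairing s h G = ∑ c, symbolResidue (s c) (h c) (G c) := by
  simp [residuePairing]

variable [CommSemiring 𝕜] [Algebra 𝕜 R]

/-- The effect of a derivation `δ` on `A(z)` when it acts on `A(z) e(z)`, where `δ e = z^j e` if
`P` holds and `δ e = 0` otherwise. -/
def waveStep (δ : Derivation 𝕜 R R) (P : Prop) [Decidable P] (j : ℤ) : PsiDO R →+ PsiDO R :=
  mapCoeffHom δ.toLinearMap.toAddMonoidHom + if P then symbolShift j else 0

theorem coeff_waveStep (δ : Derivation 𝕜 R R) (P : Prop) [Decidable P] (j : ℤ) (A : PsiDO R)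
    (i : ℤ) : (waveStep δ P j A).coeff i = δ (A.coeff i) + if P then A.coeff (i - j) else 0 := by
  rw [waveStep]
  split_ifs <;> rfl

theorem waveStep_mapCoeff_mulLeft (δ : Derivation 𝕜 R R) (P : Prop) [Decidable P] (j : ℤ) (f : R)
    (A : PsiDO R) :
    waveStep δ P j (mapCoeff (AddMonoidHom.mulLeft f) A) =
      mapCoeff (AddMonoidHom.mulLeft (δ f)) A +
        mapCoeff (AddMonoidHom.mulLeft f) (waveStep δ P j A) := by
  ext i
  simp only [coeff_waveStep, coeff_add, coeff_mapCoeff, AddMonoidHom.coe_mulLeft,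
    Derivation.leibniz, smul_eq_mul]
  split_ifs <;> ring

end Residue

end PsiDO

section BilinearNumerators

open PsiDO

variable {𝕜 : Type*} [RCLike 𝕜] [NormedAlgebra 𝕜 ℂ] {r : ℕ} {Ω : TimeDomain 𝕜 (Fin r × ℕ+)}

/-- The action of `∂/∂t_j^{(b)}` on the cofactors of the exponentials `e_+^{(c)}`. -/
def fullStep (bj : Fin r × ℕ+) : AddMonoid.End (Fin r → PsiDO (SmoothFn Ω)) :=
  AddMonoidHom.piMap fun c => waveStep (pderivT bj) (bj.1 = c) (bj.2 : ℕ)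

theorem coeff_fullStep (bj : Fin r × ℕ+) (G : Fin r → PsiDO (SmoothFn Ω)) (c : Fin r) (i : ℤ) :
    (fullStep bj G c).coeff i =
      pderivT bj ((G c).coeff i) + if bj.1 = c then (G c).coeff (i - (bj.2 : ℕ)) else 0 :=
  coeff_waveStep _ _ _ _ _

theorem coeff_prod_fullStep (l : List (Fin r × ℕ+)) (G : Fin r → PsiDO (SmoothFn Ω)) (c : Fin r)
    (i : ℤ) : ((l.map fullStep).prod G c).coeff i = waveDeriv c l (G c).coeff i := by
  induction l generalizing i with
  | nil => rfl
  | cons bj l ih =>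
    change (fullStep bj ((l.map fullStep).prod G) c).coeff i = _
    rw [coeff_fullStep, ih, ih]
    rfl

theorem waveDeriv_smul_shift (c : Fin r) (l : List (Fin r × ℕ+)) (u : ℤˣ) (e : ℤ)
    (G : ℤ → SmoothFn Ω) (i : ℤ) :
    waveDeriv c l (fun i => u • G (i + e)) i = u • waveDeriv c l G (i + e) := by
  induction l generalizing i with
  | nil => rfl
  | cons bj l ih =>
    simp only [waveDeriv, List.foldr_cons] at ih ⊢
    rw [ih, ih, smul_add, smul_ite, smul_zero, Units.smul_def, map_zsmul, sub_add_eq_add_sub]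
    rfl

theorem finsum_nat_add_of_eq_zero {M : Type*} [AddCommMonoid M] {g : ℕ → M} {d : ℕ}
    (hg : ∀ n < d, g n = 0) : ∑ᶠ n, g n = ∑ᶠ n, g (n + d) := by
  rw [← finsum_mem_range (f := g) (add_left_injective d)]
  refine finsum_congr fun n => ?_
  by_cases hn : n < d
  · simp [hg n hn]
  · have hmem : n ∈ Set.range fun k => k + d := ⟨n - d, by lia⟩
    simp only [hmem, finsum_true]

theorem finsum_mul_eMinusSeries (c : Fin r) (σ : ℤˣ) (f : SmoothFn Ω) (d : ℕ)
    (F : ℕ → SmoothFn Ω) :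
    ∑ᶠ n : ℕ, F n * eMinusSeries c σ f (-(n : ℤ) + d) =
      ∑ᶠ q : ℕ, F (q + d) * eMinus c σ q f := by
  rw [finsum_nat_add_of_eq_zero (d := d) fun n hn => by
    rw [eMinusSeries, if_neg (by lia), mul_zero]]
  refine finsum_congr fun q => ?_
  rw [eMinusSeries, if_pos (by lia)]
  congr 2
  lia

/-- `1 - δ_{ab}`. -/
def offDiag (a b : Fin r) : ℕ := if a = b then 0 else 1

/-- The sign `(-1)^{|e_a|_{b-1}}`. -/
def ltSign (a b : Fin r) : ℤˣ := if a < b then -1 else 1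

theorem negOnePow_sum_Iio (m : Fin r → ℤ) (a b c : Fin r) :
    Int.negOnePow (∑ i ∈ Finset.Iio c,
      ((m + Pi.single a 1 : Fin r → ℤ) i + (m - Pi.single b 1 : Fin r → ℤ) i)) =
      ltSign a c * ltSign b c := by
  have hsingle (x : Fin r) : ∑ i ∈ Finset.Iio c, (Pi.single x (1 : ℤ) : Fin r → ℤ) i =
      if x < c then 1 else 0 := by
    simp [Pi.single_apply]
  simp only [Pi.add_apply, Pi.sub_apply, Finset.sum_add_distrib, Finset.sum_sub_distrib, hsingle]
  rw [show ∀ S x y : ℤ, S + x + (S - y) = 2 * S + x - y by intros; ring, Int.negOnePow_sub,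
    Int.negOnePow_add, Int.negOnePow_two_mul, ltSign, ltSign]
  split_ifs <;> simp

theorem add_single_sub_sub_single (m : Fin r → ℤ) (a b c : Fin r) :
    (m + Pi.single a 1 : Fin r → ℤ) c - (m - Pi.single b 1 : Fin r → ℤ) c =
      2 - offDiag a c - offDiag b c := by
  simp only [Pi.add_apply, Pi.sub_apply, Pi.single_apply, offDiag, eq_comm (a := c)]
  split_ifs <;> push_cast <;> ring

/-- The numerators of the coefficients of `P^-_{bc}(-z)`. -/
def waveNumNeg (τ : (Fin r → ℤ) → SmoothFn Ω) (m : Fin r → ℤ) (b c : Fin r) (n : ℕ) :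
    SmoothFn Ω :=
  ((-1) ^ n : ℤ) • waveNum τ (-1) m b c n

theorem waveNum_eq (τ : (Fin r → ℤ) → SmoothFn Ω) (σ : ℤˣ) (m : Fin r → ℤ) (a b : Fin r)
    (n : ℕ) : waveNum τ σ m a b n = (ltSign a b * σ ^ n) • eMinusSeries b σ
      (τ (m + (σ : ℤ) • (Pi.single a 1 - Pi.single b 1))) (-n + offDiag a b) := by
  rw [waveNum, offDiag, Nat.cast_ite, Nat.cast_zero, Nat.cast_one]
  rfl

theorem coeff_ofSymbol_waveNum (τ : (Fin r → ℤ) → SmoothFn Ω) (m : Fin r → ℤ) (a c : Fin r)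
    (i : ℤ) : (ofSymbol (waveNum τ 1 m a c)).coeff i = ltSign a c •
      eMinusSeries c 1 (τ (m + Pi.single a 1 - Pi.single c 1)) (i + offDiag a c) := by
  rw [coeff_ofSymbol]
  split_ifs with hi
  · rw [waveNum_eq, one_pow, mul_one, Units.val_one, one_smul, add_sub_assoc,
      Int.toNat_of_nonneg (by lia), neg_neg]
  · rw [eMinusSeries, if_neg (by lia), smul_zero]

theorem waveNumNeg_eq (τ : (Fin r → ℤ) → SmoothFn Ω) (m : Fin r → ℤ) (b c : Fin r) (n : ℕ) :
    waveNumNeg τ m b c n = ltSign b c •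
      eMinusSeries c (-1) (τ (m - Pi.single b 1 + Pi.single c 1)) (-(n : ℤ) + offDiag b c) := by
  have hsign : ((-1) ^ n : ℤ) = ((-1) ^ n : ℤˣ) := by simp
  rw [waveNumNeg, waveNum_eq, hsign, ← Units.smul_def, smul_smul, mul_left_comm, ← mul_pow,
    neg_one_mul, neg_neg, one_pow, mul_one, Units.val_neg, Units.val_one, neg_one_smul, neg_sub,
    add_sub_left_comm, add_comm (Pi.single c 1)]

theorem symbolResidue_waveNumNeg (τ : (Fin r → ℤ) → SmoothFn Ω) (m : Fin r → ℤ) (a b c : Fin r)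
    (s : ℤ) (l : List (Fin r × ℕ+)) :
    symbolResidue s (waveNumNeg τ m b c)
        ((l.map fullStep).prod (fun c => ofSymbol (waveNum τ 1 m a c)) c) =
      (ltSign a c * ltSign b c) • ∑ᶠ q : ℕ,
        waveDeriv c l (eMinusSeries c 1 (τ (m + Pi.single a 1 - Pi.single c 1)))
          (q - 1 - s + offDiag a c + offDiag b c) *
        eMinus c (-1) q (τ (m - Pi.single b 1 + Pi.single c 1)) := by
  have hcoeff : (ofSymbol (waveNum τ 1 m a c)).coeff = fun i => ltSign a c •
      eMinusSeries c 1 (τ (m + Pi.single a 1 - Pi.single c 1)) (i + offDiag a c) :=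
    funext (coeff_ofSymbol_waveNum τ m a c)
  simp only [symbolResidue_apply, coeff_prod_fullStep, hcoeff, waveDeriv_smul_shift, waveNumNeg_eq,
    smul_mul_smul_comm]
  refine ((DistribMulAction.toAddEquiv _ (ltSign a c * ltSign b c)).map_finsum _).symm.trans ?_
  rw [finsum_mul_eMinusSeries]
  refine congrArg _ (finsum_congr fun q => ?_)
  congr 2
  push_cast
  ring

theorem bilinear_waveNum {p : Fin r → ℕ} {k : ℤ} {τ : (Fin r → ℤ) → SmoothFn Ω}
    (hτ : IsTauFunction p k τ) {m : Fin r → ℤ} (hm : ∑ a, m a = k) (a b : Fin r) (ℓ : ℕ) :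
    (fun c => ofSymbol (waveNum τ 1 m a c)) ∈ stableKer fullStep
      (residuePairing (fun c => ((ℓ * p c : ℕ) : ℤ)) (waveNumNeg τ m b)) := by
  rw [mem_stableKer]
  intro l
  have h := hτ ℓ (m + Pi.single a 1) (m - Pi.single b 1)
    (by simp [Finset.sum_add_distrib, hm]) (by simp [Finset.sum_sub_distrib, hm]) l
  rw [residuePairing_apply, ← h]
  refine Finset.sum_congr rfl fun c _ => ?_
  rw [symbolResidue_waveNumNeg, negOnePow_sum_Iio, add_single_sub_sub_single, ← Units.smul_def]
  refine congrArg _ (finsum_congr fun q => ?_)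
  congr 2
  push_cast
  ring

theorem waveNum_zero_of_ne (τ : (Fin r → ℤ) → SmoothFn Ω) (m : Fin r → ℤ) (σ : ℤˣ)
    {a b : Fin r} (hab : a ≠ b) : waveNum τ σ m a b 0 = 0 := by
  simp [waveNum, eMinusSeries, hab]

theorem eMinus_zero (a : Fin r) (σ : ℤˣ) (f : SmoothFn Ω) : eMinus a σ 0 f = f := by
  have : Subsingleton (Composition 0) :=
    Fintype.card_le_one_iff_subsingleton.mp (by rw [composition_card]; simp)
  rw [eMinus, Fintype.sum_subsingleton _ (Composition.ones 0)]
  simp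
  rfl

theorem waveNum_zero_self (τ : (Fin r → ℤ) → SmoothFn Ω) (m : Fin r → ℤ) (σ : ℤˣ) (a : Fin r) :
    waveNum τ σ m a a 0 = τ m := by
  simp [waveNum, eMinusSeries, eMinus_zero]

end BilinearNumerators

section BilinearReduced

open PsiDO

variable {𝕜 : Type*} [RCLike 𝕜] [NormedAlgebra 𝕜 ℂ] {r : ℕ} [NeZero r] (p : Fin r → ℕ)
  {Ω : TimeDomain 𝕜 (Fin r × ℕ+)} (τ : (Fin r → ℤ) → SmoothFn Ω) (m : Fin r → ℤ)

/-- The substitution `redMap`, followed by restriction to the domain of the wave operators. -/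
def redHom : SmoothFn Ω →+* SmoothFn (waveDomain p τ m) :=
  (restrictNonvanishing (pullback (redMap p) (τ m))).comp (pullback (redMap p))

theorem pderivT_redHom (i : Option (Blk1 p × ℕ+)) (f : SmoothFn Ω) :
    pderivT i (redHom p τ m f) = redHom p τ m (dirDerivation Ω ((redMap p).col i) f) := by
  rw [redHom, RingHom.comp_apply, pderivT, dirDerivation_restrictNonvanishing]
  exact congrArg (restrictNonvanishing _) (pderivT_pullback (redMap p) i f)

theorem pderivT_some_redHom (d : Blk1 p) (j : ℕ+) (f : SmoothFn Ω) :
    pderivT (some (d, j)) (redHom p τ m f) = redHom p τ m (pderivT (d.1, j) f) :=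
  pderivT_redHom p τ m _ f

theorem pderivT_none_redHom (f : SmoothFn Ω) :
    pderivT none (redHom p τ m f) = ∑ d : Blk1 p, redHom p τ m (pderivT (d.1, 1) f) := by
  rw [pderivT_redHom, ← map_sum]
  exact congrArg _ (map_sum (dirDerivationHom Ω f) _ _)

theorem waveQ_eq (σ : ℤˣ) (a b : Fin r) (n : ℕ) : waveQ p τ m σ a b n =
    quotFn 1 (pullback (redMap p) (τ m)) * redHom p τ m (waveNum τ σ m a b n) :=
  quotFn_eq_quotFn_one_mul _ _

/-- The coefficients of `Q^-_{bc}(-z)`. -/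
def waveQNeg (b c : Fin r) (n : ℕ) : SmoothFn (waveDomain p τ m) :=
  ((-1) ^ n : ℤ) • waveQ p τ m (-1) b c n

theorem waveQNeg_eq (b c : Fin r) (n : ℕ) : waveQNeg p τ m b c n =
    quotFn 1 (pullback (redMap p) (τ m)) * redHom p τ m (waveNumNeg τ m b c n) := by
  rw [waveQNeg, waveQ_eq, waveNumNeg, map_zsmul, mul_smul_comm]

variable {τ m} in
theorem waveQ_zero_of_ne (σ : ℤˣ) {a b : Fin r} (hab : a ≠ b) : waveQ p τ m σ a b 0 = 0 := by
  rw [waveQ_eq, waveNum_zero_of_ne _ _ _ hab, map_zero, mul_zero]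

theorem waveQ_zero_self (σ : ℤˣ) (a : Fin r) : waveQ p τ m σ a a 0 = 1 := by
  rw [waveQ, waveNum_zero_self, quotFn_self]

theorem waveQ_zero (σ : ℤˣ) (a b : Fin r) :
    waveQ p τ m σ a b 0 = if a = b then 1 else 0 := by
  split_ifs with hab
  · rw [hab, waveQ_zero_self]
  · exact waveQ_zero_of_ne p σ hab

theorem waveQNeg_zero (b c : Fin r) : waveQNeg p τ m b c 0 = if b = c then 1 else 0 := by
  rw [waveQNeg, waveQ_zero, pow_zero, one_smul]

variable {p τ m}

/-- The action of `∂/∂x` and of `∂/∂t_j^{(d)}`, `d ≤ r_1`, on the cofactors of the exponentials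
`e_+^{(c)}` after the reduction. -/
def redStep {V : TimeDomain 𝕜 (Option (Blk1 p × ℕ+))} :
    Option (Blk1 p × ℕ+) → AddMonoid.End (Fin r → PsiDO (SmoothFn V))
  | none => AddMonoidHom.piMap fun c => waveStep (pderivT none) (p c = p 0) 1
  | some (d, j) => AddMonoidHom.piMap fun c => waveStep (pderivT (some (d, j))) (d.1 = c) (j : ℕ)

theorem redStep_mapCoeff_mulLeft {V : TimeDomain 𝕜 (Option (Blk1 p × ℕ+))}
    (i : Option (Blk1 p × ℕ+)) (f : SmoothFn V) (G : Fin r → PsiDO (SmoothFn V)) :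
    redStep i (fun c => mapCoeff (AddMonoidHom.mulLeft f) (G c)) =
      (fun c => mapCoeff (AddMonoidHom.mulLeft (pderivT i f)) (G c)) +
        fun c => mapCoeff (AddMonoidHom.mulLeft f) (redStep i G c) := by
  rcases i with _ | ⟨d, j⟩ <;> exact funext fun c => waveStep_mapCoeff_mulLeft _ _ _ _ _

theorem coeff_redStep_none {V : TimeDomain 𝕜 (Option (Blk1 p × ℕ+))}
    (G : Fin r → PsiDO (SmoothFn V)) (c : Fin r) (i : ℤ) :
    (redStep none G c).coeff i =
      pderivT none ((G c).coeff i) + if p c = p 0 then (G c).coeff (i - 1) else 0 :=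
  coeff_waveStep _ _ _ _ _

theorem coeff_redStep_some {V : TimeDomain 𝕜 (Option (Blk1 p × ℕ+))} (d : Blk1 p) (j : ℕ+)
    (G : Fin r → PsiDO (SmoothFn V)) (c : Fin r) (i : ℤ) :
    (redStep (some (d, j)) G c).coeff i =
      pderivT (some (d, j)) ((G c).coeff i) + if d.1 = c then (G c).coeff (i - (j : ℕ)) else 0 :=
  coeff_waveStep _ _ _ _ _

/-- The operator before the reduction that corresponds to `redStep i`. -/
def liftStep : Option (Blk1 p × ℕ+) → (Fin r → PsiDO (SmoothFn Ω)) → Fin r → PsiDO (SmoothFn Ω)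
  | none, G => ∑ d : Blk1 p, fullStep (d.1, 1) G
  | some (d, j), G => fullStep (d.1, j) G

theorem liftStep_mem_stableKer {N : Type*} [AddCommGroup N]
    {π : (Fin r → PsiDO (SmoothFn Ω)) →+ N} (i : Option (Blk1 p × ℕ+))
    {G : Fin r → PsiDO (SmoothFn Ω)} (hG : G ∈ stableKer fullStep π) :
    liftStep i G ∈ stableKer fullStep π := by
  rcases i with _ | ⟨d, j⟩
  · exact sum_mem fun d _ => apply_mem_stableKer hG _
  · exact apply_mem_stableKer hG _

theorem sum_ite_blk1_eq {M : Type*} [AddCommMonoid M] (c : Fin r) (x : M) :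
    ∑ d : Blk1 p, (if d.1 = c then x else 0) = if p c = p 0 then x else 0 := by
  split_ifs with hc
  · rw [Finset.sum_eq_single_of_mem (⟨c, hc⟩ : Blk1 p) (Finset.mem_univ _)
      fun d _ hd => if_neg fun h => hd (Subtype.ext h)]
    exact if_pos rfl
  · exact Finset.sum_eq_zero fun d _ => if_neg fun h : d.1 = c => hc (h ▸ d.2)

theorem coeff_liftStep_none (G : Fin r → PsiDO (SmoothFn Ω)) (c : Fin r) (i : ℤ) :
    (liftStep (p := p) none G c).coeff i = ∑ d : Blk1 p, pderivT (d.1, 1) ((G c).coeff i) +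
      if p c = p 0 then (G c).coeff (i - 1) else 0 := by
  rw [liftStep, Finset.sum_apply, coeff_sum, ← sum_ite_blk1_eq, ← Finset.sum_add_distrib]
  exact Finset.sum_congr rfl fun d _ => coeff_fullStep _ _ _ _

theorem redStep_mapCoeff_redHom (i : Option (Blk1 p × ℕ+)) (G : Fin r → PsiDO (SmoothFn Ω)) :
    redStep i (fun c => mapCoeff (redHom p τ m).toAddMonoidHom (G c)) =
      fun c => mapCoeff (redHom p τ m).toAddMonoidHom (liftStep i G c) := by
  funext c
  ext1 k
  have hcoeff (A : PsiDO (SmoothFn Ω)) (k : ℤ) :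
      (mapCoeff (redHom p τ m).toAddMonoidHom A).coeff k = redHom p τ m (A.coeff k) := rfl
  rcases i with _ | ⟨d, j⟩
  · rw [coeff_redStep_none, hcoeff, hcoeff, hcoeff, coeff_liftStep_none, map_add, map_sum,
      apply_ite (redHom p τ m), map_zero, pderivT_none_redHom]
  · rw [coeff_redStep_some, hcoeff, hcoeff, hcoeff, liftStep, coeff_fullStep, map_add,
      apply_ite (redHom p τ m), map_zero, pderivT_some_redHom]

theorem ofSymbol_waveQ (a c : Fin r) : ofSymbol (waveQ p τ m 1 a c) =
    mapCoeff (AddMonoidHom.mulLeft (quotFn 1 (pullback (redMap p) (τ m))))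
      (mapCoeff (redHom p τ m).toAddMonoidHom (ofSymbol (waveNum τ 1 m a c))) := by
  ext1 i
  rw [coeff_mapCoeff, coeff_mapCoeff, coeff_ofSymbol, coeff_ofSymbol, waveQ_eq]
  split_ifs
  · rfl
  · rw [map_zero, map_zero]

theorem residuePairing_waveQNeg_eq_zero {s : Fin r → ℤ} {b : Fin r}
    (f : SmoothFn (waveDomain p τ m)) {G : Fin r → PsiDO (SmoothFn Ω)}
    (hG : residuePairing s (waveNumNeg τ m b) G = 0) :
    residuePairing s (waveQNeg p τ m b) (fun c =>
      mapCoeff (AddMonoidHom.mulLeft f) (mapCoeff (redHom p τ m).toAddMonoidHom (G c))) = 0 := by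
  have hQNeg : waveQNeg p τ m b = fun c n =>
      quotFn 1 (pullback (redMap p) (τ m)) * redHom p τ m (waveNumNeg τ m b c n) :=
    funext fun c => funext (waveQNeg_eq p τ m b c)
  rw [residuePairing_apply] at hG
  rw [hQNeg, residuePairing_apply,
    Finset.sum_congr rfl fun c _ => symbolResidue_mapCoeff _ _ _ _ _ _,
    ← Finset.mul_sum, ← map_sum, hG, map_zero, mul_zero]

theorem mapCoeff_redHom_mem_stableKer {s : Fin r → ℤ} {b : Fin r}
    {G : Fin r → PsiDO (SmoothFn Ω)}
    (hG : G ∈ stableKer fullStep (residuePairing s (waveNumNeg τ m b)))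
    (f : SmoothFn (waveDomain p τ m)) :
    (fun c => mapCoeff (AddMonoidHom.mulLeft f) (mapCoeff (redHom p τ m).toAddMonoidHom (G c))) ∈
      stableKer redStep (residuePairing s (waveQNeg p τ m b)) := by
  let μ (f : SmoothFn (waveDomain p τ m)) (G : Fin r → PsiDO (SmoothFn Ω)) (c : Fin r) :=
    mapCoeff (AddMonoidHom.mulLeft f) (mapCoeff (redHom p τ m).toAddMonoidHom (G c))
  have hstep (i : Option (Blk1 p × ℕ+)) (f : SmoothFn (waveDomain p τ m))
      (G : Fin r → PsiDO (SmoothFn Ω)) :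
      redStep i (μ f G) = μ (pderivT i f) G + μ f (liftStep i G) := by
    rw [redStep_mapCoeff_mulLeft, redStep_mapCoeff_redHom]
  exact map_mem_stableKer_of_leibniz (fun i _ => liftStep_mem_stableKer i) hstep
    (fun f G hG => residuePairing_waveQNeg_eq_zero f hG) hG f

theorem bilinear_waveQ {k : ℤ} (hτ : IsTauFunction p k τ) (hm : ∑ a, m a = k) (a b : Fin r)
    (ℓ : ℕ) :
    (fun c => ofSymbol (waveQ p τ m 1 a c)) ∈ stableKer (redStep (V := waveDomain p τ m))
      (residuePairing (fun c => ((ℓ * p c : ℕ) : ℤ)) (waveQNeg p τ m b)) := by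
  simp only [ofSymbol_waveQ]
  exact mapCoeff_redHom_mem_stableKer (bilinear_waveNum hτ hm a b ℓ) _

end BilinearReduced

section ResidueIdentity

open PsiDO

variable {𝕜 : Type*} [RCLike 𝕜] [NormedAlgebra 𝕜 ℂ] {r : ℕ} [NeZero r] {p : Fin r → ℕ}
  {V : TimeDomain 𝕜 (Option (Blk1 p × ℕ+))}

theorem pow_redStep_none_blk1 (G : Fin r → PsiDO (SmoothFn V)) (k : ℕ) (c : Blk1 p) :
    (redStep none ^ k) G c.1 = mono 1 (k : ℤ) * G c.1 := by
  have hstep (H : Fin r → PsiDO (SmoothFn V)) : redStep none H c.1 = mono 1 1 * H c.1 := by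
    ext1 i
    rw [coeff_d_mul, coeff_redStep_none, if_pos c.2, add_comm]
    rfl
  induction k with
  | zero => exact (one_mul _).symm
  | succ k ih =>
    calc (redStep none ^ (k + 1)) G c.1 = redStep none ((redStep none ^ k) G) c.1 := by
          rw [pow_succ']; rfl
      _ = mono 1 1 * mono 1 (k : ℤ) * G c.1 := by rw [hstep, ih, mul_assoc]
      _ = mono 1 ((k + 1 : ℕ) : ℤ) * G c.1 := by
          rw [mono_mul_mono_one, Nat.cast_succ, add_comm]

theorem coeff_pow_redStep_none_blk2 (G : Fin r → PsiDO (SmoothFn V)) (k : ℕ) (c : Blk2 p)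
    (i : ℤ) : ((redStep none ^ k) G c.1).coeff i =
      (Differential.deriv (R := SmoothFn V))^[k] ((G c.1).coeff i) := by
  induction k with
  | zero => rfl
  | succ k ih =>
    rw [pow_succ', Function.iterate_succ_apply', ← ih]
    refine (coeff_redStep_none _ _ _).trans ?_
    rw [if_neg c.2, add_zero]
    rfl

theorem residue_identity {s : Fin r → ℤ} {h : Fin r → ℕ → SmoothFn V}
    {G : Fin r → PsiDO (SmoothFn V)} (hG : G ∈ stableKer redStep (residuePairing s h)) (k : ℕ) :
    (mono 1 (k : ℤ) * ∑ c : Blk1 p, G c.1 * mono 1 (s c.1) * coSymbol (h c.1)).coeff (-1) +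
      ∑ c : Blk2 p, ∑ᶠ n : ℕ, (Differential.deriv (R := SmoothFn V))^[k]
        ((G c.1).coeff (n - 1 - s c.1)) * h c.1 n = 0 := by
  have hzero := map_eq_zero_of_mem_stableKer (pow_apply_mem_stableKer hG none k)
  rw [residuePairing_apply, ← Fintype.sum_subtype_add_sum_subtype (fun c => p c = p 0)] at hzero
  rw [← hzero, Finset.mul_sum, coeff_sum]
  congr 1
  · refine Finset.sum_congr rfl fun c _ => ?_
    rw [symbolResidue_apply, pow_redStep_none_blk1, ← mul_assoc, ← mul_assoc,
      coeff_neg_one_mul_coSymbol]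
    simp only [coeff_mul_mono_one]
  · refine Finset.sum_congr rfl fun c _ => finsum_congr fun n => ?_
    rw [coeff_pow_redStep_none_blk2]

theorem sum_mul_coSymbol_mem_diffOps {h : Fin r → ℕ → SmoothFn V}
    {G : Fin r → PsiDO (SmoothFn V)}
    (hG : G ∈ stableKer redStep (residuePairing (fun _ => 0) h))
    (hGord : ∀ c : Blk2 p, G c.1 ∈ ordLE (SmoothFn V) (-1)) (hh : ∀ c : Blk2 p, h c.1 0 = 0) :
    ∑ c : Blk1 p, G c.1 * coSymbol (h c.1) ∈ diffOps (SmoothFn V) := by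
  intro i hi
  refine coeff_eq_zero_of_residues (fun k => ?_) hi
  have hres := residue_identity hG k
  have hmono (A : PsiDO (SmoothFn V)) : A * mono 1 0 = A := mul_one A
  rw [Finset.sum_eq_zero (s := (Finset.univ : Finset (Blk2 p))), add_zero] at hres
  · simpa only [hmono] using hres
  · refine fun c _ => finsum_eq_zero_of_forall_eq_zero fun n => ?_
    rcases n with _ | n
    · rw [hh c, mul_zero]
    · rw [hGord c _ (by push_cast; lia), iterate_map_zero, zero_mul]

theorem coeff_residue_mono_mul_mono {R : Type*} [CommRing R] [Differential R] (k : ℕ) (f g : R) :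
    (mono 1 (k : ℤ) * (mono f (-1) * mono g 0)).coeff (-1) =
      (Differential.deriv (R := R))^[k] f * g := by
  rw [← mul_assoc, coeff_neg_one_mul_mono_zero, coeff_mono_mul, finsum_eq_single _ k]
  · rw [coeff_mono, if_pos (by ring), Ring.choose_natCast, Nat.choose_self, Nat.cast_one, one_smul,
      one_mul]
  · intro n hn
    rw [coeff_mono, if_neg (by lia), iterate_map_zero, mul_zero, smul_zero]

end ResidueIdentity

section Dressing

open PsiDO

variable {𝕜 : Type*} [RCLike 𝕜] [NormedAlgebra 𝕜 ℂ] {r : ℕ} [NeZero r] (p : Fin r → ℕ)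
  {Ω : TimeDomain 𝕜 (Fin r × ℕ+)} (τ : (Fin r → ℤ) → SmoothFn Ω) (m : Fin r → ℤ)

/-- The operator with entries `∑_n ∂^{-n} ∘ Q^-_{bc;n} (-1)^n`, which is the inverse of
`Q^+_{11}`. -/
def waveInv : Matrix (Blk1 p) (Blk1 p) (PsiDO (SmoothFn (waveDomain p τ m))) :=
  Matrix.of fun c b => coSymbol (waveQNeg p τ m b.1 c.1)

/-- The dressed operator `Q_{11} ∘ ∂^n ∘ Q_{11}⁻¹`. -/
def dressed (n : ℤ) : Matrix (Blk1 p) (Blk1 p) (PsiDO (SmoothFn (waveDomain p τ m))) :=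
  waveQ11 p τ m * Matrix.diagonal (fun _ => mono 1 n) * waveInv p τ m

variable {p τ m}

theorem waveQ11_mem_ordLE :
    waveQ11 p τ m ∈ (ordLE (SmoothFn (waveDomain p τ m)) 0).matrix :=
  fun _ _ => ofSymbol_mem_ordLE _

theorem waveInv_mem_ordLE :
    waveInv p τ m ∈ (ordLE (SmoothFn (waveDomain p τ m)) 0).matrix :=
  fun _ _ => coSymbol_mem_ordLE _

theorem matCoeff_waveQ11 : matCoeff 0 (waveQ11 p τ m) = 1 := by
  ext1 a b
  refine (waveQ_zero p τ m 1 a.1 b.1).trans ?_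
  simp only [Matrix.one_apply, Subtype.ext_iff]

theorem matCoeff_waveInv : matCoeff 0 (waveInv p τ m) = 1 := by
  ext1 a b
  refine (coeff_coSymbol_zero _).trans ((waveQNeg_zero p τ m b.1 a.1).trans ?_)
  simp only [Matrix.one_apply, Subtype.ext_iff, eq_comm]

theorem ofSymbol_waveQ_mem_ordLE {a c : Fin r} (hac : a ≠ c) :
    ofSymbol (waveQ p τ m 1 a c) ∈ ordLE (SmoothFn (waveDomain p τ m)) (-1) := by
  intro i hi
  rw [coeff_ofSymbol]
  split_ifs with hi0
  · rw [show (-i).toNat = 0 by lia, waveQ_zero, if_neg hac]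
  · rfl

theorem blk1_ne_blk2 (a : Blk1 p) (c : Blk2 p) : a.1 ≠ c.1 := fun h => c.2 (h ▸ a.2)

theorem matrix_diagonal_mono_mem_ordLE {R I : Type*} [CommRing R] [DecidableEq I] (n : ℤ) :
    Matrix.diagonal (fun _ : I => mono 1 n) ∈ (ordLE R n).matrix := by
  intro a b
  rw [Matrix.diagonal_apply]
  split_ifs
  · exact mono_mem_ordLE 1 n
  · exact zero_mem _

theorem matCoeff_diagonal_mono {R I : Type*} [CommRing R] [DecidableEq I] (n : ℤ) :
    matCoeff n (Matrix.diagonal fun _ : I => (mono 1 n : PsiDO R)) = 1 := by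
  ext1 a b
  rw [matCoeff_apply, Matrix.diagonal_apply, Matrix.one_apply]
  split_ifs
  · rw [coeff_mono, if_pos rfl]
  · rfl

theorem dressed_mem_ordLE (n : ℤ) :
    dressed p τ m n ∈ (ordLE (SmoothFn (waveDomain p τ m)) n).matrix := by
  simpa [dressed] using mul_mem_matrix_ordLE
    (mul_mem_matrix_ordLE waveQ11_mem_ordLE (matrix_diagonal_mono_mem_ordLE n)) waveInv_mem_ordLE

theorem matCoeff_dressed (n : ℤ) : matCoeff n (dressed p τ m n) = 1 := by
  have hQ := matCoeff_mul_top (waveQ11_mem_ordLE (p := p) (τ := τ) (m := m))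
    (matrix_diagonal_mono_mem_ordLE n)
  have hT := matCoeff_mul_top
    (mul_mem_matrix_ordLE waveQ11_mem_ordLE (matrix_diagonal_mono_mem_ordLE n))
    (waveInv_mem_ordLE (p := p) (τ := τ) (m := m))
  rw [hQ, matCoeff_waveQ11, matCoeff_waveInv, matCoeff_diagonal_mono, zero_add, add_zero, mul_one,
    mul_one] at hT
  exact hT

theorem single_self_pow {A I : Type*} [Ring A] [Fintype I] [DecidableEq I] (d : I) (x : A) {n : ℕ}
    (hn : 0 < n) : Matrix.single d d x ^ n = Matrix.single d d (x ^ n) := by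
  induction n, hn using Nat.le_induction with
  | base => simp only [Nat.succ_eq_add_one, zero_add, pow_one]
  | succ n _ ih => rw [pow_succ, ih, Matrix.single_mul_single_same, pow_succ]

theorem redStep_some_waveQ_mem_ordLE (d : Blk1 p) (j : ℕ+) (a : Blk1 p) (c : Blk2 p) :
    redStep (some (d, j)) (fun c => ofSymbol (waveQ p τ m 1 a.1 c)) c.1 ∈
      ordLE (SmoothFn (waveDomain p τ m)) (-1) := by
  intro i hi
  rw [coeff_redStep_some, if_neg (blk1_ne_blk2 d c), add_zero,
    ofSymbol_waveQ_mem_ordLE (blk1_ne_blk2 a c) i hi, map_zero]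

theorem redStep_some_waveQ_blk1 (d : Blk1 p) (j : ℕ+) (a c : Blk1 p) :
    redStep (some (d, j)) (fun c => ofSymbol (waveQ p τ m 1 a.1 c)) c.1 =
      ((waveQ11 p τ m).map (mapCoeff (pderivT (some (d, j))).toLinearMap.toAddMonoidHom) +
        waveQ11 p τ m * Matrix.single d d (mono 1 (j : ℕ)) :
          Matrix (Blk1 p) (Blk1 p) (PsiDO (SmoothFn (waveDomain p τ m)))) a c := by
  ext1 i
  rw [coeff_redStep_some, Matrix.add_apply, coeff_add]
  refine congrArg₂ (· + ·) rfl ?_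
  split_ifs with hdc
  · obtain rfl : d = c := Subtype.ext hdc
    rw [Matrix.mul_single_apply_same, coeff_mul_mono_one]
    rfl
  · have hdc' : c ≠ d := fun h => hdc (congrArg Subtype.val h.symm)
    exact congrArg (·.coeff i) (Matrix.mul_single_apply_of_ne (mono 1 (j : ℕ)) d d a c hdc'
      (waveQ11 p τ m)).symm

theorem map_pderivT_waveQ11_mem_ordLE (d : Blk1 p) (j : ℕ+) :
    (waveQ11 p τ m).map (mapCoeff (pderivT (some (d, j))).toLinearMap.toAddMonoidHom) ∈
      (ordLE (SmoothFn (waveDomain p τ m)) (-1)).matrix := by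
  have hord : (waveQ11 p τ m).map (mapCoeff (pderivT (some (d, j))).toLinearMap.toAddMonoidHom) ∈
      (ordLE (SmoothFn (waveDomain p τ m)) 0).matrix :=
    fun a b => mapCoeff_mem_ordLE _ (waveQ11_mem_ordLE a b)
  have htop : matCoeff 0 ((waveQ11 p τ m).map
      (mapCoeff (pderivT (some (d, j))).toLinearMap.toAddMonoidHom)) = 0 := by
    ext1 a b
    refine (congrArg (pderivT (some (d, j))) (waveQ_zero p τ m 1 a.1 b.1)).trans ?_
    split_ifs
    · exact (pderivT (some (d, j))).map_one_eq_zero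
    · exact map_zero _
  rw [← zero_sub]
  exact mem_matrix_ordLE_pred hord htop

theorem finsum_iterate_deriv_waveQ_mul_waveQNeg (k : ℕ) (a b : Blk1 p) (c : Blk2 p) :
    ∑ᶠ n : ℕ, (Differential.deriv (R := SmoothFn (waveDomain p τ m)))^[k]
        ((ofSymbol (waveQ p τ m 1 a.1 c.1)).coeff (n - 1 - ((1 * p c.1 : ℕ) : ℤ))) *
          waveQNeg p τ m b.1 c.1 n =
      ∑ n ∈ Finset.range (p c.1), (Differential.deriv (R := SmoothFn (waveDomain p τ m)))^[k]
        (waveQ p τ m 1 a.1 c.1 (n + 1)) * waveQNeg p τ m b.1 c.1 (p c.1 - n) := by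
  rw [finsum_eq_sum_of_support_subset (s := Finset.range (p c.1 + 1)), Finset.sum_range_succ',
    waveQNeg_zero, if_neg (blk1_ne_blk2 b c), mul_zero, add_zero, ← Finset.sum_range_reflect]
  · refine Finset.sum_congr rfl fun n hn => ?_
    have hn' : n < p c.1 := Finset.mem_range.mp hn
    rw [coeff_ofSymbol, if_pos (by push_cast; lia)]
    congr 3 <;> lia
  · intro n hn
    by_contra hlarge
    have hn' : p c.1 + 1 ≤ n := by simpa using hlarge
    refine hn ?_
    dsimp only
    rw [ofSymbol_waveQ_mem_ordLE (blk1_ne_blk2 a c) _ (by push_cast; lia), iterate_map_zero,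
      zero_mul]

variable {k : ℤ} (hτ : IsTauFunction p k τ) (hm : ∑ a, m a = k)

include hτ hm

theorem bilinear_waveQ_zero (a b : Fin r) :
    (fun c => ofSymbol (waveQ p τ m 1 a c)) ∈ stableKer (redStep (V := waveDomain p τ m))
      (residuePairing (fun _ => 0) (waveQNeg p τ m b)) := by
  simpa only [zero_mul, Nat.cast_zero] using bilinear_waveQ hτ hm a b 0

theorem waveQ11_mul_waveInv_apply_mem_diffOps (a b : Blk1 p) :
    (waveQ11 p τ m * waveInv p τ m) a b ∈ diffOps (SmoothFn (waveDomain p τ m)) := by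
  rw [Matrix.mul_apply]
  have hdiff := sum_mul_coSymbol_mem_diffOps (bilinear_waveQ_zero hτ hm a.1 b.1)
    (fun c => ofSymbol_waveQ_mem_ordLE (blk1_ne_blk2 a c))
    (fun c => by rw [waveQNeg_zero, if_neg (blk1_ne_blk2 b c)])
  exact hdiff

theorem waveQ11_mul_waveInv : waveQ11 p τ m * waveInv p τ m = 1 := by
  have hord := mul_mem_matrix_ordLE waveQ11_mem_ordLE (waveInv_mem_ordLE (p := p) (τ := τ) (m := m))
  have htop : matCoeff 0 (waveQ11 p τ m * waveInv p τ m) = matCoeff 0 1 := by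
    have hmul := matCoeff_mul_top waveQ11_mem_ordLE (waveInv_mem_ordLE (p := p) (τ := τ) (m := m))
    rwa [matCoeff_waveQ11, matCoeff_waveInv, mul_one, add_zero, ← matCoeff_one] at hmul
  ext1 a b
  ext1 i
  rcases lt_trichotomy i 0 with hi | rfl | hi
  · rw [waveQ11_mul_waveInv_apply_mem_diffOps hτ hm a b i hi, Matrix.one_apply]
    split_ifs
    · exact ((diffOps _).one_mem i hi).symm
    · rfl
  · exact congrFun (congrFun htop a) b
  · exact (hord a b i hi).trans (one_mem_matrix_ordLE a b i hi).symm

theorem waveInv_mul_waveQ11 : waveInv p τ m * waveQ11 p τ m = 1 := by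
  have hord : waveInv p τ m * waveQ11 p τ m - 1 ∈
      (ordLE (SmoothFn (waveDomain p τ m)) 0).matrix :=
    sub_mem (mul_mem_matrix_ordLE (N := 0) (M := 0) (waveInv_mem_ordLE (p := p) (τ := τ) (m := m))
      waveQ11_mem_ordLE) one_mem_matrix_ordLE
  have htop := matCoeff_mul_top (waveInv_mem_ordLE (p := p) (τ := τ) (m := m)) waveQ11_mem_ordLE
  rw [matCoeff_waveQ11, matCoeff_waveInv, one_mul, add_zero] at htop
  have hpred := mem_matrix_ordLE_pred hord (by rw [map_sub, htop, matCoeff_one, sub_self])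
  rw [zero_sub] at hpred
  exact mul_eq_one_symm_of_sub_one_mem_ordLE (waveQ11_mul_waveInv hτ hm) hpred

theorem isUnit_waveQ11 : IsUnit (waveQ11 p τ m) :=
  ⟨⟨_, _, waveQ11_mul_waveInv hτ hm, waveInv_mul_waveQ11 hτ hm⟩, rfl⟩

theorem inverse_waveQ11 : Ring.inverse (waveQ11 p τ m) = waveInv p τ m :=
  Ring.inverse_unit ⟨_, _, waveQ11_mul_waveInv hτ hm, waveInv_mul_waveQ11 hτ hm⟩

theorem conj_waveQ11_pow (C : Matrix (Blk1 p) (Blk1 p) (PsiDO (SmoothFn (waveDomain p τ m))))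
    (n : ℕ) : (waveQ11 p τ m * C * waveInv p τ m) ^ n = waveQ11 p τ m * C ^ n * waveInv p τ m :=
  Units.conj_pow ⟨_, _, waveQ11_mul_waveInv hτ hm, waveInv_mul_waveQ11 hτ hm⟩ C n

theorem waveQ11_evolution (d : Blk1 p) (j : ℕ+) :
    (waveQ11 p τ m).map (mapCoeff (pderivT (some (d, j))).toLinearMap.toAddMonoidHom) *
        waveInv p τ m =
      (waveQ11 p τ m * Matrix.single d d (mono 1 (j : ℕ)) * waveInv p τ m).map pos -
        waveQ11 p τ m * Matrix.single d d (mono 1 (j : ℕ)) * waveInv p τ m := by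
  have hord := mul_mem_matrix_ordLE (map_pderivT_waveQ11_mem_ordLE (τ := τ) (m := m) d j)
    (waveInv_mem_ordLE (p := p) (τ := τ) (m := m))
  rw [add_zero] at hord
  refine eq_map_pos_sub hord fun a b => ?_
  have hdiff := sum_mul_coSymbol_mem_diffOps
    (apply_mem_stableKer (bilinear_waveQ_zero hτ hm a.1 b.1) (some (d, j)))
    (redStep_some_waveQ_mem_ordLE d j a)
    (fun c => by rw [waveQNeg_zero, if_neg (blk1_ne_blk2 b c)])
  simp only [redStep_some_waveQ_blk1] at hdiff
  rw [← Matrix.add_apply, ← add_mul, Matrix.mul_apply]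
  exact hdiff

theorem laxA_pow (d : Blk1 p) {n : ℕ} (hn : 0 < n) : laxA p τ m d ^ n =
    waveQ11 p τ m * Matrix.single d d (mono 1 n) * waveInv p τ m := by
  rw [laxA, inverse_waveQ11 hτ hm, conj_waveQ11_pow hτ hm, single_self_pow d _ hn, mono_one_pow]

theorem sum_laxA_pow {n : ℕ} (hn : 0 < n) : ∑ d, laxA p τ m d ^ n = dressed p τ m n := by
  simp only [laxA_pow hτ hm _ hn]
  rw [← Finset.sum_mul, ← Finset.mul_sum, Matrix.sum_single_eq_diagonal, dressed]

theorem dressed_one_pow (n : ℕ) : dressed p τ m 1 ^ n = dressed p τ m n := by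
  rw [dressed, conj_waveQ11_pow hτ hm, Matrix.diagonal_pow, dressed]
  simp only [Pi.pow_def, mono_one_pow]

theorem dressed_evolution (d : Blk1 p) (j : ℕ+) (n : ℤ) :
    (dressed p τ m n).map (mapCoeff (pderivT (some (d, j))).toLinearMap.toAddMonoidHom) =
      ⁅(waveQ11 p τ m * Matrix.single d d (mono 1 (j : ℕ)) * waveInv p τ m).map pos,
        dressed p τ m n⁆ := by
  refine lax_of_dressing (R := SmoothFn (waveDomain p τ m)) (pderivT (some (d, j)))
    (fun f => ?_) (waveQ11_mul_waveInv hτ hm) (waveInv_mul_waveQ11 hτ hm) ?_ ?_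
    (waveQ11_evolution hτ hm d j)
  · exact pderivT_comm (some (d, j)) none f
  · ext1 a b
    ext1 i
    rw [Matrix.map_apply, coeff_mapCoeff, Matrix.diagonal_apply]
    split_ifs
    · rw [coeff_mono]
      split_ifs
      · exact (pderivT (some (d, j))).map_one_eq_zero
      · exact map_zero _
    · exact map_zero _
  · ext1 a b
    rw [Matrix.diagonal_mul, Matrix.mul_diagonal, Matrix.single_apply]
    split_ifs
    · rw [mono_mul_mono_one, mono_mul_mono_one, add_comm]
    · rw [mul_zero, zero_mul]

theorem sum_dressed_evolution (j : ℕ+) (n : ℤ) :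
    ∑ d : Blk1 p,
        (dressed p τ m n).map (mapCoeff (pderivT (some (d, j))).toLinearMap.toAddMonoidHom) =
      ⁅(dressed p τ m 1 ^ (j : ℕ)).map pos, dressed p τ m n⁆ := by
  have hpos : (dressed p τ m 1 ^ (j : ℕ)).map pos = ∑ d : Blk1 p,
      (waveQ11 p τ m * Matrix.single d d (mono 1 (j : ℕ)) * waveInv p τ m).map pos := by
    rw [dressed_one_pow hτ hm, dressed, ← Matrix.sum_single_eq_diagonal, Finset.mul_sum,
      Finset.sum_mul]
    exact map_sum (posHom.mapMatrix (m := Blk1 p) (n := Blk1 p)) _ _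
  rw [hpos, Ring.lie_def, Finset.sum_mul, Finset.mul_sum, ← Finset.sum_sub_distrib]
  exact Finset.sum_congr rfl fun d _ => dressed_evolution hτ hm d j n

theorem dressed_add_mem_diffOps (a b : Blk1 p) : dressed p τ m (p 0) a b +
    ∑ c : Blk2 p, ∑ n ∈ Finset.range (p c.1), mono (waveQ p τ m 1 a.1 c.1 (n + 1)) (-1) *
      mono (waveQNeg p τ m b.1 c.1 (p c.1 - n)) 0 ∈ diffOps (SmoothFn (waveDomain p τ m)) := by
  intro i hi
  refine coeff_eq_zero_of_residues (fun k => ?_) hi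
  have hdressed : dressed p τ m (p 0) a b = ∑ c : Blk1 p, ofSymbol (waveQ p τ m 1 a.1 c.1) *
      mono 1 ((1 * p c.1 : ℕ) : ℤ) * coSymbol (waveQNeg p τ m b.1 c.1) := by
    rw [dressed, Matrix.mul_apply]
    refine Finset.sum_congr rfl fun c _ => ?_
    rw [Matrix.mul_diagonal, one_mul, c.2]
    rfl
  rw [mul_add, coeff_add, hdressed, ← residue_identity (bilinear_waveQ hτ hm a.1 b.1 1) k]
  refine congrArg _ ?_
  simp only [Finset.mul_sum, coeff_sum, coeff_residue_mono_mul_mono]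
  exact Finset.sum_congr rfl fun c _ => (finsum_iterate_deriv_waveQ_mul_waveQNeg k a b c).symm

end Dressing

/-! ### Roots and changes of the times -/

namespace PsiDO

section Constants

variable {R : Type*} [CommRing R] [Differential R]

/-- The functions as operators of order zero. -/
def C : R →+* PsiDO R where
  toFun a := mono a 0
  map_zero' := mono_zero 0
  map_one' := rfl
  map_add' := map_add (monoHom 0)
  map_mul' a b := (mono_zero_mul_mono a b 0).symm

theorem coeff_C_mul (a : R) (A : PsiDO R) (i : ℤ) : (C a * A).coeff i = a * A.coeff i :=
  coeff_mono_zero_mul a A i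

theorem C_mul_comm_of_deriv_eq_zero {c : R} (hc : Differential.deriv c = 0) (A : PsiDO R) :
    C c * A = A * C c := by
  ext1 i
  refine (coeff_C_mul c A i).trans (Eq.symm ((coeff_mul_mono_zero A c i).trans ?_))
  rw [finsum_eq_single _ 0]
  · simp [mul_comm]
  · intro n hn
    obtain ⟨n, rfl⟩ := Nat.exists_eq_succ_of_ne_zero hn
    rw [Function.iterate_succ_apply, hc, iterate_map_zero]
    simp

variable (I : Type*) [Fintype I] [DecidableEq I]

/-- The functions as scalar matrices of operators of order zero. -/
def matC : R →+* Matrix I I (PsiDO R) := (Matrix.scalar I).comp C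

variable {I}

theorem coeff_matC_mul_apply (a : R) (A : Matrix I I (PsiDO R)) (b c : I) (i : ℤ) :
    ((matC I a * A) b c).coeff i = a * (A b c).coeff i := by
  rw [matC, RingHom.comp_apply, Matrix.scalar_apply, Matrix.diagonal_mul, coeff_C_mul]

theorem commute_matC_of_deriv_eq_zero {c : R} (hc : Differential.deriv c = 0)
    (A : Matrix I I (PsiDO R)) : Commute (matC I c) A :=
  Matrix.scalar_commute (C c) (C_mul_comm_of_deriv_eq_zero hc) A

theorem map_pos_matC_mul (a : R) (A : Matrix I I (PsiDO R)) :
    (matC I a * A).map pos = matC I a * A.map pos := by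
  ext1 b c
  ext1 i
  rw [Matrix.map_apply, coeff_pos, coeff_matC_mul_apply, coeff_matC_mul_apply, Matrix.map_apply,
    coeff_pos, mul_ite, mul_zero]

end Constants

end PsiDO

section Roots

open PsiDO

variable {𝕜 : Type*} [RCLike 𝕜] [NormedAlgebra 𝕜 ℂ] {I : Type*} [Fintype I] [DecidableEq I]
  {V : TimeDomain 𝕜 (Option ℕ+)}

theorem isRootWithLeading_iff {c : ℂ} {n : ℕ} {A B : Matrix I I (PsiDO (SmoothFn V))} :
    IsRootWithLeading c n A B ↔ B ^ n = A ∧ B ∈ (ordLE (SmoothFn V) 1).matrix ∧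
      matCoeff 1 B = algebraMap ℂ (SmoothFn V) c • 1 := by
  refine and_congr_right fun _ => ⟨fun h => ⟨fun a b i hi => ?_, ?_⟩, fun h a b i hi => ?_⟩
  · rw [h a b i hi.le, if_neg fun hab => hi.ne' hab.2]
  · ext1 a b
    simp [h a b 1 le_rfl, Matrix.one_apply]
  · rcases hi.eq_or_lt with rfl | hi
    · have hab := congrFun (congrFun h.2 a) b
      rw [matCoeff_apply] at hab
      simp [hab, Matrix.one_apply]
    · rw [h.1 a b i hi, if_neg fun hab => hi.ne' hab.2]

theorem isLeftRegular_algebraMap {c : ℂ} (hc : c ≠ 0) :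
    IsLeftRegular (algebraMap ℂ (SmoothFn V) c) :=
  ((IsUnit.mk0 c hc).map (algebraMap ℂ (SmoothFn V))).isRegular.left

theorem IsRootWithLeading.eq {c : ℂ} (hc : c ≠ 0) {n : ℕ} (hn : 0 < n)
    {A B C : Matrix I I (PsiDO (SmoothFn V))} (hB : IsRootWithLeading c n A B)
    (hC : IsRootWithLeading c n A C) : B = C := by
  obtain ⟨k, rfl⟩ := Nat.exists_eq_succ_of_ne_zero hn.ne'
  obtain ⟨hBn, hB1, hBc⟩ := isRootWithLeading_iff.mp hB
  obtain ⟨hCn, hC1, hCc⟩ := isRootWithLeading_iff.mp hC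
  refine pow_succ_injective_of_leading (c := algebraMap ℂ (SmoothFn V) c) ?_ hB1 hC1 hBc hCc
    (hBn.trans hCn.symm)
  rw [← map_pow, ← map_natCast (algebraMap ℂ (SmoothFn V)), ← map_mul]
  exact isLeftRegular_algebraMap
    (mul_ne_zero (Nat.cast_ne_zero.mpr k.succ_ne_zero) (pow_ne_zero k hc))

theorem solvesLax_of_root {c : ℂ} (hc : c ≠ 0) {n : ℕ} (hn : 0 < n)
    {A B : Matrix I I (PsiDO (SmoothFn V))} (hB : IsRootWithLeading c n A B)
    (h : ∀ j : ℕ+, A.map (mapCoeff (pderivT (some j)).toLinearMap.toAddMonoidHom) =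
      ⁅(B ^ (j : ℕ)).map pos, A⁆) :
    SolvesLax c n A :=
  ⟨⟨B, hB, fun _ hC => hC.eq hc hn hB⟩, fun _ hC j => hC.eq hc hn hB ▸ h j⟩

end Roots

theorem matrix_map_lie {I R S : Type*} [Fintype I] [Ring R] [Ring S] (f : R →+* S)
    (A B : Matrix I I R) : (⁅A, B⁆).map f = ⁅A.map f, B.map f⁆ := by
  rw [Ring.lie_def, Ring.lie_def, Matrix.map_sub f (map_sub f), Matrix.map_mul, Matrix.map_mul]

theorem neg_mul_lie_of_commute {R : Type*} [Ring R] {c b : R} (h : Commute c b) (a : R) :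
    -(c * ⁅a, b⁆) = ⁅c * a, -b⁆ := by
  rw [Ring.lie_def, Ring.lie_def, mul_neg, neg_mul, mul_sub, mul_assoc, ← mul_assoc c b, h.eq,
    mul_assoc, sub_neg_eq_add, neg_sub, neg_add_eq_sub]

section Identification

open PsiDO

variable {𝕜 : Type*} [RCLike 𝕜] [NormedAlgebra 𝕜 ℂ] {r : ℕ} [NeZero r] {p : Fin r → ℕ}
  {V : TimeDomain 𝕜 (Option (Blk1 p × ℕ+))}

theorem pullback_diagMap_deriv (f : SmoothFn V) : pullback (diagMap p) (Differential.deriv f) =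
    Differential.deriv (pullback (diagMap p) f) :=
  (pderivT_pullback (diagMap p) none f).symm

theorem pderivT_pullback_diagMap (j : ℕ+) (f : SmoothFn V) :
    pderivT (some j) (pullback (diagMap p) f) =
      pullback (diagMap p) (∑ d : Blk1 p, pderivT (some (d, j)) f) := by
  rw [pderivT_pullback]
  exact congrArg _ (map_sum (dirDerivationHom V f) _ _)

/-- The identification of the times, as a homomorphism of rings of operators. -/
def diagHom (V : TimeDomain 𝕜 (Option (Blk1 p × ℕ+))) :
    PsiDO (SmoothFn V) →+* PsiDO (SmoothFn (V.comap (diagMap p))) :=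
  mapRingHom (pullback (diagMap p)) pullback_diagMap_deriv

theorem coeff_diagHom (A : PsiDO (SmoothFn V)) (i : ℤ) :
    (diagHom V A).coeff i = pullback (diagMap p) (A.coeff i) := rfl

theorem map_mapCoeff_pderivT_diagHom {I : Type*} (A : Matrix I I (PsiDO (SmoothFn V))) (j : ℕ+) :
    (A.map (diagHom V)).map (mapCoeff (pderivT (some j)).toLinearMap.toAddMonoidHom) =
      (∑ d : Blk1 p, A.map (mapCoeff (pderivT (some (d, j))).toLinearMap.toAddMonoidHom)).map
        (diagHom V) := by
  ext1 a b
  ext1 i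
  rw [Matrix.map_apply, Matrix.map_apply, Matrix.map_apply, Matrix.sum_apply, coeff_diagHom,
    coeff_sum, coeff_mapCoeff, coeff_diagHom]
  exact pderivT_pullback_diagMap j _

theorem map_pos_diagHom {I : Type*} (A : Matrix I I (PsiDO (SmoothFn V))) :
    (A.map (diagHom V)).map pos = (A.map pos).map (diagHom V) := by
  ext1 a b
  exact pos_mapCoeff _ _

end Identification

section Flip

open PsiDO

variable {𝕜 : Type*} [RCLike 𝕜] [NormedAlgebra 𝕜 ℂ] {V : TimeDomain 𝕜 (Option ℕ+)} (ε : 𝕜)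

theorem pullback_flipMap_deriv (f : SmoothFn V) : pullback (flipMap ε) (Differential.deriv f) =
    -Differential.deriv (pullback (flipMap ε) f) := by
  have h : Differential.deriv (pullback (flipMap ε) f) =
      pullback (flipMap ε) (dirDerivationHom V f (Finsupp.single none (-1))) :=
    pderivT_pullback (flipMap ε) none f
  rw [h, Finsupp.single_neg, map_neg, map_neg, neg_neg]
  rfl

theorem pderivT_pullback_flipMap (j : ℕ+) (f : SmoothFn V) :
    pderivT (some j) (pullback (flipMap ε) f) =
      algebraMap ℂ _ (algebraMap 𝕜 ℂ ε ^ (j : ℕ)) * pullback (flipMap ε) (pderivT (some j) f) := by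
  have h : pderivT (some j) (pullback (flipMap ε) f) =
      pullback (flipMap ε) (dirDerivationHom V f (Finsupp.single (some j) (ε ^ (j : ℕ)))) :=
    pderivT_pullback (flipMap ε) (some j) f
  rw [h, ← mul_one (ε ^ (j : ℕ)), ← smul_eq_mul, ← Finsupp.smul_single, map_smul,
    ← algebraMap_smul ℂ (ε ^ (j : ℕ)), map_pow, ← Algebra.smul_def]
  rfl

/-- The substitution `x ↦ -x`, `t_j ↦ ε^j t_j`, `∂ ↦ -∂`, as a homomorphism of rings of
operators. -/
def flipHom (V : TimeDomain 𝕜 (Option ℕ+)) (ε : 𝕜) :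
    PsiDO (SmoothFn V) →+* PsiDO (SmoothFn (V.comap (flipMap ε))) :=
  reflectHom (pullback (flipMap ε)) (pullback_flipMap_deriv ε)

theorem coeff_flipHom (A : PsiDO (SmoothFn V)) (i : ℤ) : (flipHom V ε A).coeff i =
    (Int.negOnePow i : ℤ) • pullback (flipMap ε) (A.coeff i) := rfl

theorem map_pos_flipHom {I : Type*} (A : Matrix I I (PsiDO (SmoothFn V))) :
    (A.map (flipHom V ε)).map pos = (A.map pos).map (flipHom V ε) := by
  ext1 a b
  exact pos_reflect _ _

variable {I : Type*} [Fintype I] [DecidableEq I]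

theorem map_mapCoeff_pderivT_flipHom (A : Matrix I I (PsiDO (SmoothFn V))) (j : ℕ+) :
    (A.map (flipHom V ε)).map (mapCoeff (pderivT (some j)).toLinearMap.toAddMonoidHom) =
      matC I (algebraMap ℂ _ (algebraMap 𝕜 ℂ ε ^ (j : ℕ))) *
        (A.map (mapCoeff (pderivT (some j)).toLinearMap.toAddMonoidHom)).map (flipHom V ε) := by
  ext1 a b
  ext1 i
  rw [coeff_matC_mul_apply, Matrix.map_apply, Matrix.map_apply, Matrix.map_apply, Matrix.map_apply,
    coeff_flipHom, coeff_mapCoeff, coeff_flipHom, map_zsmul, mul_smul_comm]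
  exact congrArg _ (pderivT_pullback_flipMap ε j _)

theorem commute_matC_algebraMap {V : TimeDomain 𝕜 (Option ℕ+)} (c : ℂ)
    (A : Matrix I I (PsiDO (SmoothFn V))) : Commute (matC I (algebraMap ℂ _ c)) A :=
  commute_matC_of_deriv_eq_zero ((pderivT none).map_algebraMap c) A

theorem matC_mul_map_flipHom_pow (c : ℂ) (B : Matrix I I (PsiDO (SmoothFn V))) (j : ℕ) :
    (matC I (algebraMap ℂ _ c) * B.map (flipHom V ε)) ^ j =
      matC I (algebraMap ℂ _ (c ^ j)) * (B ^ j).map (flipHom V ε) := by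
  rw [(commute_matC_algebraMap c _).mul_pow, map_pow, map_pow]
  exact congrArg _ (map_pow (flipHom V ε).mapMatrix B j).symm

variable {ε} {n : ℕ} {A B : Matrix I I (PsiDO (SmoothFn V))}

theorem IsRootWithLeading.flip (hε : ε ^ n = -1) (hB : IsRootWithLeading 1 n A B) :
    IsRootWithLeading (-algebraMap 𝕜 ℂ ε) n (-A.map (flipHom V ε))
      (matC I (algebraMap ℂ _ (algebraMap 𝕜 ℂ ε)) * B.map (flipHom V ε)) := by
  refine ⟨?_, fun a b i hi => ?_⟩
  · rw [matC_mul_map_flipHom_pow, ← map_pow, hε, hB.1]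
    simp only [map_neg, map_one, neg_mul, one_mul]
  · rw [coeff_matC_mul_apply, Matrix.map_apply, coeff_flipHom, hB.2 a b i hi]
    split_ifs with hab
    · rw [hab.2, map_one, map_one, Int.negOnePow_one, Units.val_neg, Units.val_one, neg_smul,
        one_smul, map_neg]
      exact mul_neg_one (algebraMap ℂ (SmoothFn (V.comap (flipMap ε))) (algebraMap 𝕜 ℂ ε))
    · rw [map_zero, smul_zero, mul_zero]

theorem flip_evolution (j : ℕ+)
    (h : A.map (mapCoeff (pderivT (some j)).toLinearMap.toAddMonoidHom) =
      ⁅(B ^ (j : ℕ)).map pos, A⁆) :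
    (-A.map (flipHom V ε)).map (mapCoeff (pderivT (some j)).toLinearMap.toAddMonoidHom) =
      ⁅((matC I (algebraMap ℂ _ (algebraMap 𝕜 ℂ ε)) * B.map (flipHom V ε)) ^ (j : ℕ)).map pos,
        -A.map (flipHom V ε)⁆ := by
  have hneg : (-A.map (flipHom V ε)).map
      (mapCoeff (pderivT (some j)).toLinearMap.toAddMonoidHom) =
      -(A.map (flipHom V ε)).map (mapCoeff (pderivT (some j)).toLinearMap.toAddMonoidHom) :=
    map_neg (mapCoeffHom (pderivT (some j)).toLinearMap.toAddMonoidHom).mapMatrix _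
  rw [hneg, map_mapCoeff_pderivT_flipHom, h, matrix_map_lie, matC_mul_map_flipHom_pow,
    map_pos_matC_mul, map_pos_flipHom,
    neg_mul_lie_of_commute (commute_matC_algebraMap _ (A.map (flipHom V ε)))]

theorem solvesLax_flip (hn : 0 < n) (hε : ε ^ n = -1) (hB : IsRootWithLeading 1 n A B)
    (h : ∀ j : ℕ+, A.map (mapCoeff (pderivT (some j)).toLinearMap.toAddMonoidHom) =
      ⁅(B ^ (j : ℕ)).map pos, A⁆) :
    SolvesLax (-algebraMap 𝕜 ℂ ε) n (-A.map (flipHom V ε)) := by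
  have hε0 : ε ≠ 0 := by
    rintro rfl
    simp [zero_pow hn.ne'] at hε
  exact solvesLax_of_root (neg_ne_zero.mpr ((map_ne_zero _).mpr hε0)) hn (hB.flip hε)
    fun j => flip_evolution j (h j)

end Flip

section LaxTilde

open PsiDO

variable {𝕜 : Type*} [RCLike 𝕜] [NormedAlgebra 𝕜 ℂ] {r : ℕ} [NeZero r] {p : Fin r → ℕ}
  {Ω : TimeDomain 𝕜 (Fin r × ℕ+)} {τ : (Fin r → ℤ) → SmoothFn Ω} {m : Fin r → ℤ} {k : ℤ}
  (hτ : IsTauFunction p k τ) (hm : ∑ a, m a = k) (hp0 : 0 < p 0)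

include hτ hm hp0

theorem laxTilde_eq :
    laxTilde p τ m = (dressed p τ m (p 0)).map (diagHom (waveDomain p τ m)) := by
  rw [laxTilde, sum_laxA_pow hτ hm hp0]
  rfl

theorem isRootWithLeading_laxTilde : IsRootWithLeading 1 (p 0) (laxTilde p τ m)
    ((dressed p τ m 1).map (diagHom (waveDomain p τ m))) := by
  refine isRootWithLeading_iff.mpr ⟨?_, fun a b => ?_, ?_⟩
  · rw [laxTilde_eq hτ hm hp0, ← dressed_one_pow hτ hm]
    exact (map_pow (diagHom (waveDomain p τ m)).mapMatrix _ _).symm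
  · exact mapCoeff_mem_ordLE _ (dressed_mem_ordLE 1 a b)
  · have hlead : matCoeff 1 ((dressed p τ m 1).map (diagHom (waveDomain p τ m))) =
        (pullback (diagMap p)).mapMatrix (matCoeff 1 (dressed p τ m 1)) := rfl
    rw [hlead, matCoeff_dressed, map_one, map_one, one_smul]

theorem laxTilde_evolution (j : ℕ+) :
    (laxTilde p τ m).map (mapCoeff (pderivT (some j)).toLinearMap.toAddMonoidHom) =
      ⁅(((dressed p τ m 1).map (diagHom (waveDomain p τ m))) ^ (j : ℕ)).map pos,
        laxTilde p τ m⁆ := by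
  have hpow : ((dressed p τ m 1).map (diagHom (waveDomain p τ m))) ^ (j : ℕ) =
      (dressed p τ m 1 ^ (j : ℕ)).map (diagHom (waveDomain p τ m)) :=
    (map_pow (diagHom (waveDomain p τ m)).mapMatrix _ _).symm
  rw [laxTilde_eq hτ hm hp0, map_mapCoeff_pderivT_diagHom, sum_dressed_evolution hτ hm, hpow,
    map_pos_diagHom, matrix_map_lie]

end LaxTilde

/-! ### The operators `W` -/

section DivPow

variable {𝕜 : Type*} [RCLike 𝕜] [NormedAlgebra 𝕜 ℂ] {κ : Type*} (V : TimeDomain 𝕜 (Option κ))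

theorem deriv_divPowX_succ (i : ℕ) : Differential.deriv (divPowX V (i + 1)) = divPowX V i := by
  have hderiv : Differential.deriv (divPowX V (i + 1)) = pderivT none (divPowX V (i + 1)) := rfl
  rw [hderiv, divPowX, divPowX, Derivation.map_smul, Derivation.leibniz_pow, pderivT_coordFn,
    smul_eq_mul, mul_one, Nat.add_sub_cancel, ← Nat.cast_smul_eq_nsmul ℂ, smul_smul,
    Nat.factorial_succ, Nat.cast_mul]
  congr 1
  field_simp [(i + 1).cast_ne_zero, i.factorial_ne_zero]

theorem divPowX_mul (i j : ℕ) :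
    divPowX V i * divPowX V j = ((i + j).choose i : ℤ) • divPowX V (i + j) := by
  have hfac : ((i + j).choose i : ℂ) * (i.factorial * j.factorial) = (i + j).factorial := by
    rw [Nat.choose_symm_add, ← mul_assoc]
    exact_mod_cast Nat.add_choose_mul_factorial_mul_factorial i j
  have hi : (i.factorial : ℂ) ≠ 0 := Nat.cast_ne_zero.mpr i.factorial_ne_zero
  have hj : (j.factorial : ℂ) ≠ 0 := Nat.cast_ne_zero.mpr j.factorial_ne_zero
  have hchoose : ((i + j).choose i : ℂ) ≠ 0 :=
    Nat.cast_ne_zero.mpr (Nat.choose_pos (Nat.le_add_right i j)).ne'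
  rw [divPowX, divPowX, divPowX, smul_mul_smul_comm, ← pow_add, natCast_zsmul,
    ← Nat.cast_smul_eq_nsmul ℂ, smul_smul, ← hfac]
  congr 1
  field_simp

theorem isDividedPowerSeq_divPowX : IsDividedPowerSeq (divPowX V) where
  zero := by simp [divPowX]
  deriv_succ := deriv_divPowX_succ V
  mul := divPowX_mul V

end DivPow

section DiffOp

open PsiDO

variable {R : Type*} [CommRing R]

theorem monoNeg_mem_ordLE (a : R) (n : ℤ) : monoNeg a n ∈ ordLE R n := mono_mem_ordLE _ n

theorem diffOp_mem_ordLE (n : ℕ) (w : ℕ → R) : diffOp n w ∈ ordLE R ((n : ℤ) - 1) :=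
  sum_mem fun _ hj => ordLE_mono
    (Int.le_sub_one_of_lt (Nat.cast_lt.mpr (Finset.mem_range.mp hj))) (monoNeg_mem_ordLE _ _)

theorem monoNeg_negCoeff (A : PsiDO R) (j : ℕ) : monoNeg (negCoeff A j) j = mono (A.coeff j) j := by
  rw [monoNeg, negCoeff, negOnePow_natCast, zsmul_eq_mul]
  push_cast
  rw [← mul_assoc, ← mul_pow, neg_one_mul, neg_neg, one_pow, one_mul]

variable [Differential R]

theorem diffOp_negCoeff {n : ℕ} {A : PsiDO R} (hA : A ∈ ordLE R ((n : ℤ) - 1))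
    (hA' : A ∈ diffOps R) : diffOp n (negCoeff A) = A := by
  ext1 i
  simp only [diffOp, monoNeg_negCoeff, coeff_sum, coeff_mono]
  rcases lt_or_ge i 0 with hi | hi
  · rw [hA' i hi, Finset.sum_eq_zero fun j _ => if_neg (by omega)]
  · lift i to ℕ using hi
    simp only [Nat.cast_inj, Finset.sum_ite_eq, Finset.mem_range, ite_eq_left_iff, not_lt]
    exact fun hi => (hA i (by omega)).symm

theorem pos_mem_diffOps (A : PsiDO R) : A.pos ∈ diffOps R := fun i hi => by
  rw [coeff_pos, if_neg hi.not_ge]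

theorem pos_eq_self_of_mem_diffOps {A : PsiDO R} (hA : A ∈ diffOps R) : A.pos = A := by
  ext1 i
  rw [coeff_pos]
  exact ite_eq_left_iff.mpr fun hi => (hA i (not_le.mp hi)).symm

end DiffOp

section Solution

open PsiDO

variable {𝕜 : Type*} [RCLike 𝕜] [NormedAlgebra 𝕜 ℂ] {r : ℕ} [NeZero r] {p : Fin r → ℕ}
  {Ω : TimeDomain 𝕜 (Fin r × ℕ+)} {τ : (Fin r → ℤ) → SmoothFn Ω} {m : Fin r → ℤ} {ε : 𝕜}

theorem solW12_apply (a : Blk1 p) (b : Blk2 p) : solW12 p τ m ε a b =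
    diffOp (p b.1) fun j => ∑ i ∈ Finset.range (j + 1), divPowX (solDomain p τ m ε) i *
      -solQ p τ m ε 1 a.1 b.1 (j - i + 1) := by
  refine congrArg (diffOp (p b.1)) (funext fun j => ?_)
  exact (Finset.sum_neg_distrib _).symm.trans
    (Finset.sum_congr rfl fun i _ => (mul_neg (divPowX (solDomain p τ m ε) i) _).symm)

theorem solW21_apply (a : Blk2 p) (b : Blk1 p) : solW21 p τ m ε a b =
    ∑ j ∈ Finset.range (p a.1), ∑ i ∈ Finset.range (j + 1), mono 1 (j : ℤ) *
      mono (solQ p τ m ε (-1) b.1 a.1 (j - i + 1) * divPowX (solDomain p τ m ε) i) 0 := by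
  refine diffOp_negCoeff (sum_mem fun j hj => sum_mem fun i _ => ?_)
    (sum_mem fun j _ => sum_mem fun i _ =>
      mul_mem (mono_mem_diffOps _ (Int.natCast_nonneg j)) (mono_mem_diffOps _ le_rfl))
  have hj := Finset.mem_range.mp hj
  exact ordLE_mono (by omega) (mul_mem_ordLE (mono_mem_ordLE _ _) (mono_mem_ordLE _ 0))

theorem solW_product_mem_ordLE (hp : ∀ a, p a ≤ p 0) :
    solW12 p τ m ε * negDq p τ m ε * solW21 p τ m ε ∈
      (ordLE (SmoothFn (solDomain p τ m ε)) ((p 0 : ℤ) - 1)).matrix := by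
  intro a b
  rw [Matrix.mul_apply]
  refine sum_mem fun c _ => ?_
  rw [negDq, Matrix.mul_diagonal]
  have hc := hp c.1
  exact ordLE_mono (by omega) (mul_mem_ordLE (mul_mem_ordLE (diffOp_mem_ordLE (p c.1) _)
    (monoNeg_mem_ordLE _ _)) (diffOp_mem_ordLE (p c.1) _))

theorem solW_product_add_mem_diffOps (a b : Blk1 p) :
    (solW12 p τ m ε * negDq p τ m ε * solW21 p τ m ε) a b +
      ∑ c : Blk2 p, ∑ n ∈ Finset.range (p c.1), ((-1) ^ (p c.1 - n) : ℤ) •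
        (mono (solQ p τ m ε 1 a.1 c.1 (n + 1)) (-1) *
          mono (solQ p τ m ε (-1) b.1 c.1 (p c.1 - n)) 0) ∈
      diffOps (SmoothFn (solDomain p τ m ε)) := by
  rw [Matrix.mul_apply, ← Finset.sum_add_distrib]
  refine sum_mem fun c _ => ?_
  have h := (isDividedPowerSeq_divPowX
    (solDomain p τ m ε)).diffOp_mul_monoNeg_mul_sum_mem_diffOps (p c.1)
    (fun n => -solQ p τ m ε 1 a.1 c.1 (n + 1)) (fun n => solQ p τ m ε (-1) b.1 c.1 (n + 1))
  rw [negDq, Matrix.mul_diagonal, solW12_apply, solW21_apply]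
  convert h using 2
  refine Finset.sum_congr rfl fun n hn => ?_
  have hn := Finset.mem_range.mp hn
  rw [mono_neg, neg_mul, smul_neg, ← neg_smul, show p c.1 - n = p c.1 - 1 - n + 1 by omega,
    pow_succ, mul_neg_one]

/-- The substitution taking the reduced wave operators to their values at `-x`, `t̃`, `-∂`. -/
def solHom (p : Fin r → ℕ) (τ : (Fin r → ℤ) → SmoothFn Ω) (m : Fin r → ℤ) (ε : 𝕜) :
    PsiDO (SmoothFn (waveDomain p τ m)) →+* PsiDO (SmoothFn (solDomain p τ m ε)) :=
  (flipHom (laxDomain p τ m) ε).comp (diagHom (waveDomain p τ m))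

theorem coeff_solHom (A : PsiDO (SmoothFn (waveDomain p τ m))) (i : ℤ) :
    (solHom p τ m ε A).coeff i =
      (Int.negOnePow i : ℤ) • pullback (flipMap ε) (pullback (diagMap p) (A.coeff i)) := rfl

theorem solHom_mono (f : SmoothFn (waveDomain p τ m)) (n : ℤ) : solHom p τ m ε (mono f n) =
    (Int.negOnePow n : ℤ) • mono (pullback (flipMap ε) (pullback (diagMap p) f)) n := by
  ext1 i
  rw [coeff_solHom, coeff_zsmul, coeff_mono, coeff_mono]
  split_ifs with hi
  · rw [hi]
  · rw [map_zero, map_zero, smul_zero, smul_zero]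

theorem solHom_mem_ordLE {A : PsiDO (SmoothFn (waveDomain p τ m))} {n : ℤ}
    (hA : A ∈ ordLE (SmoothFn (waveDomain p τ m)) n) :
    solHom p τ m ε A ∈ ordLE (SmoothFn (solDomain p τ m ε)) n :=
  reflect_mem_ordLE _ (mapCoeff_mem_ordLE _ hA)

theorem solHom_mem_diffOps {A : PsiDO (SmoothFn (waveDomain p τ m))}
    (hA : A ∈ diffOps (SmoothFn (waveDomain p τ m))) :
    solHom p τ m ε A ∈ diffOps (SmoothFn (solDomain p τ m ε)) := fun i hi => by
  rw [coeff_solHom, hA i hi, map_zero, map_zero, smul_zero]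

theorem solHom_waveQ_mul_waveQNeg (a b c : Fin r) (n l : ℕ) :
    solHom p τ m ε (mono (waveQ p τ m 1 a c n) (-1) * mono (waveQNeg p τ m b c l) 0) =
      -(((-1) ^ l : ℤ) • (mono (solQ p τ m ε 1 a c n) (-1) *
        mono (solQ p τ m ε (-1) b c l) 0)) := by
  rw [map_mul, solHom_mono, solHom_mono, waveQNeg, map_zsmul, map_zsmul, mono_zsmul,
    Int.negOnePow_zero, Int.negOnePow_neg, Int.negOnePow_one, Units.val_neg, Units.val_one,
    one_smul, neg_smul, one_smul, neg_mul, mul_smul_comm]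
  rfl

section Bilinear

variable {k : ℤ} (hτ : IsTauFunction p k τ) (hm : ∑ a, m a = k) (hp0 : 0 < p 0)

include hτ hm hp0

theorem laxFlip_eq : laxFlip p τ m ε = (dressed p τ m (p 0)).map (solHom p τ m ε) := by
  rw [laxFlip, laxTilde_eq hτ hm hp0]
  rfl

theorem laxFlip_sub_mem_diffOps (a b : Blk1 p) : laxFlip p τ m ε a b -
    ∑ c : Blk2 p, ∑ n ∈ Finset.range (p c.1), ((-1) ^ (p c.1 - n) : ℤ) •
      (mono (solQ p τ m ε 1 a.1 c.1 (n + 1)) (-1) *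
        mono (solQ p τ m ε (-1) b.1 c.1 (p c.1 - n)) 0) ∈
    diffOps (SmoothFn (solDomain p τ m ε)) := by
  have h := solHom_mem_diffOps (ε := ε) (dressed_add_mem_diffOps hτ hm a b)
  simp only [map_add, map_sum, solHom_waveQ_mul_waveQNeg, Finset.sum_neg_distrib] at h
  rw [laxFlip_eq hτ hm hp0, Matrix.map_apply, sub_eq_add_neg]
  exact h

theorem laxFlip_sub_negDp_mem_ordLE : laxFlip p τ m ε - negDp p τ m ε ∈
    (ordLE (SmoothFn (solDomain p τ m ε)) ((p 0 : ℤ) - 1)).matrix := by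
  rw [laxFlip_eq hτ hm hp0]
  refine mem_matrix_ordLE_pred (sub_mem (fun a b => ?_) fun a b => ?_) ?_
  · exact solHom_mem_ordLE (dressed_mem_ordLE _ a b)
  · rw [negDp, Matrix.diagonal_apply]
    split_ifs
    exacts [monoNeg_mem_ordLE _ _, zero_mem _]
  · ext1 a b
    have hlead : (dressed p τ m (p 0) a b).coeff (p 0) = (1 : Matrix (Blk1 p) (Blk1 p) _) a b :=
      congrFun (congrFun (matCoeff_dressed (p := p) (τ := τ) (m := m) (p 0)) a) b
    rw [matCoeff_apply, Matrix.sub_apply, coeff_sub, Matrix.map_apply, coeff_solHom, hlead, negDp,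
      Matrix.diagonal_apply, Matrix.one_apply, Matrix.zero_apply]
    split_ifs
    · rw [map_one, map_one, monoNeg, coeff_mono, if_pos rfl, sub_self]
    · rw [map_zero, map_zero, smul_zero, coeff_zero, sub_zero]

theorem solW11_eq (hp : ∀ a, p a ≤ p 0) : solW11 p τ m ε =
    -(laxFlip p τ m ε).map pos + negDp p τ m ε -
      (solW12 p τ m ε * negDq p τ m ε * solW21 p τ m ε).map pos := by
  ext1 a b
  refine diffOp_negCoeff (fun i hi => ?_) (sub_mem (add_mem (neg_mem (pos_mem_diffOps _)) ?_)
    (pos_mem_diffOps _))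
  · have hL := laxFlip_sub_negDp_mem_ordLE (ε := ε) hτ hm hp0 a b i hi
    have hP := solW_product_mem_ordLE (τ := τ) (m := m) (ε := ε) hp a b i hi
    rw [Matrix.sub_apply, coeff_sub, sub_eq_zero] at hL
    rw [Matrix.sub_apply, Matrix.add_apply, Matrix.neg_apply, Matrix.map_apply, Matrix.map_apply,
      coeff_sub, coeff_add, coeff_neg, coeff_pos, coeff_pos, if_pos (by omega), if_pos (by omega),
      hP, hL, neg_add_cancel, sub_zero]
  · rw [negDp, Matrix.diagonal_apply]
    split_ifs
    exacts [mono_mem_diffOps _ (Int.natCast_nonneg _), zero_mem _]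

theorem map_pos_laxFlip_add : (laxFlip p τ m ε).map pos +
    (solW12 p τ m ε * negDq p τ m ε * solW21 p τ m ε).map pos =
      laxFlip p τ m ε + solW12 p τ m ε * negDq p τ m ε * solW21 p τ m ε := by
  ext1 a b
  have hmem := add_mem (laxFlip_sub_mem_diffOps (ε := ε) hτ hm hp0 a b)
    (solW_product_add_mem_diffOps (τ := τ) (m := m) (ε := ε) a b)
  rw [sub_add_add_cancel] at hmem
  exact (map_add posHom _ _).symm.trans (pos_eq_self_of_mem_diffOps hmem)

theorem laxSol_eq (hp : ∀ a, p a ≤ p 0) : laxSol p τ m ε = -laxFlip p τ m ε := by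
  have hpos := map_pos_laxFlip_add (ε := ε) hτ hm hp0
  rw [← eq_sub_iff_add_eq] at hpos
  rw [laxSol, solW11_eq hτ hm hp0 hp, hpos]
  abel

end Bilinear

end Solution

end

theorem mainTheorem6_general {𝕜 : Type*} [RCLike 𝕜] [NormedAlgebra 𝕜 ℂ] {r : ℕ} [NeZero r]
    (p : Fin r → ℕ) (hp : ∀ a, p a ≤ p 0) (hp0 : 0 < p 0)
    (k : ℤ) (Ω : TimeDomain 𝕜 (Fin r × ℕ+)) (τ : (Fin r → ℤ) → SmoothFn Ω)
    (hτ : IsTauFunction p k τ) (m : Fin r → ℤ) (hm : ∑ a, m a = k) :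
    IsUnit (waveQ11 p τ m) ∧
    SolvesLax 1 (p 0) (laxTilde p τ m) ∧
    ∀ ε : 𝕜, ε ^ p 0 = -1 →
      laxSol p τ m ε = -laxFlip p τ m ε ∧
      SolvesLax (-algebraMap 𝕜 ℂ ε) (p 0) (laxSol p τ m ε) := by
  have hroot := isRootWithLeading_laxTilde hτ hm hp0
  have hevol := laxTilde_evolution hτ hm hp0
  refine ⟨isUnit_waveQ11 hτ hm, solvesLax_of_root one_ne_zero hp0 hroot hevol, fun ε hε => ?_⟩
  have hsol := laxSol_eq (ε := ε) hτ hm hp0 hp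
  exact ⟨hsol, hsol ▸ solvesLax_flip hp0 hε hroot hevol⟩

theorem mainTheorem6 {𝕜 : Type*} [RCLike 𝕜] [NormedAlgebra 𝕜 ℂ] {r : ℕ} [NeZero r]
    (p : Fin r → ℕ) (hp : Antitone p) (hp_pos : ∀ a, 0 < p a)
    (k : ℤ) (Ω : TimeDomain 𝕜 (Fin r × ℕ+)) (τ : (Fin r → ℤ) → SmoothFn Ω)
    (hτ : IsTauFunction p k τ) (m : Fin r → ℤ) (hm : ∑ a, m a = k) :
    IsUnit (waveQ11 p τ m) ∧
    SolvesLax 1 (p 0) (laxTilde p τ m) ∧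
    ∀ ε : 𝕜, ε ^ p 0 = -1 →
      laxSol p τ m ε = -laxFlip p τ m ε ∧
      SolvesLax (-algebraMap 𝕜 ℂ ε) (p 0) (laxSol p τ m ε) :=
  mainTheorem6_general p (fun a => hp (Fin.zero_le a)) (hp_pos 0) k Ω τ hτ m hm
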